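/- Let $d\ge 1$, $\alpha>d$, $\lambda>0$, $\tau>1$, and suppose that $\gamma:=\alpha(\tau-1)/d\in(1,2)$. Let $W$ be a real random variable with $\mathbb P(W\ge 1)=1$ and $\mathbb P(W>t)=\ell(t)\,t^{-(\tau-1)}$ for $t>0$, where $\ell$ varies slowly at infinity (that is, $\lim_{t\to\infty}\ell(ct)/\ell(t)=1$ for every $c>0$). Let $L\ge 0$ be a real random variable with distribution function $F_L(t)=\mathbb P(L\le t)$ and generalised inverse $F_L^{(-1)}(y)=\inf\{t\in\mathbb R: F_L(t)\ge y\}$. Scale-free percolation on $\mathbb Z^d$ is the following random graph. The vertices $x\in\mathbb Z^d$ carry i.i.d. vertex-weights $W_x$ distributed as $W$. Any two vertices at Euclidean distance $\|x-y\|=1$ are joined by an edge. Conditionally on the vertex-weights, every pair $x,y$ with $\|x-y\|>1$ is joined by an edge with probability $1-\exp\{-\lambda W_xW_y/\|x-y\|^{\alpha}\}$, independently of all other pairs. Finally every edge $e$ of the graph receives an edge-weight $L_e$; the edge-weights are i.i.d. copies of $L$, independent of the graph and of the vertex-weights. For $x,y\in\mathbb Z^d$ let $\mathrm d_L(x,y)=\inf_\pi\sum_{e\in\pi}L_e$,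 the infimum being over all paths $\pi$ from $x$ to $y$ in the graph. Suppose that $$\mathbf I(L):=\int_0^\infty F_L^{(-1)}\big(\exp\{-\mathrm e^{y}\}\big)\,\mathrm dy=\infty .$$ Let $\underline e\in\mathbb R^d$ be any vector with Euclidean norm $1$, and for real $m$ let $\lfloor m\underline e\rfloor\in\mathbb Z^d$ be obtained from $m\underline e$ by taking integer parts coordinatewise. Then, as $m\to\infty$, $$\frac{\mathrm d_L(0,\lfloor m\underline e\rfloor)}{\displaystyle\sum_{k=1}^{\lfloor \log\log m/|\log(\gamma-1)|\rfloor}2\,F_L^{(-1)}\big(\exp\{-1/(\gamma-1)^k\}\big)}\ \longrightarrow\ 1\qquad\text{in probability.}$$ -/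

import Mathlib

open MeasureTheory ProbabilityTheory Filter Set
open scoped Topology ENNReal

namespace ScaleFreePercolation

noncomputable section

/-- The vertex set `ℤ^d`. -/
abbrev Vert (d : ℕ) : Type := Fin d → ℤ

/-- The Euclidean distance `‖x - y‖` of two vertices of `ℤ^d`. -/
def eucDist {d : ℕ} (x y : Vert d) : ℝ :=
  Real.sqrt (∑ i, ((x i : ℝ) - (y i : ℝ)) ^ 2)

lemma eucDist_comm {d : ℕ} (x y : Vert d) : eucDist x y = eucDist y x := by
  unfold eucDist
  congr 1
  exact Finset.sum_congr rfl fun i _ => by ring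

/-- The vertex `⌊v⌋` of `ℤ^d` obtained by taking integer parts coordinatewise. -/
def floorVert {d : ℕ} (v : EuclideanSpace ℝ (Fin d)) : Vert d := fun i => ⌊v i⌋

/-- `ℓ` varies slowly at infinity. -/
def SlowlyVarying (ℓ : ℝ → ℝ) : Prop :=
  ∀ c : ℝ, 0 < c → Tendsto (fun t => ℓ (c * t) / ℓ t) atTop (𝓝 1)

/-- The law `μ` on `ℝ` has the tail `μ (t, ∞) = ℓ(t) / t ^ (τ - 1)` for a slowly varying `ℓ`. -/
def PowerLawTail (μ : Measure ℝ) (τ : ℝ) : Prop :=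
  ∃ ℓ : ℝ → ℝ, SlowlyVarying ℓ ∧ ∀ t : ℝ, 0 < t → μ.real (Ioi t) = ℓ t / t ^ (τ - 1)

/-- The generalised inverse `F^{(-1)}(y) = inf {t ∈ ℝ : F(t) ≥ y}`. -/
def genInv (F : ℝ → ℝ) (y : ℝ) : ℝ := sInf {t : ℝ | y ≤ F t}

/-- The integral `I(L) = ∫_0^∞ F_L^{(-1)}(exp(-e^y)) dy ∈ [0, ∞]`, for an edge-weight `L ≥ 0` with
law `ν`. -/
def explosionIntegral (ν : Measure ℝ) : ℝ≥0∞ :=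
  ∫⁻ y in Ioi (0 : ℝ), ENNReal.ofReal (genInv (cdf ν) (Real.exp (-Real.exp y)))

/-- A realisation of all the randomness: the vertex-weights `W_x`, a number `U_e ∈ [0, 1]` for each
unordered pair `e` of vertices, which decides whether the edge `e` is present, and an edge-weight
`L_e` for each unordered pair `e`, which is used only if the edge `e` is present. -/
abbrev Sample (d : ℕ) : Type :=
  (Vert d → ℝ) × (Sym2 (Vert d) → unitInterval) × (Sym2 (Vert d) → ℝ)

/-- The vertex-weight of `x`. -/
def vertexWeight {d : ℕ} (ω : Sample d) (x : Vert d) : ℝ := ω.1 x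

/-- The uniform variable attached to the pair `e`. -/
def edgeUniform {d : ℕ} (ω : Sample d) (e : Sym2 (Vert d)) : ℝ := ω.2.1 e

/-- The edge-weight of `e`. -/
def edgeWeight {d : ℕ} (ω : Sample d) (e : Sym2 (Vert d)) : ℝ := ω.2.2 e

/-- The law of the model: the `W_x` are i.i.d. with law `μ`, the `U_e` are i.i.d. uniform on
`[0, 1]`, the `L_e` are i.i.d. with law `ν`, and the three families are independent. -/
def law (d : ℕ) (μ ν : Measure ℝ) [IsProbabilityMeasure μ] [IsProbabilityMeasure ν] :
    Measure (Sample d) :=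
  (Measure.infinitePi fun _ : Vert d => μ).prod
    ((Measure.infinitePi fun _ : Sym2 (Vert d) => (volume : Measure unitInterval)).prod
      (Measure.infinitePi fun _ : Sym2 (Vert d) => ν))

/-- The connection probability `1 - exp(-λ W_x W_y / ‖x - y‖^α)`. -/
def connProb {d : ℕ} (lam α : ℝ) (ω : Sample d) (x y : Vert d) : ℝ :=
  1 - Real.exp (-(lam * (vertexWeight ω x * vertexWeight ω y / eucDist x y ^ α)))

lemma connProb_comm {d : ℕ} (lam α : ℝ) (ω : Sample d) (x y : Vert d) :
    connProb lam α ω x y = connProb lam α ω y x := by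
  unfold connProb
  rw [eucDist_comm, mul_comm (vertexWeight ω x)]

/-- The random graph: nearest neighbours are always joined; given the vertex-weights, any other
pair `x, y` is joined, independently of all other pairs, with probability `connProb`. -/
def graph {d : ℕ} (lam α : ℝ) (ω : Sample d) : SimpleGraph (Vert d) where
  Adj x y := eucDist x y = 1 ∨
    (1 < eucDist x y ∧ edgeUniform ω s(x, y) < connProb lam α ω x y)
  symm := ⟨fun x y h => by
    rwa [eucDist_comm y x, Sym2.eq_swap, connProb_comm lam α ω y x]⟩
  loopless := ⟨fun x h => by
    have h0 : eucDist x x = 0 := by simp [eucDist]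
    rw [h0] at h
    rcases h with h | h
    · exact zero_ne_one h
    · exact absurd h.1 (by norm_num)⟩

/-- The `L`-distance `d_L(x, y)`: the infimum, over all paths from `x` to `y` in the random graph,
of the sum of the edge-weights along the path (infinite if there is no path). -/
def distL {d : ℕ} (lam α : ℝ) (ω : Sample d) (x y : Vert d) : ℝ≥0∞ :=
  ⨅ p : (graph lam α ω).Path x y,
    (((p : (graph lam α ω).Walk x y).edges).map fun e => ENNReal.ofReal (edgeWeight ω e)).sum

/-- The normalisation `∑_{k=1}^{⌊log log m / |log(γ-1)|⌋} 2 F_L^{(-1)}(exp(-1/(γ-1)^k))`. -/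
def normalisation (ν : Measure ℝ) (γ m : ℝ) : ℝ :=
  ∑ k ∈ Finset.Icc 1 ⌊Real.log (Real.log m) / |Real.log (γ - 1)|⌋₊,
    2 * genInv (cdf ν) (Real.exp (-(1 / (γ - 1) ^ k)))

end

end ScaleFreePercolation

/-!
Write `F` for the distribution function of the edge-weights and `h y = F⁻¹(exp(-e ^ y))` for the
integrand of the explosion integral (`profile`); `h` is nonnegative and antitone. Up to a bounded
error the normalisation is `2 / |log (γ - 1)|` times `H m = ∫ h` over `[0, log log m]`
(`normalisation_bounds`), and `H m → ∞` because the explosion integral is infinite. It is therefore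
enough to show that, with probability close to one, the `L`-distance is at least
`(2 / a) H m - C` for every `a > |log (γ - 1)|` (`distL_lower_bound`) and at most `(2 / a) H m + C`
for every `0 < a < |log (γ - 1)|` (`distL_upper_bound`).

*Lower bound.* Put `c = e ^ a > 1 / (γ - 1)`. A first moment bound over self-avoiding paths
(`law_existsPath_le`) rests on `min 1 x ≤ x ^ θ`, with `θ` slightly above `d / α`: it turns the
connection probabilities into a product, so that the weights decouple into truncated moments and the
sum over paths into a power of a finite lattice sum. It shows that, outside an event of small
probability, the vertices at graph distance `k` from a given centre have weight at most
`exp (A c ^ k)`, and the edges between the graph spheres of radii `k` and `k + 1` have Euclidean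
length at most `exp (A B c ^ (k + 1))` and edge-weight at least `F⁻¹(exp(-A B c ^ (k + 1)))`
(`badGrowth`, `law_badGrowth_le`). Hence the graph balls around `0` and `⌊m e⌋` of a radius close to
`log log m / a` are disjoint, and a path between the centres has to leave one ball and enter the
other (`two_sided_cost_le`). Its cost is at least twice the sum of the edge-weight bounds, which is
compared with `H m`.

*Upper bound.* Put `c = e ^ a < 1 / (γ - 1)` and consider the radii `ρ i = exp (s c ^ i)`, with `s`
in a bounded range chosen such that the last radius is `2 m`. A hub of level `i` is a vertex of
weight larger than `ρ i ^ κ` in the box of radius `ρ i`, where `κ < d / (τ - 1)`. As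
`κ (1 + 1 / c) > α`, hubs of consecutive levels are joined with probability at least `1 / 2`. The
next level contains so many hubs that all vertices of the box of radius `ρ i` have, simultaneously,
a potential neighbour among them along an edge of weight at most `F⁻¹(ρ (i + 1) ^ (-ξ))`; the same
is true for common neighbours of pairs, and the failure probability is smaller than any power of the
radius (`law_noMeet_le`). Thus hubs can be climbed from both ends until they meet in a common box
(`distL_le_of_notMem_noMeet`); the first hub is reached through nearest neighbours inside a box of
bounded radius. The cost of the climb is again compared with `H m`.
-/

namespace ScaleFreePercolation

/-! ### The generalised inverse and the profile -/

lemma cdf_eq_zero_of_neg {ν : Measure ℝ} [IsProbabilityMeasure ν] (hν0 : ν (Iio 0) = 0)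
    {t : ℝ} (ht : t < 0) : cdf ν t = 0 := by
  rw [cdf_eq_real, measureReal_def, measure_mono_null (Iic_subset_Iio.2 ht) hν0]
  rfl

lemma superlevel_cdf_subset {ν : Measure ℝ} [IsProbabilityMeasure ν] (hν0 : ν (Iio 0) = 0)
    {y : ℝ} (hy : 0 < y) : {t : ℝ | y ≤ cdf ν t} ⊆ Ici 0 := by
  intro t ht
  by_contra h
  have := cdf_eq_zero_of_neg hν0 (not_le.1 h)
  simp only [mem_ofPred_eq] at ht
  linarith

lemma superlevel_cdf_nonempty {ν : Measure ℝ} {y : ℝ} (hy : y < 1) :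
    {t : ℝ | y ≤ cdf ν t}.Nonempty :=
  (((tendsto_cdf_atTop ν).eventually (lt_mem_nhds hy)).exists).imp fun _ h => h.le

lemma genInv_nonneg {ν : Measure ℝ} [IsProbabilityMeasure ν] (hν0 : ν (Iio 0) = 0)
    {y : ℝ} (hy : 0 < y) : 0 ≤ genInv (cdf ν) y :=
  Real.sInf_nonneg fun _ ht => superlevel_cdf_subset hν0 hy ht

lemma genInv_mono {ν : Measure ℝ} [IsProbabilityMeasure ν] (hν0 : ν (Iio 0) = 0)
    {y z : ℝ} (hy : 0 < y) (hyz : y ≤ z) (hz : z < 1) :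
    genInv (cdf ν) y ≤ genInv (cdf ν) z :=
  csInf_le_csInf ⟨0, superlevel_cdf_subset hν0 hy⟩ (superlevel_cdf_nonempty hz)
    fun _ ht => hyz.trans ht

/-- The infimum defining the generalised inverse is attained, because distribution functions are
right continuous. -/
lemma le_cdf_genInv {ν : Measure ℝ} {y : ℝ} (hy1 : y < 1) : y ≤ cdf ν (genInv (cdf ν) y) := by
  have hright : Tendsto (cdf ν) (𝓝[>] (genInv (cdf ν) y)) (𝓝 (cdf ν (genInv (cdf ν) y))) :=
    ((cdf ν).right_continuous _).mono_left (nhdsWithin_mono _ Ioi_subset_Ici_self)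
  refine ge_of_tendsto hright ?_
  filter_upwards [self_mem_nhdsWithin] with t ht
  obtain ⟨s, hs, hst⟩ := exists_lt_of_csInf_lt (superlevel_cdf_nonempty hy1) ht
  exact le_trans hs (monotone_cdf ν hst.le)

/-- For the closed half-line this fails in general: the law may have an atom at `F⁻¹(y)`. -/
lemma measure_Iio_genInv_le {ν : Measure ℝ} [IsProbabilityMeasure ν] (hν0 : ν (Iio 0) = 0)
    {y : ℝ} (hy : 0 < y) : ν (Iio (genInv (cdf ν) y)) ≤ ENNReal.ofReal y := by
  set g := genInv (cdf ν) y
  obtain ⟨u, hu, hult, hulim⟩ := exists_seq_strictMono_tendsto g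
  have hU : Iio g = ⋃ n, Iic (u n) := by
    ext x
    simp only [mem_Iio, mem_iUnion, mem_Iic]
    constructor
    · intro hx
      exact ((hulim.eventually (lt_mem_nhds hx)).exists).imp fun _ h => h.le
    · rintro ⟨n, hn⟩
      exact hn.trans_lt (hult n)
  have hmono : Monotone fun n => Iic (u n) := fun i j hij => Iic_subset_Iic.2 (hu.monotone hij)
  rw [hU, hmono.measure_iUnion]
  refine iSup_le fun n => ?_
  rw [← ofReal_cdf]
  refine ENNReal.ofReal_le_ofReal ?_
  by_contra h
  have : g ≤ u n := csInf_le ⟨0, superlevel_cdf_subset hν0 hy⟩ (not_le.1 h).le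
  exact absurd (hult n) (not_lt.2 this)

/-- The function `y ↦ F^{(-1)}(exp(-e^y))`, the integrand of the explosion integral. -/
noncomputable def profile (ν : Measure ℝ) (y : ℝ) : ℝ :=
  genInv (cdf ν) (Real.exp (-Real.exp y))

lemma exp_neg_exp_lt_one (y : ℝ) : Real.exp (-Real.exp y) < 1 := by
  rw [Real.exp_lt_one_iff, neg_lt_zero]
  exact Real.exp_pos y

lemma profile_nonneg {ν : Measure ℝ} [IsProbabilityMeasure ν] (hν0 : ν (Iio 0) = 0) (y : ℝ) :
    0 ≤ profile ν y := genInv_nonneg hν0 (Real.exp_pos _)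

lemma profile_antitone {ν : Measure ℝ} [IsProbabilityMeasure ν] (hν0 : ν (Iio 0) = 0) :
    Antitone (profile ν) := fun _ _ hxy =>
  genInv_mono hν0 (Real.exp_pos _)
    (Real.exp_le_exp.2 (neg_le_neg (Real.exp_le_exp.2 hxy))) (exp_neg_exp_lt_one _)

/-! ### Sums and integrals of antitone functions -/

section Antitone

variable {h : ℝ → ℝ}

lemma sum_le_integral_of_antitone (hh : Antitone h) {a : ℝ} (ha : 0 < a) (b : ℝ) (n : ℕ) :
    ∑ i ∈ Finset.range n, h (b + (i + 1) * a) ≤ (1 / a) * ∫ x in b..(b + n * a), h x := by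
  have hg : Antitone fun x => h (b + a * x) := fun x y hxy =>
    hh (by have := mul_le_mul_of_nonneg_left hxy ha.le; linarith)
  have := AntitoneOn.sum_le_integral (x₀ := 0) (a := n) (hg.antitoneOn _)
  rw [intervalIntegral.integral_comp_add_mul _ ha.ne'] at this
  simp only [smul_eq_mul, zero_add, mul_zero, add_zero] at this
  rw [one_div, mul_comm (n : ℝ) a]
  refine le_trans (le_of_eq ?_) this
  refine Finset.sum_congr rfl fun i _ => ?_
  push_cast
  rw [mul_comm a]

lemma integral_le_sum_of_antitone (hh : Antitone h) {a : ℝ} (ha : 0 < a) (b : ℝ) (n : ℕ) :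
    (1 / a) * ∫ x in (b + a)..(b + (n + 1) * a), h x ≤
      ∑ i ∈ Finset.range n, h (b + (i + 1) * a) := by
  have hg : Antitone fun x => h (b + a * x) := fun x y hxy =>
    hh (by have := mul_le_mul_of_nonneg_left hxy ha.le; linarith)
  have := AntitoneOn.integral_le_sum (x₀ := 1) (a := n) (hg.antitoneOn _)
  rw [intervalIntegral.integral_comp_add_mul _ ha.ne'] at this
  simp only [smul_eq_mul, mul_one] at this
  rw [one_div, add_comm (n : ℝ) 1, mul_comm (1 + (n : ℝ)) a]
  refine this.trans (le_of_eq ?_)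
  refine Finset.sum_congr rfl fun i _ => ?_
  rw [mul_comm a, add_comm (1 : ℝ)]

lemma integral_le_of_antitone (hh : Antitone h) {b c : ℝ} (hbc : b ≤ c) :
    ∫ x in b..c, h x ≤ (c - b) * h b := by
  have := intervalIntegral.integral_mono_on (μ := volume) hbc hh.intervalIntegrable
    (intervalIntegrable_const (c := h b)) fun x hx => hh hx.1
  simpa using this

/-- A shift of the endpoints costs a bounded amount, as `h` is bounded on `[0, ∞)`. -/
lemma integral_shift_le (hh : Antitone h) (h0 : ∀ x, 0 ≤ h x) {b T U s : ℝ} (hb : 0 ≤ b)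
    (hU : 0 ≤ U) (hs : 0 ≤ s) (hT : T ≤ U + s) :
    ∫ x in b..T, h x ≤ (∫ x in (0 : ℝ)..U, h x) + s * h 0 := by
  have hI : ∀ u v : ℝ, IntervalIntegrable h volume u v := fun _ _ => hh.intervalIntegrable
  have h1 : ∫ x in b..T, h x = (∫ x in (0 : ℝ)..(U + s), h x) - (∫ x in (0 : ℝ)..b, h x)
      - ∫ x in T..(U + s), h x := by
    have e1 := intervalIntegral.integral_add_adjacent_intervals (hI 0 b) (hI b T)
    have e2 := intervalIntegral.integral_add_adjacent_intervals (hI 0 T) (hI T (U + s))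
    linarith
  have h2 := intervalIntegral.integral_nonneg (μ := volume) hb (f := h) fun x _ => h0 x
  have h3 := intervalIntegral.integral_nonneg (μ := volume) hT (f := h) fun x _ => h0 x
  have h4 := intervalIntegral.integral_add_adjacent_intervals (hI 0 U) (hI U (U + s))
  have h5 := integral_le_of_antitone hh (b := U) (c := U + s) (by linarith)
  have h6 := hh hU
  have : (U + s - U) * h U ≤ s * h 0 := by
    rw [add_sub_cancel_left]; exact mul_le_mul_of_nonneg_left h6 hs
  linarith

lemma tendsto_integral_of_lintegral_eq_top (hh : Antitone h) (h0 : ∀ x, 0 ≤ h x)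
    (htop : ∫⁻ y in Ioi (0 : ℝ), ENNReal.ofReal (h y) = ⊤) :
    Tendsto (fun T => ∫ x in (0 : ℝ)..T, h x) atTop atTop := by
  have hmono : MonotoneOn (fun T => ∫ x in (0 : ℝ)..T, h x) (Ici 0) := by
    intro u hu v hv huv
    exact intervalIntegral.integral_mono_interval le_rfl hu huv
      (Eventually.of_forall h0) hh.intervalIntegrable
  by_contra hcon
  have hbdd : ∃ B : ℝ, ∀ T, 0 ≤ T → ∫ x in (0 : ℝ)..T, h x ≤ B := by
    by_contra! hB
    refine hcon (tendsto_atTop.2 fun B => ?_)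
    obtain ⟨T, hT0, hT⟩ := hB B
    filter_upwards [eventually_ge_atTop T] with U hU
    exact hT.le.trans (hmono hT0 (hT0.trans hU) hU)
  obtain ⟨B, hB⟩ := hbdd
  have hU : Ioi (0 : ℝ) = ⋃ n : ℕ, Ioc (0 : ℝ) n := by
    ext x
    simp only [mem_Ioi, mem_iUnion, mem_Ioc]
    exact ⟨fun hx => ⟨⌈x⌉₊, hx, Nat.le_ceil x⟩, fun ⟨_, hx, _⟩ => hx⟩
  have hle : ∫⁻ y in Ioi (0 : ℝ), ENNReal.ofReal (h y) ≤ ENNReal.ofReal B := by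
    rw [hU, setLIntegral_iUnion_of_directed (fun x => ENNReal.ofReal (h x))
      (Monotone.directed_le fun i j hij => Ioc_subset_Ioc_right (by exact_mod_cast hij))]
    refine iSup_le fun n => ?_
    have hint : IntegrableOn h (Ioc (0 : ℝ) n) :=
      (intervalIntegrable_iff_integrableOn_Ioc_of_le (Nat.cast_nonneg n)).1
        hh.intervalIntegrable
    rw [← ofReal_integral_eq_lintegral_ofReal hint (Eventually.of_forall h0),
      ← intervalIntegral.integral_of_le (Nat.cast_nonneg n)]
    exact ENNReal.ofReal_le_ofReal (hB n (Nat.cast_nonneg n))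
  rw [htop] at hle
  exact absurd hle (by simp)

end Antitone

/-! ### The normalisation -/

/-- Replacing the sum in the normalisation by an integral costs only a bounded error. -/
lemma normalisation_bounds {ν : Measure ℝ} [IsProbabilityMeasure ν] (hν0 : ν (Iio 0) = 0)
    {γ : ℝ} (hγ1 : 1 < γ) (hγ2 : γ < 2) :
    ∃ C : ℝ, ∀ᶠ m : ℝ in atTop,
      |normalisation ν γ m -
        2 / |Real.log (γ - 1)| * ∫ x in (0 : ℝ)..Real.log (Real.log m), profile ν x| ≤ C := by
  set a := |Real.log (γ - 1)| with ha_def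
  have hlog : Real.log (γ - 1) < 0 := Real.log_neg (by linarith) (by linarith)
  have ha : 0 < a := abs_pos.2 hlog.ne
  have hinv : ∀ k : ℕ, 1 / (γ - 1) ^ k = Real.exp (k * a) := by
    intro k
    rw [ha_def, abs_of_neg hlog, mul_neg, Real.exp_neg, Real.exp_nat_mul,
      Real.exp_log (by linarith), one_div]
  have hanti := profile_antitone hν0
  have hnn := profile_nonneg hν0
  refine ⟨2 * profile ν 0 + 2 / a * (a * profile ν 0), ?_⟩
  filter_upwards [(Real.tendsto_log_atTop.comp Real.tendsto_log_atTop).eventually_ge_atTop 0]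
    with m hm
  simp only [Function.comp] at hm
  set T := Real.log (Real.log m)
  set n := ⌊T / a⌋₊ with hn
  have hnorm : normalisation ν γ m = 2 * ∑ i ∈ Finset.range n, profile ν (0 + (i + 1) * a) := by
    rw [normalisation, ← Finset.mul_sum, Finset.range_eq_Ico,
      ← Finset.Ico_add_one_right_eq_Icc]
    have := Finset.sum_Ico_add' (fun i : ℕ =>
      genInv (cdf ν) (Real.exp (-(1 / (γ - 1) ^ i)))) 0 n 1
    rw [zero_add] at this
    rw [← this]
    simp only [hinv, profile, zero_add, hn, T]
    push_cast
    rfl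
  have hnT : (n : ℝ) * a ≤ T := by
    have := Nat.floor_le (div_nonneg hm ha.le)
    rwa [le_div_iff₀ ha] at this
  have hnT' : T ≤ ((n : ℝ) + 1) * a := by
    have := (Nat.lt_floor_add_one (T / a)).le
    rwa [div_le_iff₀ ha] at this
  have up := sum_le_integral_of_antitone hanti ha 0 n
  have lo := integral_le_sum_of_antitone hanti ha 0 n
  have up2 := integral_shift_le hanti hnn (b := 0) (T := 0 + n * a) (U := T) (s := 0) le_rfl hm
    le_rfl (by linarith)
  have hsplit := intervalIntegral.integral_add_adjacent_intervals
    (hanti.intervalIntegrable (μ := volume) (a := 0) (b := a))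
    (hanti.intervalIntegrable (μ := volume) (a := a) (b := (n + 1) * a))
  have lo2 := integral_shift_le hanti hnn (b := 0) (T := T) (U := (n + 1) * a) (s := 0) le_rfl
    (by positivity) le_rfl (by linarith)
  have lo3 := integral_le_of_antitone hanti ha.le (b := 0)
  simp only [zero_add] at lo up up2
  simp only [zero_add] at hnorm
  have h0 := hnn 0
  have e1 : 2 / a * ∫ x in (0 : ℝ)..T, profile ν x
      = 2 * ((1 / a) * ∫ x in (0 : ℝ)..T, profile ν x) := by ring
  have e2 : (1 / a) * ∫ x in (0 : ℝ)..T, profile ν x ≤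
      (1 / a) * (∫ x in a..(n + 1) * a, profile ν x) + (1 / a) * (a * profile ν 0) := by
    rw [← mul_add]
    exact mul_le_mul_of_nonneg_left (by linarith) (by positivity)
  have e3 := mul_le_mul_of_nonneg_left up2 (one_div_nonneg.2 ha.le)
  have e4 : 2 / a * (a * profile ν 0) = 2 * ((1 / a) * (a * profile ν 0)) := by ring
  rw [e1, e4, hnorm, abs_le]
  rw [zero_mul, add_zero] at e3
  have e5 : 0 ≤ (1 / a) * (a * profile ν 0) := by positivity
  constructor <;> linarith

/-! ### Euclidean distance and lattice sums -/

lemma eucDist_nonneg {d : ℕ} (x y : Vert d) : 0 ≤ eucDist x y := Real.sqrt_nonneg _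

lemma eucDist_self {d : ℕ} (x : Vert d) : eucDist x x = 0 := by simp [eucDist]

lemma abs_sub_le_eucDist {d : ℕ} (x y : Vert d) (i : Fin d) :
    |(x i : ℝ) - y i| ≤ eucDist x y := by
  rw [← Real.sqrt_sq_eq_abs]
  refine Real.sqrt_le_sqrt ?_
  exact Finset.single_le_sum (f := fun i => ((x i : ℝ) - y i) ^ 2)
    (fun i _ => sq_nonneg _) (Finset.mem_univ i)

lemma one_le_eucDist {d : ℕ} {x y : Vert d} (h : x ≠ y) : 1 ≤ eucDist x y := by
  obtain ⟨i, hi⟩ := Function.ne_iff.1 h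
  refine le_trans ?_ (abs_sub_le_eucDist x y i)
  have : 1 ≤ |x i - y i| := Int.one_le_abs (sub_ne_zero.2 hi)
  exact_mod_cast this

lemma eucDist_eq_dist {d : ℕ} (x y : Vert d) :
    eucDist x y = dist (WithLp.toLp 2 fun i => (x i : ℝ) : EuclideanSpace ℝ (Fin d))
      (WithLp.toLp 2 fun i => (y i : ℝ)) := by
  rw [EuclideanSpace.dist_eq]
  simp [eucDist, Real.dist_eq]

lemma eucDist_triangle {d : ℕ} (x y z : Vert d) : eucDist x z ≤ eucDist x y + eucDist y z := by
  simp only [eucDist_eq_dist]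
  exact dist_triangle _ _ _

lemma eucDist_le_mul {d : ℕ} (x y : Vert d) {r : ℝ} (hr : 0 ≤ r)
    (h : ∀ i, |(x i : ℝ) - y i| ≤ r) : eucDist x y ≤ d * r := by
  rw [eucDist, Real.sqrt_le_left (by positivity)]
  have h1 : ∑ i, ((x i : ℝ) - y i) ^ 2 ≤ ∑ _i : Fin d, r ^ 2 :=
    Finset.sum_le_sum fun i _ => sq_le_sq' (abs_le.1 (h i)).1 (abs_le.1 (h i)).2
  refine h1.trans ?_
  simp only [Finset.sum_const, Finset.card_univ, Fintype.card_fin, nsmul_eq_mul]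
  rcases Nat.eq_zero_or_pos d with rfl | hd
  · simp
  · have : (1 : ℝ) ≤ d := by exact_mod_cast hd
    nlinarith [sq_nonneg r, mul_nonneg (by linarith : (0 : ℝ) ≤ d - 1) (sq_nonneg r)]

/-- Summing a product of kernels over all walks of length `k` from a fixed start: if every kernel
has total mass at most `S` from each vertex, the sum is at most `S ^ k`. -/
lemma tsum_prod_walk_le {V : Type*} (g : V → V → ℝ≥0∞) (S : ℝ≥0∞)
    (hS : ∀ u, ∑' v, g u v ≤ S) (k : ℕ) (o : V) :
    ∑' x : Fin k → V, ∏ i : Fin k, g ((Fin.cons o x : Fin (k + 1) → V) i.castSucc)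
      ((Fin.cons o x : Fin (k + 1) → V) i.succ) ≤ S ^ k := by
  induction k generalizing o with
  | zero => simp
  | succ k ih =>
    rw [← (Fin.consEquiv fun _ : Fin (k + 1) => V).tsum_eq, ENNReal.summable.tsum_prod'
      fun _ => ENNReal.summable]
    have step : ∀ v, ∑' x : Fin k → V,
        ∏ i : Fin (k + 1), g
          ((Fin.cons o (Fin.cons v x : Fin (k + 1) → V) : Fin (k + 2) → V) i.castSucc)
          ((Fin.cons o (Fin.cons v x : Fin (k + 1) → V) : Fin (k + 2) → V) i.succ)
        ≤ g o v * S ^ k := by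
      intro v
      simp only [Fin.prod_univ_succ, Fin.castSucc_zero, Fin.cons_zero, Fin.cons_succ,
        ← Fin.succ_castSucc]
      rw [ENNReal.tsum_mul_left]
      exact mul_le_mul_right (ih v) _
    calc _ ≤ ∑' v, g o v * S ^ k := ENNReal.tsum_le_tsum fun v => step v
      _ = (∑' v, g o v) * S ^ k := ENNReal.tsum_mul_right
      _ ≤ S * S ^ k := mul_le_mul_left (hS o) _
      _ = S ^ (k + 1) := (pow_succ' S k).symm

lemma tsum_prod_eq_pow {V : Type*} (f : V → ℝ≥0∞) (d : ℕ) :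
    ∑' x : Fin d → V, ∏ i, f (x i) = (∑' v, f v) ^ d := by
  induction d with
  | zero => simp
  | succ k ih =>
    rw [← (Fin.consEquiv fun _ : Fin (k + 1) => V).tsum_eq, ENNReal.summable.tsum_prod'
      fun _ => ENNReal.summable]
    simp only [Fin.consEquiv, Equiv.coe_fn_mk, Fin.prod_univ_succ, Fin.cons_zero, Fin.cons_succ]
    simp_rw [ENNReal.tsum_mul_left, ENNReal.tsum_mul_right, ih]
    rw [pow_succ']

lemma summable_one_add_abs_rpow {p : ℝ} (hp : 1 < p) :
    Summable fun n : ℤ => (1 + |(n : ℝ)|) ^ (-p) := by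
  have h0 := Real.summable_abs_int_rpow hp
  refine Summable.of_norm_bounded_eventually (g := fun n : ℤ => |(n : ℝ)| ^ (-p)) h0 ?_
  refine (Set.finite_singleton (0 : ℤ)).subset ?_
  intro n hn
  by_contra h0
  rw [mem_compl_iff, mem_ofPred_eq] at hn
  refine hn ?_
  have hn0 : n ≠ 0 := by simpa using h0
  have : 0 < |(n : ℝ)| := by simpa using hn0
  rw [Real.norm_of_nonneg (by positivity)]
  exact Real.rpow_le_rpow_of_nonpos this (by linarith) (by linarith)

/-- The lattice sum `∑_z ‖z‖^{-σ}`. For `σ ≠ 0` the term at the origin is `0 ^ (-σ) = 0`. -/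
noncomputable def latticeSum (d : ℕ) (σ : ℝ) : ℝ≥0∞ :=
  ∑' z : Vert d, ENNReal.ofReal (eucDist 0 z ^ (-σ))

/-- Convergence of the lattice sum: `‖z‖^{-σ}` is at most a constant times the product of the
one-dimensional terms `(1 + |z i|)^{-σ/d}`, over which the sum factorises. -/
lemma latticeSum_ne_top {d : ℕ} {σ : ℝ} (hσ : (d : ℝ) < σ) : latticeSum d σ ≠ ⊤ := by
  rw [latticeSum]
  rcases Nat.eq_zero_or_pos d with rfl | hd
  · simp [tsum_fintype]
  have hd' : (0 : ℝ) < d := by exact_mod_cast hd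
  set p := σ / d with hp
  have hp1 : 1 < p := by rw [hp, lt_div_iff₀ hd']; linarith
  have key : ∀ z : Vert d, ENNReal.ofReal (eucDist 0 z ^ (-σ)) ≤
      ENNReal.ofReal (2 ^ σ) * ∏ i, ENNReal.ofReal ((1 + |(z i : ℝ)|) ^ (-p)) := by
    intro z
    rw [← ENNReal.ofReal_prod_of_nonneg (fun i _ => by positivity),
      ← ENNReal.ofReal_mul (by positivity)]
    refine ENNReal.ofReal_le_ofReal ?_
    by_cases hz : (0 : Vert d) = z
    · subst hz
      rw [eucDist_self, Real.zero_rpow (by linarith)]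
      positivity
    have h1 := one_le_eucDist hz
    set r := eucDist 0 z
    have h2 : ∏ _i : Fin d, (2 * r) ^ (-p) ≤ ∏ i, (1 + |(z i : ℝ)|) ^ (-p) := by
      refine Finset.prod_le_prod (fun i _ => by positivity) fun i _ => ?_
      refine Real.rpow_le_rpow_of_nonpos (by positivity) ?_ (by linarith)
      have := abs_sub_le_eucDist 0 z i
      simp only [Pi.zero_apply, Int.cast_zero, zero_sub, abs_neg] at this
      linarith
    have h3 : ∏ _i : Fin d, (2 * r) ^ (-p) = (2 * r) ^ (-σ) := by
      rw [Finset.prod_const, Finset.card_univ, Fintype.card_fin, ← Real.rpow_natCast,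
        ← Real.rpow_mul (by positivity)]
      congr 1
      rw [hp]; field_simp
    rw [h3, Real.mul_rpow (by norm_num) (by linarith)] at h2
    calc r ^ (-σ) = 2 ^ σ * (2 ^ (-σ) * r ^ (-σ)) := by
          rw [← mul_assoc, ← Real.rpow_add (by norm_num), add_neg_cancel, Real.rpow_zero, one_mul]
      _ ≤ _ := mul_le_mul_of_nonneg_left h2 (by positivity)
  refine ne_top_of_le_ne_top ?_ (ENNReal.tsum_le_tsum key)
  rw [ENNReal.tsum_mul_left,
    tsum_prod_eq_pow (fun n : ℤ => ENNReal.ofReal ((1 + |(n : ℝ)|) ^ (-p)))]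
  refine ENNReal.mul_ne_top ENNReal.ofReal_ne_top (ENNReal.pow_ne_top ?_)
  rw [← ENNReal.ofReal_tsum_of_nonneg (fun n => by positivity) (summable_one_add_abs_rpow hp1)]
  exact ENNReal.ofReal_ne_top

lemma tsum_eucDist_eq {d : ℕ} (σ : ℝ) (u : Vert d) :
    ∑' v : Vert d, ENNReal.ofReal (eucDist u v ^ (-σ)) = latticeSum d σ := by
  rw [latticeSum, ← (Equiv.addLeft u).tsum_eq]
  refine tsum_congr fun z => ?_
  congr 2
  simp only [eucDist, Equiv.coe_addLeft, Pi.add_apply, Pi.zero_apply]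
  congr 1
  refine Finset.sum_congr rfl fun i _ => ?_
  push_cast
  ring

/-! ### Independence in product spaces -/

lemma infinitePi_forall_mem {ι κ X : Type*} [Fintype κ] [MeasurableSpace X] (P : Measure X)
    [IsProbabilityMeasure P] {f : κ → ι} (hf : Function.Injective f) {t : κ → Set X}
    (ht : ∀ k, MeasurableSet (t k)) :
    Measure.infinitePi (fun _ : ι => P) {u | ∀ k, u (f k) ∈ t k} = ∏ k, P (t k) := by
  have h : (Measure.infinitePi fun _ : ι => P).map (fun ω k => ω (f k)) =
      Measure.pi fun _ : κ => P := by
    rw [Measure.map_infinitePi_infinitePi_of_inj hf, Measure.infinitePi_eq_pi]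
  rw [← Measure.pi_pi, ← h, Measure.map_apply (by fun_prop) (MeasurableSet.univ_pi ht)]
  congr 1
  ext u
  simp

lemma lintegral_infinitePi_prod {ι κ X : Type*} [Fintype κ] [MeasurableSpace X] (P : Measure X)
    [IsProbabilityMeasure P] {f : κ → ι} (hf : Function.Injective f) {g : κ → X → ℝ≥0∞}
    (hg : ∀ k, Measurable (g k)) :
    ∫⁻ u, ∏ k, g k (u (f k)) ∂Measure.infinitePi (fun _ : ι => P) = ∏ k, ∫⁻ w, g k w ∂P := by
  have hind : iIndepFun (fun (k : κ) (u : κ → X) => g k (u k))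
      (Measure.infinitePi fun _ : κ => P) := iIndepFun_infinitePi hg
  have h := Measure.map_infinitePi_infinitePi_of_inj (P := fun _ : ι => P) hf
  have h1 := lintegral_prod_eq_prod_lintegral_of_indepFun Finset.univ _ hind
    (fun k => (hg k).comp (measurable_pi_apply k))
  rw [← h, lintegral_map (by fun_prop) (by fun_prop)] at h1
  rw [h1]
  refine Finset.prod_congr rfl fun k _ => ?_
  rw [h]
  conv_rhs => rw [← Measure.infinitePi_map_eval (fun _ : κ => P) k]
  rw [lintegral_map (hg k) (by fun_prop)]

/-! ### First moment bound for constrained paths -/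

/-- A bound for the uniform variable of a present edge in terms of the weights at its ends. It is
in product form, thanks to `min 1 a ≤ a ^ θ`. -/
lemma edge_bound {lam α θ w w' D u : ℝ} (hθ0 : 0 ≤ θ)
    (hθ1 : θ ≤ 1) (hw : 1 ≤ w) (hw' : 1 ≤ w') (hD : 1 ≤ D) (hu1 : u ≤ 1)
    (h : D = 1 ∨ (1 < D ∧ u < 1 - Real.exp (-(lam * (w * w' / D ^ α))))) :
    u ≤ (max 1 lam) ^ θ * (w ^ θ * w' ^ θ) * D ^ (-(α * θ)) := by
  have hΛ : 1 ≤ max 1 lam := le_max_left _ _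
  have h0 : 0 < D := by linarith
  have hform : (max 1 lam) ^ θ * (w ^ θ * w' ^ θ) * D ^ (-(α * θ)) =
      (max 1 lam * (w * w') * D ^ (-α)) ^ θ := by
    rw [Real.mul_rpow (by positivity) (by positivity),
      Real.mul_rpow (by positivity) (by positivity),
      Real.mul_rpow (by positivity) (by positivity), ← Real.rpow_mul h0.le, neg_mul]
  rw [hform]
  set b := max 1 lam * (w * w') * D ^ (-α) with hb
  have hb0 : 0 ≤ b := by positivity
  have hww : 1 ≤ w * w' := one_le_mul_of_one_le_of_one_le hw hw'
  rcases le_or_gt 1 b with h1 | h1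
  · exact hu1.trans (Real.one_le_rpow h1 hθ0)
  · have hub : u ≤ b := by
      rcases h with h | ⟨_, h⟩
      · refine hu1.trans ?_
        rw [hb, h, Real.one_rpow, mul_one]
        exact one_le_mul_of_one_le_of_one_le hΛ hww
      · have := Real.add_one_le_exp (-(lam * (w * w' / D ^ α)))
        have h2 : lam * (w * w' / D ^ α) ≤ b := by
          rw [hb, Real.rpow_neg h0.le, div_eq_mul_inv, ← mul_assoc]
          gcongr
          exact le_max_right _ _
        linarith
    refine hub.trans ?_
    calc b = b ^ (1 : ℝ) := (Real.rpow_one b).symm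
      _ ≤ b ^ θ := by
        rcases hb0.eq_or_lt with h0 | h0
        · rw [← h0, Real.zero_rpow one_ne_zero]
          exact Real.rpow_nonneg le_rfl _
        · exact Real.rpow_le_rpow_of_exponent_ge h0 h1.le hθ1

/-- In a product over the edges of a path each inner vertex occurs twice. The first vertex is
allowed a second occurrence too, so that all vertices but the last are treated alike. -/
lemma prod_adjacent_le (k : ℕ) (v : Fin (k + 1) → ℝ) (hv : ∀ i, 1 ≤ v i) :
    ∏ i : Fin k, (v i.castSucc * v i.succ) ≤ (∏ i : Fin k, v i.castSucc ^ 2) * v (Fin.last k) := by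
  have h0 : ∀ i, 0 ≤ v i := fun i => zero_le_one.trans (hv i)
  have h1 : ∏ i : Fin k, v i.succ ≤ ∏ i, v i := by
    rw [Fin.prod_univ_succ]
    exact le_mul_of_one_le_left (Finset.prod_nonneg fun i _ => h0 _) (hv 0)
  rw [Finset.prod_mul_distrib, Finset.prod_pow, sq, mul_assoc]
  refine mul_le_mul_of_nonneg_left ?_ (Finset.prod_nonneg fun i _ => h0 _)
  rwa [← Fin.prod_univ_castSucc]

lemma volume_unitInterval_le (b : ℝ) :
    (volume : Measure unitInterval) {u | (u : ℝ) ≤ b} ≤ ENNReal.ofReal b := by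
  rcases lt_or_ge b 0 with hb | hb
  · have : {u : unitInterval | (u : ℝ) ≤ b} = ∅ := by
      ext u
      simp only [mem_ofPred_eq, mem_empty_iff_false, iff_false, not_le]
      exact hb.trans_le u.2.1
    simp [this]
  rcases lt_or_ge b 1 with hb1 | hb1
  · have : {u : unitInterval | (u : ℝ) ≤ b} = Iic ⟨b, hb, hb1.le⟩ := by
      ext u
      simp only [mem_ofPred_eq, mem_Iic]
      exact Iff.rfl
    rw [this, unitInterval.volume_Iic]
  · exact prob_le_one.trans (by rw [← ENNReal.ofReal_one]; exact ENNReal.ofReal_le_ofReal hb1)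

/-- The truncated moment `E[W ^ p; W ∈ A]`. -/
noncomputable def moment (μ : Measure ℝ) (p : ℝ) (A : Set ℝ) : ℝ≥0∞ :=
  ∫⁻ w in A, ENNReal.ofReal (w ^ p) ∂μ

/-- The event that `x 0, …, x k` is a walk in the graph whose vertex-weights lie in the sets `A i`
and whose edge-weights lie in the sets `C i`. -/
def pathEvent {d : ℕ} (lam α : ℝ) {k : ℕ} (x : Fin (k + 1) → Vert d) (A C : ℕ → Set ℝ) :
    Set (Sample d) :=
  {ω | (∀ i : Fin (k + 1), vertexWeight ω (x i) ∈ A i) ∧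
    (∀ i : Fin k, (graph lam α ω).Adj (x i.castSucc) (x i.succ)) ∧
    ∀ i : Fin k, edgeWeight ω s(x i.castSucc, x i.succ) ∈ C i}

lemma edges_injective {V : Type*} {k : ℕ} {x : Fin (k + 1) → V} (hx : Function.Injective x) :
    Function.Injective fun i : Fin k => s(x i.castSucc, x i.succ) := by
  intro i j hij
  rcases Sym2.eq_iff.1 hij with ⟨h, _⟩ | ⟨h, h'⟩
  · exact Fin.castSucc_injective _ (hx h)
  · have h1 := congrArg Fin.val (hx h)
    have h2 := congrArg Fin.val (hx h')
    simp at h1 h2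
    omega

lemma measurable_vertexWeight {d : ℕ} (v : Vert d) :
    Measurable fun ω : Sample d => vertexWeight ω v := by
  unfold vertexWeight; fun_prop

lemma measurable_edgeUniform {d : ℕ} (e : Sym2 (Vert d)) :
    Measurable fun ω : Sample d => edgeUniform ω e := by
  unfold edgeUniform; fun_prop

lemma measurable_edgeWeight {d : ℕ} (e : Sym2 (Vert d)) :
    Measurable fun ω : Sample d => edgeWeight ω e := by
  unfold edgeWeight; fun_prop

/-- The probability that a given self-avoiding path is present with prescribed weights. The
vertices and the edges being distinct, all the variables involved are independent. -/
lemma law_pathEvent_le {d : ℕ} {lam α θ : ℝ} (hθ0 : 0 ≤ θ) (hθ1 : θ ≤ 1)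
    (μ ν : Measure ℝ) [IsProbabilityMeasure μ] [IsProbabilityMeasure ν]
    {k : ℕ} {x : Fin (k + 1) → Vert d} (hx : Function.Injective x) {A C : ℕ → Set ℝ}
    (hA : ∀ i, MeasurableSet (A i)) (hA1 : ∀ i, A i ⊆ Ici 1) (hC : ∀ i, MeasurableSet (C i)) :
    law d μ ν (pathEvent lam α x A C) ≤
      (∏ i : Fin k, ENNReal.ofReal ((max 1 lam) ^ θ) *
        ENNReal.ofReal (eucDist (x i.castSucc) (x i.succ) ^ (-(α * θ))) * ν (C i)) *
      ((∏ i : Fin k, moment μ (2 * θ) (A i)) * moment μ θ (A k)) := by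
  set D : Fin k → ℝ := fun i => eucDist (x i.castSucc) (x i.succ) with hD
  have hD1 : ∀ i, 1 ≤ D i := fun i => one_le_eucDist fun h => by
    have := hx h
    exact absurd this (Fin.castSucc_lt_succ).ne
  set b : Fin k → (Vert d → ℝ) → ℝ := fun i W =>
    (max 1 lam) ^ θ * (W (x i.castSucc) ^ θ * W (x i.succ) ^ θ) * D i ^ (-(α * θ)) with hb
  have hbm : ∀ i, Measurable (b i) := fun i => by
    simp only [hb]
    exact ((((measurable_pi_apply (x i.castSucc)).pow_const θ).mul
      ((measurable_pi_apply (x i.succ)).pow_const θ)).const_mul _).mul_const _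
  set F : Set (Sample d) := {ω | (∀ i : Fin (k + 1), vertexWeight ω (x i) ∈ A i) ∧
    (∀ i : Fin k, edgeUniform ω s(x i.castSucc, x i.succ) ≤ b i ω.1) ∧
    ∀ i : Fin k, edgeWeight ω s(x i.castSucc, x i.succ) ∈ C i} with hF
  have hFm : MeasurableSet F := by
    have e : F = (⋂ i : Fin (k + 1), {ω | vertexWeight ω (x i) ∈ A i}) ∩
        ((⋂ i : Fin k, {ω | edgeUniform ω s(x i.castSucc, x i.succ) ≤ b i ω.1}) ∩
        ⋂ i : Fin k, {ω | edgeWeight ω s(x i.castSucc, x i.succ) ∈ C i}) := by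
      ext ω; simp [hF]
    rw [e]
    refine (MeasurableSet.iInter fun i : Fin (k + 1) =>
      measurable_vertexWeight (x i) (hA i)).inter
      ((MeasurableSet.iInter fun i : Fin k => measurableSet_le
        (measurable_edgeUniform s(x i.castSucc, x i.succ)) ((hbm i).comp measurable_fst)).inter
      (MeasurableSet.iInter fun i : Fin k =>
        measurable_edgeWeight s(x i.castSucc, x i.succ) (hC i)))
  have hsub : pathEvent lam α x A C ⊆ F := by
    rintro ω ⟨h1, h2, h3⟩
    refine ⟨h1, fun i => ?_, h3⟩
    refine edge_bound hθ0 hθ1 (hA1 _ (h1 i.castSucc)) (hA1 _ (h1 i.succ)) (hD1 i)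
      (ω.2.1 _).2.2 (h2 i)
  set e : Fin (k + 1) → ℝ := fun i => if (i : ℕ) < k then 2 * θ else θ with he
  set φ : Fin (k + 1) → ℝ → ℝ≥0∞ := fun i =>
    (A i).indicator fun w => ENNReal.ofReal (w ^ e i) with hφ
  have hφm : ∀ i, Measurable (φ i) := fun i =>
    (ENNReal.measurable_ofReal.comp (measurable_id.pow_const (e i))).indicator (hA i)
  set K : ℝ≥0∞ := ∏ i : Fin k, ENNReal.ofReal ((max 1 lam) ^ θ) *
        ENNReal.ofReal (D i ^ (-(α * θ))) * ν (C i) with hK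
  have hinj := edges_injective hx
  have hsec : ∀ W : Vert d → ℝ, ((Measure.infinitePi fun _ : Sym2 (Vert d) =>
        (volume : Measure unitInterval)).prod (Measure.infinitePi fun _ : Sym2 (Vert d) => ν))
        (Prod.mk W ⁻¹' F) ≤ K * ∏ i, φ i (W (x i)) := by
    intro W
    by_cases hW : ∀ i : Fin (k + 1), W (x i) ∈ A i
    · have hW1 : ∀ i : Fin (k + 1), 1 ≤ W (x i) := fun i => hA1 _ (hW i)
      have hs : Prod.mk W ⁻¹' F ⊆
          {u | ∀ i : Fin k, u s(x i.castSucc, x i.succ) ∈ {t : unitInterval | (t : ℝ) ≤ b i W}} ×ˢ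
          {l | ∀ i : Fin k, l s(x i.castSucc, x i.succ) ∈ C i} := by
        rintro ⟨u, l⟩ ⟨_, h2, h3⟩
        exact ⟨h2, h3⟩
      refine (measure_mono hs).trans ?_
      rw [Measure.prod_prod, infinitePi_forall_mem _ hinj (fun i =>
        measurableSet_le measurable_subtype_coe measurable_const),
        infinitePi_forall_mem _ hinj (fun i : Fin k => hC i)]
      have h1 : ∏ i : Fin k, (volume : Measure unitInterval) {t | (t : ℝ) ≤ b i W} ≤
          (∏ i : Fin k, ENNReal.ofReal ((max 1 lam) ^ θ) * ENNReal.ofReal (D i ^ (-(α * θ)))) *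
            ∏ i : Fin k, ENNReal.ofReal (W (x i.castSucc) ^ θ * W (x i.succ) ^ θ) := by
        rw [← Finset.prod_mul_distrib]
        refine Finset.prod_le_prod' fun i _ => (volume_unitInterval_le _).trans (le_of_eq ?_)
        have := hW1 i.castSucc
        have := hW1 i.succ
        have := hD1 i
        rw [← ENNReal.ofReal_mul (by positivity), ← ENNReal.ofReal_mul (by positivity)]
        congr 1
        simp only [hb]
        ring
      have h2 : ∏ i : Fin k, ENNReal.ofReal (W (x i.castSucc) ^ θ * W (x i.succ) ^ θ) ≤
          ∏ i, φ i (W (x i)) := by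
        have hv : ∀ i : Fin (k + 1), 1 ≤ W (x i) ^ θ := fun i => Real.one_le_rpow (hW1 i) hθ0
        have hpos : ∀ i : Fin (k + 1), 0 ≤ W (x i) ^ θ := fun i => zero_le_one.trans (hv i)
        have hφe : ∏ i, φ i (W (x i)) = ∏ i, ENNReal.ofReal (W (x i) ^ e i) :=
          Finset.prod_congr rfl fun i _ => by simp only [hφ]; rw [indicator_of_mem (hW i)]
        rw [hφe, Fin.prod_univ_castSucc]
        rw [← ENNReal.ofReal_prod_of_nonneg fun i _ => mul_nonneg (hpos _) (hpos _)]
        have h3 := prod_adjacent_le k (fun i => W (x i) ^ θ) hv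
        refine (ENNReal.ofReal_le_ofReal h3).trans (le_of_eq ?_)
        rw [ENNReal.ofReal_mul (Finset.prod_nonneg fun i _ => sq_nonneg _),
          ENNReal.ofReal_prod_of_nonneg fun i _ => sq_nonneg _]
        congr 1
        · refine Finset.prod_congr rfl fun i _ => ?_
          have h0 : 0 ≤ W (x i.castSucc) := zero_le_one.trans (hW1 _)
          simp only [he, Fin.val_castSucc, i.2, if_true]
          rw [mul_comm 2 θ, Real.rpow_mul h0, Real.rpow_two]
        · simp [he]
      calc _ ≤ ((∏ i : Fin k, ENNReal.ofReal ((max 1 lam) ^ θ) *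
            ENNReal.ofReal (D i ^ (-(α * θ)))) * ∏ i, φ i (W (x i))) * ∏ i : Fin k, ν (C i) :=
          mul_le_mul_left (h1.trans (mul_le_mul_right h2 _)) _
        _ = K * ∏ i, φ i (W (x i)) := by
          rw [hK, Finset.prod_mul_distrib (g := fun i : Fin k => ν (C i))]
          ring
    · have hs : Prod.mk W ⁻¹' F = ∅ := by
        ext p
        simp only [mem_preimage, mem_empty_iff_false, iff_false]
        exact fun h => hW h.1
      rw [hs, measure_empty]
      exact zero_le
  calc law d μ ν (pathEvent lam α x A C) ≤ law d μ ν F := measure_mono hsub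
    _ ≤ ∫⁻ W, K * ∏ i, φ i (W (x i)) ∂(Measure.infinitePi fun _ : Vert d => μ) := by
      rw [law, Measure.prod_apply hFm]
      exact lintegral_mono hsec
    _ = K * ∏ i, ∫⁻ w, φ i w ∂μ := by
      have hm : Measurable fun W : Vert d → ℝ => ∏ i, φ i (W (x i)) :=
        Finset.measurable_prod _ fun i _ => (hφm i).comp (measurable_pi_apply (x i))
      rw [lintegral_const_mul _ hm, lintegral_infinitePi_prod μ hx hφm]
    _ = _ := by
      rw [Fin.prod_univ_castSucc]
      congr 2
      · refine Finset.prod_congr rfl fun i _ => ?_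
        simp only [hφ, moment]
        rw [lintegral_indicator (hA _)]
        simp [he]
      · simp only [hφ, moment]
        rw [lintegral_indicator (hA _)]
        simp [he]

/-- The event that there is a self-avoiding path of length `k` from `o` with vertex-weights in the
sets `A i`, edge-weights in the sets `C i` and steps of Euclidean length at least `R i`. -/
def existsPath {d : ℕ} (lam α : ℝ) (o : Vert d) (k : ℕ) (A C : ℕ → Set ℝ) (R : ℕ → ℝ) :
    Set (Sample d) :=
  {ω | ∃ x : Fin (k + 1) → Vert d, x 0 = o ∧ Function.Injective x ∧
    (∀ i : Fin k, R i ≤ eucDist (x i.castSucc) (x i.succ)) ∧ ω ∈ pathEvent lam α x A C}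

/-- First moment bound over all self-avoiding paths of length `k` from `o` whose `i`-th step has
length at least `R i`. -/
lemma law_existsPath_le {d : ℕ} {lam α θ s : ℝ} (hθ0 : 0 ≤ θ) (hθ1 : θ ≤ 1)
    (hs : 0 ≤ s)
    (μ ν : Measure ℝ) [IsProbabilityMeasure μ] [IsProbabilityMeasure ν] (o : Vert d)
    (k : ℕ) {A C : ℕ → Set ℝ} {R : ℕ → ℝ} (hR : ∀ i, 0 < R i)
    (hA : ∀ i, MeasurableSet (A i)) (hA1 : ∀ i, A i ⊆ Ici 1) (hC : ∀ i, MeasurableSet (C i)) :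
    law d μ ν (existsPath lam α o k A C R) ≤
    (∏ i ∈ Finset.range k, ENNReal.ofReal ((max 1 lam) ^ θ) * latticeSum d (α * θ - s) *
      ENNReal.ofReal (R i ^ (-s)) * ν (C i)) *
      ((∏ i ∈ Finset.range k, moment μ (2 * θ) (A i)) * moment μ θ (A k)) := by
  set m : ℝ≥0∞ := (∏ i : Fin k, moment μ (2 * θ) (A i)) * moment μ θ (A k) with hm
  set c : ℝ≥0∞ := ∏ i : Fin k, ENNReal.ofReal ((max 1 lam) ^ θ) *
      ENNReal.ofReal (R i ^ (-s)) * ν (C i) with hc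
  have hterm : ∀ y : Fin k → Vert d, law d μ ν {ω |
      Function.Injective (Fin.cons o y : Fin (k + 1) → Vert d) ∧
      (∀ i : Fin k, R i ≤ eucDist ((Fin.cons o y : Fin (k + 1) → Vert d) i.castSucc)
        ((Fin.cons o y : Fin (k + 1) → Vert d) i.succ)) ∧
      ω ∈ pathEvent lam α (Fin.cons o y : Fin (k + 1) → Vert d) A C} ≤
      c * m * ∏ i : Fin k, ENNReal.ofReal
        (eucDist ((Fin.cons o y : Fin (k + 1) → Vert d) i.castSucc)
        ((Fin.cons o y : Fin (k + 1) → Vert d) i.succ) ^ (-(α * θ - s))) := by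
    intro y
    set x : Fin (k + 1) → Vert d := Fin.cons o y
    by_cases hx : Function.Injective x ∧
      ∀ i : Fin k, R i ≤ eucDist (x i.castSucc) (x i.succ)
    · refine (measure_mono fun ω hω => hω.2.2).trans
        ((law_pathEvent_le hθ0 hθ1 μ ν hx.1 hA hA1 hC).trans ?_)
      have h1 : ∏ i : Fin k, ENNReal.ofReal ((max 1 lam) ^ θ) *
          ENNReal.ofReal (eucDist (x i.castSucc) (x i.succ) ^ (-(α * θ))) * ν (C i) ≤
          c * ∏ i : Fin k, ENNReal.ofReal
            (eucDist (x i.castSucc) (x i.succ) ^ (-(α * θ - s))) := by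
        rw [hc, ← Finset.prod_mul_distrib]
        refine Finset.prod_le_prod' fun i _ => ?_
        have hDp : 0 < eucDist (x i.castSucc) (x i.succ) := (hR i).trans_le (hx.2 i)
        have h2 : ENNReal.ofReal (eucDist (x i.castSucc) (x i.succ) ^ (-(α * θ))) ≤
            ENNReal.ofReal (R i ^ (-s)) *
            ENNReal.ofReal (eucDist (x i.castSucc) (x i.succ) ^ (-(α * θ - s))) := by
          rw [← ENNReal.ofReal_mul (Real.rpow_nonneg (hR i).le _)]
          refine ENNReal.ofReal_le_ofReal ?_
          have : -(α * θ) = -s + -(α * θ - s) := by ring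
          rw [this, Real.rpow_add hDp]
          refine mul_le_mul_of_nonneg_right ?_ (Real.rpow_nonneg hDp.le _)
          exact Real.rpow_le_rpow_of_nonpos (hR i) (hx.2 i) (by linarith)
        calc _ ≤ ENNReal.ofReal ((max 1 lam) ^ θ) * (ENNReal.ofReal (R i ^ (-s)) *
              ENNReal.ofReal (eucDist (x i.castSucc) (x i.succ) ^ (-(α * θ - s)))) * ν (C i) :=
              mul_le_mul_left (mul_le_mul_right h2 _) _
          _ = _ := by ring
      calc _ ≤ (c * ∏ i : Fin k, ENNReal.ofReal
            (eucDist (x i.castSucc) (x i.succ) ^ (-(α * θ - s)))) * m := mul_le_mul_left h1 _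
        _ = _ := by ring
    · have : {ω : Sample d | Function.Injective x ∧
          (∀ i : Fin k, R i ≤ eucDist (x i.castSucc) (x i.succ)) ∧
          ω ∈ pathEvent lam α x A C} = ∅ := by
        ext ω
        simp only [mem_ofPred_eq, mem_empty_iff_false, iff_false]
        exact fun h => hx ⟨h.1, h.2.1⟩
      rw [this, measure_empty]
      exact zero_le
  calc _ ≤ law d μ ν (⋃ y : Fin k → Vert d, {ω |
      Function.Injective (Fin.cons o y : Fin (k + 1) → Vert d) ∧
      (∀ i : Fin k, R i ≤ eucDist ((Fin.cons o y : Fin (k + 1) → Vert d) i.castSucc)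
        ((Fin.cons o y : Fin (k + 1) → Vert d) i.succ)) ∧
      ω ∈ pathEvent lam α (Fin.cons o y : Fin (k + 1) → Vert d) A C}) := by
        refine measure_mono ?_
        rintro ω ⟨x, hx0, hx⟩
        refine mem_iUnion.2 ⟨Fin.tail x, ?_⟩
        have : (Fin.cons o (Fin.tail x) : Fin (k + 1) → Vert d) = x := by
          rw [← hx0]; exact Fin.cons_self_tail x
        rw [mem_ofPred_eq, this]
        exact hx
    _ ≤ ∑' y : Fin k → Vert d, c * m * ∏ i : Fin k, ENNReal.ofReal
        (eucDist ((Fin.cons o y : Fin (k + 1) → Vert d) i.castSucc)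
        ((Fin.cons o y : Fin (k + 1) → Vert d) i.succ) ^ (-(α * θ - s))) :=
      (measure_iUnion_le _).trans (ENNReal.tsum_le_tsum hterm)
    _ ≤ c * m * latticeSum d (α * θ - s) ^ k := by
      rw [ENNReal.tsum_mul_left]
      exact mul_le_mul_right (tsum_prod_walk_le
        (fun u v => ENNReal.ofReal (eucDist u v ^ (-(α * θ - s)))) _
        (fun u => (tsum_eucDist_eq _ u).le) k o) _
    _ = _ := by
      rw [hc, hm, Finset.prod_range, Finset.prod_range]
      have : latticeSum d (α * θ - s) ^ k = ∏ _i : Fin k, latticeSum d (α * θ - s) := by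
        simp
      rw [this, mul_right_comm, ← Finset.prod_mul_distrib]
      congr 1
      exact Finset.prod_congr rfl fun i _ => by ring

/-! ### Power-law tails -/

/-- The limit `ℓ (2 t) / ℓ t → 1` excludes that `ℓ` vanishes for large arguments, a quotient by zero
being zero. The tail is therefore positive everywhere. -/
lemma PowerLawTail.real_Ioi_pos {μ : Measure ℝ} [IsProbabilityMeasure μ] {τ : ℝ}
    (hμ : PowerLawTail μ τ) (t : ℝ) : 0 < μ.real (Ioi t) := by
  obtain ⟨ℓ, hℓ, hG⟩ := hμ
  have h1 := (hℓ 2 two_pos).eventually (lt_mem_nhds (zero_lt_one))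
  obtain ⟨s, hs, hst⟩ := (h1.and (eventually_gt_atTop (max t 0))).exists
  have hs0 : 0 < s := (le_max_right _ _).trans_lt hst
  have hne : ℓ s ≠ 0 := fun h => by simp [h] at hs
  have hpos : 0 < μ.real (Ioi s) := by
    refine lt_of_le_of_ne measureReal_nonneg (Ne.symm ?_)
    rw [hG s hs0]
    exact div_ne_zero hne (Real.rpow_pos_of_pos hs0 _).ne'
  exact hpos.trans_le (measureReal_mono (Ioi_subset_Ioi ((le_max_left _ _).trans hst.le)))

lemma PowerLawTail.tendsto_ratio {μ : Measure ℝ} {τ : ℝ} (hμ : PowerLawTail μ τ) :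
    Tendsto (fun t => μ.real (Ioi (2 * t)) / μ.real (Ioi t)) atTop
      (𝓝 ((2 : ℝ) ^ (-(τ - 1)))) := by
  obtain ⟨ℓ, hℓ, hG⟩ := hμ
  have h1 := (hℓ 2 two_pos).mul_const ((2 : ℝ) ^ (-(τ - 1)))
  rw [one_mul] at h1
  refine h1.congr' ?_
  filter_upwards [eventually_gt_atTop 0] with t ht
  rw [hG t ht, hG (2 * t) (by positivity), Real.mul_rpow two_pos.le ht.le,
    Real.rpow_neg two_pos.le]
  have : 0 < t ^ (τ - 1) := Real.rpow_pos_of_pos ht _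
  have : 0 < (2 : ℝ) ^ (τ - 1) := by positivity
  rcases eq_or_ne (ℓ t) 0 with h0 | h0
  · simp [h0]
  · field_simp

/-- Moments of order smaller than `τ - 1` are finite: compare with a dyadic sum, which converges by
the ratio test. -/
lemma PowerLawTail.moment_ne_top {μ : Measure ℝ} [IsProbabilityMeasure μ] {τ p : ℝ}
    (hμ : PowerLawTail μ τ) (hp0 : 0 ≤ p) (hp : p < τ - 1) : moment μ p (Ici 1) ≠ ⊤ := by
  set a : ℕ → ℝ := fun n => (2 : ℝ) ^ ((n + 1) * p) * μ.real (Ioi ((2 : ℝ) ^ n / 2)) with ha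
  have hapos : ∀ n, 0 < a n := fun n => mul_pos (by positivity) (hμ.real_Ioi_pos _)
  have hsum : Summable a := by
    refine summable_of_ratio_test_tendsto_lt_one
      (l := (2 : ℝ) ^ p * (2 : ℝ) ^ (-(τ - 1))) ?_ (Eventually.of_forall fun n => (hapos n).ne') ?_
    · rw [← Real.rpow_add two_pos]
      exact Real.rpow_lt_one_of_one_lt_of_neg one_lt_two (by linarith)
    · have ht : Tendsto (fun n : ℕ => (2 : ℝ) ^ n / 2) atTop atTop :=
        (tendsto_pow_atTop_atTop_of_one_lt one_lt_two).atTop_div_const two_pos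
      refine ((hμ.tendsto_ratio.comp ht).const_mul ((2 : ℝ) ^ p)).congr fun n => ?_
      rw [Real.norm_of_nonneg (hapos _).le, Real.norm_of_nonneg (hapos _).le]
      simp only [ha, Function.comp]
      have e1 : ((2 : ℝ) ^ (((n + 1 : ℕ) + 1 : ℝ) * p)) = 2 ^ p * 2 ^ ((n + 1 : ℝ) * p) := by
        rw [← Real.rpow_add two_pos]; congr 1; push_cast; ring
      have e2 : (2 : ℝ) ^ (n + 1) / 2 = 2 * (2 ^ n / 2) := by ring
      rw [e1, e2]
      have := hμ.real_Ioi_pos ((2 : ℝ) ^ n / 2)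
      have : (0 : ℝ) < 2 ^ ((n + 1 : ℝ) * p) := by positivity
      field_simp
  have hpt : ∀ w ∈ Ici (1 : ℝ), ENNReal.ofReal (w ^ p) ≤
      ∑' n : ℕ, (Ici ((2 : ℝ) ^ n)).indicator
        (fun _ => ENNReal.ofReal ((2 : ℝ) ^ ((n + 1) * p))) w := by
    intro w hw
    obtain ⟨n, hn1, hn2⟩ := exists_nat_pow_near (mem_Ici.1 hw) one_lt_two
    refine le_trans ?_ (ENNReal.le_tsum n)
    rw [indicator_of_mem (show w ∈ Ici ((2 : ℝ) ^ n) from hn1)]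
    refine ENNReal.ofReal_le_ofReal ?_
    rw [Real.rpow_mul two_pos.le]
    refine Real.rpow_le_rpow (zero_le_one.trans hw) ?_ hp0
    have : (2 : ℝ) ^ ((n : ℝ) + 1) = 2 ^ (n + 1) := by
      rw [← Real.rpow_natCast]; push_cast; rfl
    rw [this]
    exact hn2.le
  refine ne_top_of_le_ne_top hsum.tsum_ofReal_ne_top ?_
  calc moment μ p (Ici 1) ≤ ∫⁻ w in Ici 1, ∑' n : ℕ, (Ici ((2 : ℝ) ^ n)).indicator
        (fun _ => ENNReal.ofReal ((2 : ℝ) ^ ((n + 1) * p))) w ∂μ :=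
        setLIntegral_mono' measurableSet_Ici hpt
    _ ≤ ∫⁻ w, ∑' n : ℕ, (Ici ((2 : ℝ) ^ n)).indicator
        (fun _ => ENNReal.ofReal ((2 : ℝ) ^ ((n + 1) * p))) w ∂μ := setLIntegral_le_lintegral _ _
    _ = ∑' n : ℕ, ENNReal.ofReal ((2 : ℝ) ^ ((n + 1) * p)) * μ (Ici ((2 : ℝ) ^ n)) := by
      rw [lintegral_tsum fun n => (measurable_const.indicator measurableSet_Ici).aemeasurable]
      exact tsum_congr fun n => lintegral_indicator_const measurableSet_Ici _
    _ ≤ ∑' n : ℕ, ENNReal.ofReal (a n) := by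
      refine ENNReal.tsum_le_tsum fun n => ?_
      simp only [ha]
      rw [ENNReal.ofReal_mul (by positivity), ofReal_measureReal]
      refine mul_le_mul_right (measure_mono ?_) _
      intro w hw
      have : (0 : ℝ) < 2 ^ n := by positivity
      have hw' : (2 : ℝ) ^ n ≤ w := hw
      exact lt_of_lt_of_le (by linarith) hw'

lemma moment_Icc_le (μ : Measure ℝ) {p q w : ℝ} (hw : 1 ≤ w) (hqp : q ≤ p) :
    moment μ p (Icc 1 w) ≤ ENNReal.ofReal (w ^ (p - q)) * moment μ q (Ici 1) := by
  rw [moment, moment, ← lintegral_const_mul' _ _ ENNReal.ofReal_ne_top]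
  refine (setLIntegral_mono' measurableSet_Icc fun x hx => ?_).trans
    (lintegral_mono_set Icc_subset_Ici_self)
  have h0 : 0 < x := lt_of_lt_of_le one_pos hx.1
  rw [← ENNReal.ofReal_mul (by positivity)]
  refine ENNReal.ofReal_le_ofReal ?_
  have : p = (p - q) + q := by ring
  rw [this, Real.rpow_add h0, add_sub_cancel_right]
  exact mul_le_mul_of_nonneg_right (Real.rpow_le_rpow h0.le hx.2 (by linarith)) (by positivity)

lemma moment_Ioi_le (μ : Measure ℝ) {p q w : ℝ} (hw : 1 ≤ w) (hqp : p ≤ q) :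
    moment μ p (Ioi w) ≤ ENNReal.ofReal (w ^ (p - q)) * moment μ q (Ici 1) := by
  rw [moment, moment, ← lintegral_const_mul' _ _ ENNReal.ofReal_ne_top]
  refine (setLIntegral_mono' measurableSet_Ioi fun x hx => ?_).trans
    (lintegral_mono_set (Ioi_subset_Ici hw))
  have hx' : w < x := hx
  have h0 : 0 < x := by linarith
  rw [← ENNReal.ofReal_mul (by positivity)]
  refine ENNReal.ofReal_le_ofReal ?_
  have : p = (p - q) + q := by ring
  rw [this, Real.rpow_add h0, add_sub_cancel_right]
  exact mul_le_mul_of_nonneg_right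
    (Real.rpow_le_rpow_of_nonpos (by linarith) hx'.le (by linarith)) (by positivity)

lemma moment_Icc_le_of_le (μ : Measure ℝ) {p q w : ℝ} (hqp : p ≤ q) :
    moment μ p (Icc 1 w) ≤ moment μ q (Ici 1) := by
  refine (setLIntegral_mono' measurableSet_Icc fun x hx => ?_).trans
    (lintegral_mono_set Icc_subset_Ici_self)
  exact ENNReal.ofReal_le_ofReal (Real.rpow_le_rpow_of_exponent_le hx.1 hqp)

/-- The lower half of Potter's bound, obtained by iterating the doubling estimate. -/
lemma PowerLawTail.eventually_rpow_le {μ : Measure ℝ} [IsProbabilityMeasure μ] {τ q : ℝ}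
    (hμ : PowerLawTail μ τ) (hτ : 1 < τ) (hq : τ - 1 < q) :
    ∀ᶠ t in atTop, t ^ (-q) ≤ μ.real (Ioi t) := by
  set q' := (τ - 1 + q) / 2 with hq'
  have hq'0 : 0 < q' := by linarith
  have h2 : (2 : ℝ) ^ (-q') < 2 ^ (-(τ - 1)) :=
    Real.rpow_lt_rpow_of_exponent_lt one_lt_two (by linarith)
  obtain ⟨t₁, ht₁⟩ := eventually_atTop.1 (hμ.tendsto_ratio.eventually (lt_mem_nhds h2))
  set t₀ := max t₁ 1
  have ht₀ : 1 ≤ t₀ := le_max_right _ _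
  have ht₀' : 0 < t₀ := by linarith
  have hdouble : ∀ t, t₀ ≤ t → 2 ^ (-q') * μ.real (Ioi t) ≤ μ.real (Ioi (2 * t)) := fun t ht => by
    have := (ht₁ t ((le_max_left _ _).trans ht)).le
    rwa [le_div_iff₀ (hμ.real_Ioi_pos t)] at this
  have hiter : ∀ n : ℕ, ((2 : ℝ) ^ n) ^ (-q') * μ.real (Ioi t₀) ≤ μ.real (Ioi (2 ^ n * t₀)) := by
    intro n
    induction n with
    | zero => simp
    | succ n ih =>
      have h1 : (1 : ℝ) ≤ 2 ^ n := one_le_pow₀ one_le_two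
      have := hdouble (2 ^ n * t₀) (le_mul_of_one_le_left ht₀'.le h1)
      rw [← mul_assoc, ← pow_succ'] at this
      refine le_trans ?_ this
      rw [pow_succ', Real.mul_rpow two_pos.le (by positivity), mul_assoc]
      exact mul_le_mul_of_nonneg_left ih (by positivity)
  set c := (2 / t₀) ^ (-q') * μ.real (Ioi t₀) with hc
  have hc0 : 0 < c := mul_pos (by positivity) (hμ.real_Ioi_pos _)
  have hsmall : ∀ᶠ t : ℝ in atTop, t ^ (-(q - q')) ≤ c :=
    (tendsto_rpow_neg_atTop (by linarith : 0 < q - q')).eventually (ge_mem_nhds hc0)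
  filter_upwards [hsmall, eventually_ge_atTop t₀] with t ht htt
  have ht0 : 0 < t := by linarith
  obtain ⟨n, hn1, hn2⟩ := exists_nat_pow_near ((one_le_div ht₀').2 htt) (one_lt_two (α := ℝ))
  rw [div_lt_iff₀ ht₀'] at hn2
  calc t ^ (-q) = t ^ (-(q - q')) * t ^ (-q') := by
        rw [← Real.rpow_add ht0]; congr 1; ring
    _ ≤ c * t ^ (-q') := by gcongr
    _ = (2 * (t / t₀)) ^ (-q') * μ.real (Ioi t₀) := by
        rw [hc, mul_right_comm, ← Real.mul_rpow (by positivity) ht0.le]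
        congr 2; ring
    _ ≤ ((2 : ℝ) ^ (n + 1)) ^ (-q') * μ.real (Ioi t₀) := by
        refine mul_le_mul_of_nonneg_right ?_ measureReal_nonneg
        refine Real.rpow_le_rpow_of_nonpos (by positivity) ?_ (by linarith)
        rw [pow_succ']
        linarith
    _ ≤ μ.real (Ioi (2 ^ (n + 1) * t₀)) := hiter _
    _ ≤ μ.real (Ioi t) := measureReal_mono (Ioi_subset_Ioi hn2.le)

/-! ### Path costs and graph distance -/

section GraphCost

variable {V : Type*} {G : SimpleGraph V}

/-- A walk realising the graph distance is at distance `i` after `i` steps. -/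
lemma edist_getVert {o v : V} (p : G.Walk o v) (hp : (p.length : ℕ∞) = G.edist o v) {i : ℕ}
    (hi : i ≤ p.length) : G.edist o (p.getVert i) = i := by
  have h1 : G.edist o (p.getVert i) ≤ i := by
    refine (SimpleGraph.edist_le (p.take i)).trans ?_
    rw [SimpleGraph.Walk.take_length]
    exact_mod_cast min_le_left _ _
  have h2 : G.edist (p.getVert i) v ≤ (p.length - i : ℕ) := by
    refine (SimpleGraph.edist_le (p.drop i)).trans ?_
    rw [SimpleGraph.Walk.drop_length]
  have h3 := SimpleGraph.edist_triangle (G := G) (u := o) (v := p.getVert i) (w := v)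
  rw [← hp] at h3
  obtain ⟨n, hn⟩ := ENat.ne_top_iff_exists.1 (ne_top_of_le_ne_top (ENat.natCast_ne_top i) h1)
  obtain ⟨l, hl⟩ := ENat.ne_top_iff_exists.1
    (ne_top_of_le_ne_top (ENat.natCast_ne_top (p.length - i)) h2)
  rw [← hn] at h1 h3 ⊢
  rw [← hl] at h2 h3
  norm_cast at *
  omega

lemma getVert_injOn_of_length_eq_edist {o v : V} (p : G.Walk o v)
    (hp : (p.length : ℕ∞) = G.edist o v) : Set.InjOn p.getVert {i | i ≤ p.length} := by
  intro i hi j hj hij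
  have h1 := edist_getVert p hp hi
  have h2 := edist_getVert p hp hj
  rw [hij, h2] at h1
  exact_mod_cast h1.symm

/-- Graph distance from `o`, truncated at `K`; the truncation makes it finite on all vertices. -/
noncomputable def truncDist (G : SimpleGraph V) (K : ℕ) (o v : V) : ℕ :=
  (min (G.edist o v) K).toNat

lemma coe_truncDist (K : ℕ) (o v : V) : (truncDist G K o v : ℕ∞) = min (G.edist o v) K :=
  ENat.natCast_toNat (ne_top_of_le_ne_top (ENat.natCast_ne_top K) (min_le_right _ _))

lemma truncDist_le_succ {K : ℕ} {o u v : V} (h : G.Adj u v) :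
    truncDist G K o v ≤ truncDist G K o u + 1 := by
  have h1 : G.edist o v ≤ G.edist o u + 1 := by
    refine SimpleGraph.edist_triangle.trans (add_le_add le_rfl ?_)
    exact (SimpleGraph.edist_eq_one_iff_adj.2 h).le
  have h2 : (truncDist G K o v : ℕ∞) ≤ (truncDist G K o u + 1 : ℕ) := by
    push_cast
    rw [coe_truncDist, coe_truncDist]
    rcases le_total (G.edist o u) K with hu | hu
    · rw [min_eq_left hu]; exact (min_le_left _ _).trans h1
    · rw [min_eq_right hu]; exact (min_le_right _ _).trans le_self_add
  exact_mod_cast h2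

lemma edist_of_truncDist_eq_succ {K : ℕ} {o u v : V} (h : G.Adj u v)
    (hs : truncDist G K o v = truncDist G K o u + 1) :
    truncDist G K o u < K ∧ G.edist o u = truncDist G K o u ∧
      G.edist o v = (truncDist G K o u + 1 : ℕ) := by
  have hv := coe_truncDist (G := G) K o v
  have hu := coe_truncDist (G := G) K o u
  have hvK : truncDist G K o v ≤ K := by
    have : (truncDist G K o v : ℕ∞) ≤ K := hv ▸ min_le_right _ _
    exact_mod_cast this
  have hlt : truncDist G K o u < K := by omega
  have hue : G.edist o u = truncDist G K o u := by
    rcases le_total (G.edist o u) K with h' | h'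
    · rw [min_eq_left h'] at hu; exact hu.symm
    · rw [min_eq_right h'] at hu
      have : truncDist G K o u = K := by exact_mod_cast hu
      omega
  refine ⟨hlt, hue, le_antisymm ?_ ?_⟩
  · refine (SimpleGraph.edist_triangle (v := u)).trans ?_
    rw [hue, SimpleGraph.edist_eq_one_iff_adj.2 h]
    push_cast; exact le_rfl
  · rw [← hs, hv]; exact min_le_left _ _

/-- A lower bound for path costs. If the graph balls of radius `K` around `o` and `o'` are disjoint
and each edge from the sphere of radius `k` to the sphere of radius `k + 1` around either centre
costs at least `t k`, then a walk from `o` to `o'` costs at least `2 (t 0 + ⋯ + t (K - 1))`. The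
proof uses a potential, built from the truncated graph distances to `o` and `o'`, whose increment
along each edge is at most the cost of the edge. -/
lemma two_sided_cost_le {K : ℕ} {o o' : V} {L : Sym2 V → ℝ} {t : ℕ → ℝ} (ht : ∀ k, 0 ≤ t k)
    (ho : ∀ k < K, ∀ u v, G.Adj u v → G.edist o u = k → G.edist o v = (k + 1 : ℕ) →
      t k ≤ L s(u, v))
    (ho' : ∀ k < K, ∀ u v, G.Adj u v → G.edist o' u = k → G.edist o' v = (k + 1 : ℕ) →
      t k ≤ L s(u, v))
    (hdisj : ∀ u, G.edist o u ≤ K → ¬ G.edist o' u ≤ K) (p : G.Walk o o') :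
    ENNReal.ofReal (2 * ∑ k ∈ Finset.range K, t k) ≤
      (p.edges.map fun e => ENNReal.ofReal (L e)).sum := by
  set φ : ℕ → ℝ := fun n => ∑ k ∈ Finset.range n, t k with hφ
  have hmono : Monotone φ := fun m n hmn =>
    Finset.sum_le_sum_of_subset_of_nonneg (Finset.range_mono hmn) fun _ _ _ => ht _
  have hsucc : ∀ n, φ (n + 1) = φ n + t n := fun n => Finset.sum_range_succ _ _
  set pot : V → ℝ := fun v => φ (truncDist G K o v) - φ (truncDist G K o' v) with hpot
  have hfar : ∀ {a u : V}, ¬ G.edist a u ≤ K → truncDist G K a u = K := by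
    intro a u h
    have := coe_truncDist (G := G) K a u
    rw [min_eq_right (not_le.1 h).le] at this
    exact_mod_cast this
  have hnear : ∀ {a u : V} {n : ℕ}, G.edist a u = n → n ≤ K → G.edist a u ≤ K := by
    intro a u n h hn
    rw [h]; exact_mod_cast hn
  -- along an edge the potential can only increase inside one of the two balls, where the other
  -- truncated distance is constantly `K`
  have hlip : ∀ u v, G.Adj u v → ENNReal.ofReal (pot v - pot u) ≤ ENNReal.ofReal (L s(u, v)) := by
    intro u v huv
    have a1 := truncDist_le_succ (K := K) (o := o) huv
    have b1 := truncDist_le_succ (K := K) (o := o') huv.symm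
    by_cases ha : truncDist G K o v = truncDist G K o u + 1
    · obtain ⟨hK, hu, hv⟩ := edist_of_truncDist_eq_succ huv ha
      have e1 := hfar (hdisj u (hnear hu hK.le))
      have e2 := hfar (hdisj v (hnear hv hK))
      refine ENNReal.ofReal_le_ofReal ?_
      simp only [hpot]
      rw [e1, e2, ha, hsucc]
      have := ho _ hK u v huv hu hv
      linarith
    · have ha' : φ (truncDist G K o v) ≤ φ (truncDist G K o u) := hmono (by omega)
      by_cases hb : truncDist G K o' u = truncDist G K o' v + 1
      · obtain ⟨hK, hv, hu⟩ := edist_of_truncDist_eq_succ huv.symm hb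
        refine ENNReal.ofReal_le_ofReal ?_
        have := ho' _ hK v u huv.symm hv hu
        rw [Sym2.eq_swap] at this
        simp only [hpot]
        rw [hb, hsucc]
        linarith
      · have hb' : φ (truncDist G K o' u) ≤ φ (truncDist G K o' v) := hmono (by omega)
        rw [ENNReal.ofReal_of_nonpos (by simp only [hpot]; linarith)]
        exact zero_le
  have hwalk : ∀ {u v : V} (q : G.Walk u v), ENNReal.ofReal (pot v - pot u) ≤
      (q.edges.map fun e => ENNReal.ofReal (L e)).sum := by
    intro u v q
    induction q with
    | nil => simp
    | @cons u v w h q ih =>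
      rw [SimpleGraph.Walk.edges_cons, List.map_cons, List.sum_cons]
      have : pot w - pot u = (pot v - pot u) + (pot w - pot v) := by ring
      rw [this]
      exact ENNReal.ofReal_add_le.trans (add_le_add (hlip u v h) ih)
  have h0 : ∀ a : V, truncDist G K a a = 0 := fun a => by
    have := coe_truncDist (G := G) K a a
    rw [SimpleGraph.edist_self, min_eq_left zero_le] at this
    exact_mod_cast this
  have h1 : truncDist G K o o' = K := hfar fun h => hdisj o' h (by simp)
  have h2 : truncDist G K o' o = K := hfar (hdisj o (by simp))
  have hend : pot o' - pot o = 2 * ∑ k ∈ Finset.range K, t k := by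
    simp only [hpot, h0, h1, h2, hφ]
    simp
    ring
  rw [← hend]
  exact hwalk p

end GraphCost

/-- Walks that are not paths may also be used to bound the `L`-distance from above. -/
lemma distL_le_walk {d : ℕ} {lam α : ℝ} {ω : Sample d} {x y : Vert d}
    (p : (graph lam α ω).Walk x y) :
    distL lam α ω x y ≤ (p.edges.map fun e => ENNReal.ofReal (edgeWeight ω e)).sum := by
  classical
  refine (iInf_le _ (⟨p.bypass, p.bypass_isPath⟩ : (graph lam α ω).Path x y)).trans ?_
  exact (p.edges_bypass_sublist_edges.map _).sum_le_sum fun _ _ => zero_le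

/-! ### Growth of graph balls -/

/-- The bad event for the exploration from `o` with thresholds `w`, `R`, `t`: some path from `o`
whose first weights respect the thresholds `w i` ends in a vertex violating its threshold, or has
a last step longer than allowed by `R`, or a last edge cheaper than allowed by `t`. The length bound
`1` on the other steps is no restriction, since all edges have length at least `1`. -/
def badGrowth {d : ℕ} (lam α : ℝ) (w R t : ℕ → ℝ) (o : Vert d) : Set (Sample d) :=
  (⋃ k, existsPath lam α o k (fun i => if i < k then Icc 1 (w i) else Ioi (w k))
    (fun _ => univ) fun _ => 1) ∪
  ((⋃ n, existsPath lam α o (n + 1) (fun i => Icc 1 (w i)) (fun _ => univ)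
    fun i => if i = n then R n else 1) ∪
  ⋃ n, existsPath lam α o (n + 1) (fun i => Icc 1 (w i))
    (fun i => if i = n then Iio (t n) else univ) fun _ => 1)

section Deterministic

variable {d : ℕ} {lam α : ℝ} {w R t : ℕ → ℝ} {o : Vert d} {ω : Sample d}

lemma one_le_eucDist_of_adj {x y : Vert d} (h : (graph lam α ω).Adj x y) : 1 ≤ eucDist x y :=
  one_le_eucDist h.ne

/-- Off the bad event, weights along geodesics respect the thresholds. -/
lemma weight_le_of_notMem_badGrowth (hω : ω ∉ badGrowth lam α w R t o)
    (h1 : ∀ v, 1 ≤ vertexWeight ω v) {v : Vert d} (p : (graph lam α ω).Walk o v)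
    (hp : (p.length : ℕ∞) = (graph lam α ω).edist o v) {j : ℕ} (hj : j ≤ p.length) :
    vertexWeight ω (p.getVert j) ≤ w j := by
  induction j using Nat.strong_induction_on with
  | _ j ih =>
  by_contra hcon
  refine hω (Or.inl (mem_iUnion.2 ⟨j, fun i => p.getVert i, p.getVert_zero, ?_, ?_, ?_, ?_, ?_⟩))
  · intro a b hab
    exact Fin.ext (getVert_injOn_of_length_eq_edist p hp
      (by simp only [mem_ofPred_eq]; omega) (by simp only [mem_ofPred_eq]; omega) hab)
  · exact fun i => one_le_eucDist_of_adj (p.adj_getVert_succ (by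
      have := i.2; simp only [Fin.val_castSucc]; omega))
  · intro i
    by_cases hi : (i : ℕ) < j
    · simp only [hi, if_true]
      exact ⟨h1 _, ih i hi (by omega)⟩
    · have : (i : ℕ) = j := by omega
      simp only [this, lt_irrefl, if_false]
      exact not_le.1 hcon
  · exact fun i => p.adj_getVert_succ (by have := i.2; simp only [Fin.val_castSucc]; omega)
  · exact fun i => mem_univ _

/-- Off the bad event, an edge from the graph sphere of radius `k` to that of radius `k + 1` is
neither too long nor too cheap. -/
lemma edge_of_notMem_badGrowth (hω : ω ∉ badGrowth lam α w R t o)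
    (h1 : ∀ v, 1 ≤ vertexWeight ω v) {k : ℕ} {u v : Vert d} (huv : (graph lam α ω).Adj u v)
    (hu : (graph lam α ω).edist o u = k) (hv : (graph lam α ω).edist o v = (k + 1 : ℕ)) :
    t k ≤ edgeWeight ω s(u, v) ∧ eucDist u v < R k := by
  obtain ⟨p, hp⟩ := SimpleGraph.exists_walk_of_edist_eq_coe hu
  set q := p.concat huv with hq
  have hlen : q.length = k + 1 := by rw [hq, SimpleGraph.Walk.length_concat, hp]
  have hqe : (q.length : ℕ∞) = (graph lam α ω).edist o v := by rw [hlen, hv]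
  have hwle := fun j hj => weight_le_of_notMem_badGrowth hω h1 q hqe (j := j) hj
  have hadj : ∀ i < k + 1, (graph lam α ω).Adj (q.getVert i) (q.getVert (i + 1)) :=
    fun i hi => q.adj_getVert_succ (by omega)
  have hinj : Function.Injective fun i : Fin (k + 1 + 1) => q.getVert i := by
    intro a b hab
    exact Fin.ext (getVert_injOn_of_length_eq_edist q hqe
      (by simp only [mem_ofPred_eq]; omega) (by simp only [mem_ofPred_eq]; omega) hab)
  have hA : ∀ i : Fin (k + 1 + 1), vertexWeight ω (q.getVert i) ∈ Icc 1 (w i) :=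
    fun i => ⟨h1 _, hwle i (by omega)⟩
  have hk : q.getVert k = u := by
    rw [hq, SimpleGraph.Walk.concat_eq_append, SimpleGraph.Walk.getVert_append, hp]
    simp
  have hk1 : q.getVert (k + 1) = v := by rw [← hlen]; exact q.getVert_length
  constructor
  · by_contra hcon
    refine hω (Or.inr (Or.inr (mem_iUnion.2 ⟨k, fun i => q.getVert i, q.getVert_zero, hinj,
      fun i => one_le_eucDist_of_adj (hadj _ i.2), hA, fun i => hadj _ i.2, fun i => ?_⟩)))
    by_cases hi : (i : ℕ) = k
    · simp only [hi, if_true, Fin.val_castSucc, Fin.val_succ, hk, hk1]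
      exact not_le.1 hcon
    · simp only [hi, if_false, mem_univ]
  · by_contra hcon
    refine hω (Or.inr (Or.inl (mem_iUnion.2 ⟨k, fun i => q.getVert i, q.getVert_zero, hinj,
      fun i => ?_, hA, fun i => hadj _ i.2, fun i => mem_univ _⟩)))
    by_cases hi : (i : ℕ) = k
    · simp only [hi, if_true, Fin.val_castSucc, Fin.val_succ, hk, hk1]
      exact not_lt.1 hcon
    · simp only [hi, if_false]
      exact one_le_eucDist_of_adj (hadj _ i.2)

/-- Off the bad event, graph balls are contained in Euclidean balls. -/
lemma eucDist_le_of_notMem_badGrowth (hω : ω ∉ badGrowth lam α w R t o)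
    (h1 : ∀ v, 1 ≤ vertexWeight ω v) {k : ℕ} {v : Vert d}
    (hv : (graph lam α ω).edist o v = k) : eucDist o v ≤ ∑ i ∈ Finset.range k, R i := by
  induction k generalizing v with
  | zero =>
    have : o = v := SimpleGraph.edist_eq_zero_iff.1 (by exact_mod_cast hv)
    simp [← this, eucDist_self]
  | succ k ih =>
    obtain ⟨p, hp⟩ := SimpleGraph.exists_walk_of_edist_eq_coe hv
    have hpe : (p.length : ℕ∞) = (graph lam α ω).edist o v := by rw [hp, hv]
    have hu := edist_getVert p hpe (i := k) (by omega)
    have hadj := p.adj_getVert_succ (i := k) (by omega)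
    have hend : p.getVert (k + 1) = v := by rw [← hp]; exact p.getVert_length
    rw [hend] at hadj
    have h2 := (edge_of_notMem_badGrowth hω h1 hadj hu hv).2.le
    rw [Finset.sum_range_succ]
    exact (eucDist_triangle o (p.getVert k) v).trans (add_le_add (ih hu) h2)

/-- Off the bad events of two far apart centres, the `L`-distance is large. -/
lemma two_sided_distL_le (ht : ∀ k, 0 ≤ t k) (hR : ∀ k, 0 ≤ R k) {o' : Vert d} {K : ℕ}
    (hω : ω ∉ badGrowth lam α w R t o) (hω' : ω ∉ badGrowth lam α w R t o')
    (h1 : ∀ v, 1 ≤ vertexWeight ω v)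
    (hfar : 2 * ∑ i ∈ Finset.range K, R i < eucDist o o') :
    ENNReal.ofReal (2 * ∑ k ∈ Finset.range K, t k) ≤ distL lam α ω o o' := by
  refine le_iInf fun p => ?_
  have hball : ∀ {a u : Vert d}, ω ∉ badGrowth lam α w R t a →
      (graph lam α ω).edist a u ≤ K → eucDist a u ≤ ∑ i ∈ Finset.range K, R i := by
    intro a u ha hu
    obtain ⟨n, hn⟩ := ENat.ne_top_iff_exists.1 (ne_top_of_le_ne_top (ENat.natCast_ne_top K) hu)
    have hnK : n ≤ K := by rw [← hn] at hu; exact_mod_cast hu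
    exact (eucDist_le_of_notMem_badGrowth ha h1 hn.symm).trans
      (Finset.sum_le_sum_of_subset_of_nonneg (Finset.range_mono hnK) fun _ _ _ => hR _)
  refine two_sided_cost_le (G := graph lam α ω) (L := edgeWeight ω) ht
    (fun k _ u v huv hu hv => (edge_of_notMem_badGrowth hω h1 huv hu hv).1)
    (fun k _ u v huv hu hv => (edge_of_notMem_badGrowth hω' h1 huv hu hv).1)
    (fun u hu hu' => ?_) _
  have e1 := hball hω hu
  have e2 := hball hω' hu'
  have e3 := eucDist_triangle o u o'
  rw [eucDist_comm u o'] at e3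
  linarith

end Deterministic

/-- The first moment bound when the weight thresholds grow doubly exponentially. -/
lemma law_existsPath_exp_le {d : ℕ} {lam α θ s b c A : ℝ} (hθ0 : 0 ≤ θ) (hθ1 : θ ≤ 1)
    (hs : 0 ≤ s) (hb : b ≤ 2 * θ) (hc : 1 < c) (hA0 : 0 ≤ A)
    (μ ν : Measure ℝ) [IsProbabilityMeasure μ] [IsProbabilityMeasure ν] {Q : ℝ≥0∞}
    (hQ1 : ENNReal.ofReal ((max 1 lam) ^ θ) * latticeSum d (α * θ - s) ≤ Q)
    (hQ2 : moment μ b (Ici 1) ≤ Q) (o : Vert d)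
    (k : ℕ) {D C : ℕ → Set ℝ} {R : ℕ → ℝ} (hR : ∀ i, 0 < R i)
    (hD : ∀ i, MeasurableSet (D i)) (hD1 : ∀ i, D i ⊆ Ici 1)
    (hDk : ∀ i < k, D i = Icc 1 (Real.exp (A * c ^ i))) (hC : ∀ i, MeasurableSet (C i)) :
    law d μ ν (existsPath lam α o k D C R) ≤
      Q ^ (2 * k) * ENNReal.ofReal (Real.exp (A * ((2 * θ - b) / (c - 1)) * c ^ k)) *
      (∏ i ∈ Finset.range k, ENNReal.ofReal (R i ^ (-s)) * ν (C i)) * moment μ θ (D k) := by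
  refine (law_existsPath_le hθ0 hθ1 hs μ ν o k hR hD hD1 hC).trans ?_
  have h1 : ∏ i ∈ Finset.range k, ENNReal.ofReal ((max 1 lam) ^ θ) * latticeSum d (α * θ - s) *
      ENNReal.ofReal (R i ^ (-s)) * ν (C i) ≤
      Q ^ k * ∏ i ∈ Finset.range k, ENNReal.ofReal (R i ^ (-s)) * ν (C i) := by
    have : Q ^ k = ∏ _i ∈ Finset.range k, Q := by simp
    rw [this, ← Finset.prod_mul_distrib]
    refine Finset.prod_le_prod' fun i _ => ?_
    rw [mul_assoc _ _ (ν (C i))]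
    exact mul_le_mul_left hQ1 _
  have h2 : ∏ i ∈ Finset.range k, moment μ (2 * θ) (D i) ≤
      ENNReal.ofReal (Real.exp (A * ((2 * θ - b) / (c - 1)) * c ^ k)) * Q ^ k := by
    have : ∏ i ∈ Finset.range k, moment μ (2 * θ) (D i) ≤
        ∏ i ∈ Finset.range k, (ENNReal.ofReal (Real.exp (A * (2 * θ - b) * c ^ i)) * Q) := by
      refine Finset.prod_le_prod' fun i hi => ?_
      rw [hDk i (Finset.mem_range.1 hi)]
      refine (moment_Icc_le μ (Real.one_le_exp (by positivity)) hb).trans ?_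
      rw [← Real.exp_mul]
      have e : A * c ^ i * (2 * θ - b) = A * (2 * θ - b) * c ^ i := by ring
      rw [e]
      exact mul_le_mul_right hQ2 _
    refine this.trans ?_
    rw [Finset.prod_mul_distrib, Finset.prod_const, Finset.card_range]
    refine mul_le_mul_left ?_ _
    rw [← ENNReal.ofReal_prod_of_nonneg fun i _ => (Real.exp_pos _).le]
    refine ENNReal.ofReal_le_ofReal ?_
    rw [← Real.exp_sum, Real.exp_le_exp, ← Finset.mul_sum, geom_sum_eq hc.ne']
    have hc1 : 0 < c - 1 := by linarith
    have : A * (2 * θ - b) * ((c ^ k - 1) / (c - 1)) =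
        A * ((2 * θ - b) / (c - 1)) * (c ^ k - 1) := by field_simp
    rw [this]
    refine mul_le_mul_of_nonneg_left (by linarith) ?_
    exact mul_nonneg hA0 (div_nonneg (by linarith) hc1.le)
  calc _ ≤ (Q ^ k * ∏ i ∈ Finset.range k, ENNReal.ofReal (R i ^ (-s)) * ν (C i)) *
      ((ENNReal.ofReal (Real.exp (A * ((2 * θ - b) / (c - 1)) * c ^ k)) * Q ^ k) *
        moment μ θ (D k)) := mul_le_mul' h1 (mul_le_mul_left h2 _)
    _ = _ := by ring

/-- The bad event is unlikely. The truncated moments of order `2θ` along a path of length `k`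
contribute, up to a power of `Q`, at most `exp (A g c ^ k)` with `g = (2θ - b) / (c - 1)`; each of
the three violations at step `k` is paid for by a factor `exp (-z A c ^ k)`, with `z = b - θ` for
the weight, `z = B s` for the length and `z = B` for the edge-weight. The assumptions on `κ` say
that `z - g ≥ κ` in each case. -/
lemma law_badGrowth_le {d : ℕ} {lam α θ s b c A B κ : ℝ} (hθ0 : 0 ≤ θ) (hθ1 : θ ≤ 1)
    (hs : 0 ≤ s) (hθb : θ ≤ b) (hb : b ≤ 2 * θ) (hc : 1 < c) (hA0 : 0 ≤ A)
    (hκ1 : κ + (2 * θ - b) / (c - 1) ≤ b - θ) (hκ2 : κ + (2 * θ - b) / (c - 1) ≤ B * s)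
    (hκ3 : κ + (2 * θ - b) / (c - 1) ≤ B)
    (μ ν : Measure ℝ) [IsProbabilityMeasure μ] [IsProbabilityMeasure ν]
    (hν0 : ν (Iio 0) = 0) {Q : ℝ≥0∞}
    (hQ1 : ENNReal.ofReal ((max 1 lam) ^ θ) * latticeSum d (α * θ - s) ≤ Q)
    (hQ2 : moment μ b (Ici 1) ≤ Q) (o : Vert d) :
    law d μ ν (badGrowth lam α (fun k => Real.exp (A * c ^ k))
      (fun k => Real.exp (A * B * c ^ (k + 1)))
      (fun k => genInv (cdf ν) (Real.exp (-(A * B * c ^ (k + 1))))) o) ≤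
      3 * ∑' k : ℕ, Q ^ (2 * k + 1) * ENNReal.ofReal (Real.exp (-(κ * A * c ^ k))) := by
  set g := (2 * θ - b) / (c - 1) with hg
  set E : ℕ → ℝ≥0∞ := fun k =>
    Q ^ (2 * k + 1) * ENNReal.ofReal (Real.exp (-(κ * A * c ^ k))) with hE
  have hAc : ∀ k : ℕ, 0 ≤ A * c ^ k := fun k => by positivity
  have hcombine : ∀ (k : ℕ) (z : ℝ), (κ + g) * (A * c ^ k) ≤ z →
      Q ^ (2 * k) * ENNReal.ofReal (Real.exp (A * g * c ^ k)) *
        ENNReal.ofReal (Real.exp (-z)) * Q ≤ E k := by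
    intro k z hz
    have : ENNReal.ofReal (Real.exp (A * g * c ^ k)) * ENNReal.ofReal (Real.exp (-z)) ≤
        ENNReal.ofReal (Real.exp (-(κ * A * c ^ k))) := by
      rw [← ENNReal.ofReal_mul (Real.exp_pos _).le, ← Real.exp_add]
      refine ENNReal.ofReal_le_ofReal (Real.exp_le_exp.2 ?_)
      linarith
    calc _ = Q ^ (2 * k + 1) * (ENNReal.ofReal (Real.exp (A * g * c ^ k)) *
          ENNReal.ofReal (Real.exp (-z))) := by ring
      _ ≤ _ := mul_le_mul_right this _
  have hmeasIcc : ∀ i : ℕ, MeasurableSet (Icc 1 (Real.exp (A * c ^ i))) := fun _ =>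
    measurableSet_Icc
  have hIccIci : ∀ i : ℕ, Icc 1 (Real.exp (A * c ^ i)) ⊆ Ici 1 := fun _ => Icc_subset_Ici_self
  have h1exp : ∀ k : ℕ, 1 ≤ Real.exp (A * c ^ k) := fun k => Real.one_le_exp (hAc k)
  have bad1 : ∀ k : ℕ, law d μ ν (existsPath lam α o k
      (fun i => if i < k then Icc 1 (Real.exp (A * c ^ i)) else Ioi (Real.exp (A * c ^ k)))
      (fun _ => univ) fun _ => 1) ≤ E k := by
    intro k
    refine (law_existsPath_exp_le hθ0 hθ1 hs hb hc hA0 μ ν hQ1 hQ2 o k (fun _ => one_pos)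
      (fun i => ?_) (fun i => ?_) (fun i hi => by simp [hi]) fun _ => MeasurableSet.univ).trans ?_
    · split_ifs
      exacts [measurableSet_Icc, measurableSet_Ioi]
    · split_ifs
      exacts [hIccIci i, Ioi_subset_Ici (h1exp k)]
    · simp only [Real.one_rpow, ENNReal.ofReal_one, measure_univ, mul_one, Finset.prod_const_one,
        lt_irrefl, if_false]
      refine le_trans ?_ (hcombine k (A * c ^ k * (b - θ)) ?_)
      · rw [mul_assoc _ _ Q]
        refine mul_le_mul_right ?_ _
        refine (moment_Ioi_le μ (h1exp k) hθb).trans ?_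
        rw [← Real.exp_mul]
        have : A * c ^ k * (θ - b) = -(A * c ^ k * (b - θ)) := by ring
        rw [this]
        exact mul_le_mul_right hQ2 _
      · rw [mul_comm]
        exact mul_le_mul_of_nonneg_left hκ1 (hAc k)
  have bad2 : ∀ n : ℕ, law d μ ν (existsPath lam α o (n + 1)
      (fun i => Icc 1 (Real.exp (A * c ^ i))) (fun _ => univ)
      fun i => if i = n then Real.exp (A * B * c ^ (n + 1)) else 1) ≤ E (n + 1) := by
    intro n
    refine (law_existsPath_exp_le hθ0 hθ1 hs hb hc hA0 μ ν hQ1 hQ2 o (n + 1) (fun i => ?_)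
      hmeasIcc hIccIci (fun i _ => rfl) fun _ => MeasurableSet.univ).trans ?_
    · split_ifs
      exacts [Real.exp_pos _, one_pos]
    · have hprod : ∏ i ∈ Finset.range (n + 1), ENNReal.ofReal
          ((if i = n then Real.exp (A * B * c ^ (n + 1)) else 1) ^ (-s)) * ν univ =
          ENNReal.ofReal (Real.exp (-(A * B * c ^ (n + 1) * s))) := by
        rw [Finset.prod_range_succ, Finset.prod_eq_one fun i hi => ?_]
        · rw [if_pos rfl, ← Real.exp_mul, measure_univ, one_mul, mul_one, mul_neg]
        · rw [if_neg (Finset.mem_range.1 hi).ne]; simp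
      rw [hprod]
      refine le_trans ?_ (hcombine (n + 1) (A * B * c ^ (n + 1) * s) ?_)
      · exact mul_le_mul_right ((moment_Icc_le_of_le μ hθb).trans hQ2) _
      · have := mul_le_mul_of_nonneg_right hκ2 (hAc (n + 1))
        linarith
  have bad3 : ∀ n : ℕ, law d μ ν (existsPath lam α o (n + 1)
      (fun i => Icc 1 (Real.exp (A * c ^ i)))
      (fun i => if i = n then Iio (genInv (cdf ν) (Real.exp (-(A * B * c ^ (n + 1))))) else univ)
      fun _ => 1) ≤ E (n + 1) := by
    intro n
    refine (law_existsPath_exp_le hθ0 hθ1 hs hb hc hA0 μ ν hQ1 hQ2 o (n + 1) (fun _ => one_pos)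
      hmeasIcc hIccIci (fun i _ => rfl) fun i => ?_).trans ?_
    · split_ifs
      exacts [measurableSet_Iio, MeasurableSet.univ]
    · have hprod : ∏ i ∈ Finset.range (n + 1), ENNReal.ofReal ((1 : ℝ) ^ (-s)) * ν
          (if i = n then Iio (genInv (cdf ν) (Real.exp (-(A * B * c ^ (n + 1))))) else univ) ≤
          ENNReal.ofReal (Real.exp (-(A * B * c ^ (n + 1)))) := by
        rw [Finset.prod_range_succ, Finset.prod_eq_one fun i hi => ?_]
        · rw [if_pos rfl]
          simp only [Real.one_rpow, ENNReal.ofReal_one, one_mul]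
          exact measure_Iio_genInv_le hν0 (Real.exp_pos _)
        · rw [if_neg (Finset.mem_range.1 hi).ne]; simp
      refine le_trans ?_ (hcombine (n + 1) (A * B * c ^ (n + 1)) ?_)
      · exact mul_le_mul' (mul_le_mul_right hprod _) ((moment_Icc_le_of_le μ hθb).trans hQ2)
      · have := mul_le_mul_of_nonneg_right hκ3 (hAc (n + 1))
        linarith
  have hshift : ∑' n, E (n + 1) ≤ ∑' k, E k :=
    ENNReal.tsum_comp_le_tsum_of_injective (add_left_injective 1) E
  have sum1 := (measure_iUnion_le (μ := law d μ ν) fun k : ℕ => existsPath lam α o k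
      (fun i => if i < k then Icc 1 (Real.exp (A * c ^ i)) else Ioi (Real.exp (A * c ^ k)))
      (fun _ => univ) fun _ => 1).trans (ENNReal.tsum_le_tsum bad1)
  have sum2 := (measure_iUnion_le (μ := law d μ ν) fun n : ℕ => existsPath lam α o (n + 1)
      (fun i => Icc 1 (Real.exp (A * c ^ i))) (fun _ => univ)
      fun i => if i = n then Real.exp (A * B * c ^ (n + 1)) else 1).trans
      ((ENNReal.tsum_le_tsum bad2).trans hshift)
  have sum3 := (measure_iUnion_le (μ := law d μ ν) fun n : ℕ => existsPath lam α o (n + 1)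
      (fun i => Icc 1 (Real.exp (A * c ^ i)))
      (fun i => if i = n then Iio (genInv (cdf ν) (Real.exp (-(A * B * c ^ (n + 1))))) else univ)
      fun _ => 1).trans ((ENNReal.tsum_le_tsum bad3).trans hshift)
  calc _ ≤ (∑' k, E k) + ((∑' k, E k) + ∑' k, E k) :=
        (measure_union_le _ _).trans (add_le_add sum1
          ((measure_union_le _ _).trans (add_le_add sum2 sum3)))
    _ = _ := by ring

/-- The series bounding the bad events is arbitrarily small for large `A`: as
`c ^ k ≥ 1 + k (c - 1)`, it is dominated by a geometric series with a small first term. -/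
lemma eventually_tsum_le {q κ c : ℝ} (hq : 0 ≤ q) (hκ : 0 < κ) (hc : 1 < c) {η : ℝ≥0∞}
    (hη : η ≠ 0) : ∀ᶠ A : ℝ in atTop,
      3 * ∑' k : ℕ, ENNReal.ofReal q ^ (2 * k + 1) *
        ENNReal.ofReal (Real.exp (-(κ * A * c ^ k))) ≤ η := by
  have hexp : ∀ r : ℝ, 0 < r → Tendsto (fun A : ℝ => Real.exp (-(r * A))) atTop (𝓝 0) :=
    fun r hr => Real.tendsto_exp_neg_atTop_nhds_zero.comp (tendsto_id.const_mul_atTop hr)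
  have hc1 : 0 < c - 1 := by linarith
  have l1 : ∀ᶠ A : ℝ in atTop, q ^ 2 * Real.exp (-(κ * (c - 1) * A)) < 1 / 2 := by
    have := (hexp (κ * (c - 1)) (by positivity)).const_mul (q ^ 2)
    rw [mul_zero] at this
    exact this.eventually (gt_mem_nhds (by norm_num))
  have l2 : ∀ᶠ A : ℝ in atTop, 3 * ENNReal.ofReal (q * Real.exp (-(κ * A)) * 2) < η := by
    have h1 := ((hexp κ hκ).const_mul q).mul_const 2
    have h2 := ENNReal.Tendsto.const_mul (a := 3) ((ENNReal.continuous_ofReal.tendsto _).comp h1)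
      (Or.inr (by simp))
    simp only [mul_zero, zero_mul, ENNReal.ofReal_zero] at h2
    exact h2.eventually (gt_mem_nhds (pos_iff_ne_zero.2 hη))
  filter_upwards [l1, l2, eventually_ge_atTop 0] with A h1 h2 hA
  refine le_trans (mul_le_mul_right ?_ _) h2.le
  have hterm : ∀ k : ℕ, ENNReal.ofReal q ^ (2 * k + 1) *
      ENNReal.ofReal (Real.exp (-(κ * A * c ^ k))) ≤
      ENNReal.ofReal (q * Real.exp (-(κ * A)) * (1 / 2) ^ k) := by
    intro k
    rw [← ENNReal.ofReal_pow hq, ← ENNReal.ofReal_mul (by positivity)]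
    refine ENNReal.ofReal_le_ofReal ?_
    have hck : 1 + (k : ℝ) * (c - 1) ≤ c ^ k := by
      have := one_add_mul_le_pow (by linarith : (-2 : ℝ) ≤ c - 1) k
      rwa [add_sub_cancel] at this
    have hle : Real.exp (-(κ * A * c ^ k)) ≤
        Real.exp (-(κ * A)) * Real.exp (-(κ * (c - 1) * A)) ^ k := by
      rw [← Real.exp_nat_mul, ← Real.exp_add, Real.exp_le_exp]
      have := mul_le_mul_of_nonneg_left hck (by positivity : 0 ≤ κ * A)
      linarith
    calc q ^ (2 * k + 1) * Real.exp (-(κ * A * c ^ k)) ≤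
        q ^ (2 * k + 1) * (Real.exp (-(κ * A)) * Real.exp (-(κ * (c - 1) * A)) ^ k) := by gcongr
      _ = q * Real.exp (-(κ * A)) * (q ^ 2 * Real.exp (-(κ * (c - 1) * A))) ^ k := by ring
      _ ≤ _ := by gcongr
  refine (ENNReal.tsum_le_tsum hterm).trans ?_
  rw [← ENNReal.ofReal_tsum_of_nonneg (fun k => by positivity)
    (summable_geometric_two.mul_left _), tsum_mul_left, tsum_geometric_two]

lemma ae_one_le_vertexWeight {d : ℕ} (μ ν : Measure ℝ) [IsProbabilityMeasure μ]
    [IsProbabilityMeasure ν] (hμ1 : μ (Iio 1) = 0) :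
    law d μ ν {ω | ¬ ∀ v, 1 ≤ vertexWeight ω v} = 0 := by
  have h : ∀ v : Vert d, ∀ᵐ ω ∂law d μ ν, 1 ≤ vertexWeight ω v := by
    intro v
    have hmp : MeasurePreserving (fun ω : Sample d => ω.1 v) (law d μ ν) μ :=
      (measurePreserving_eval_infinitePi (fun _ : Vert d => μ) v).comp
        (by unfold law; exact measurePreserving_fst)
    have h0 : ∀ᵐ w ∂μ, 1 ≤ w := by
      rw [ae_iff]
      convert hμ1 using 2
      ext w
      simp
    exact hmp.quasiMeasurePreserving.ae h0
  exact ae_iff.1 (ae_all_iff.2 h)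

/-! ### The lower bound on the `L`-distance -/

lemma abs_floorVert_sub_le {d : ℕ} (v : EuclideanSpace ℝ (Fin d)) (i : Fin d) :
    |v i - (floorVert v i : ℝ)| ≤ 1 := by
  rw [floorVert, abs_le]
  constructor
  · linarith [Int.floor_le (v i)]
  · linarith [Int.lt_floor_add_one (v i)]

lemma le_eucDist_floorVert {d : ℕ} {e : EuclideanSpace ℝ (Fin d)} (he : ‖e‖ = 1) {m : ℝ}
    (hm : 0 ≤ m) : m - d ≤ eucDist 0 (floorVert (m • e)) := by
  set v := m • e with hv
  have hvn : ‖v‖ = m := by rw [hv, norm_smul, he, mul_one, Real.norm_of_nonneg hm]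
  set f : EuclideanSpace ℝ (Fin d) := WithLp.toLp 2 fun i => (floorVert v i : ℝ) with hf
  have h1 : eucDist 0 (floorVert v) = ‖f‖ := by
    rw [eucDist_eq_dist, dist_comm, dist_eq_norm]
    congr 1
    ext i
    simp [hf]
  have h2 : ‖v - f‖ ≤ d := by
    rw [EuclideanSpace.norm_eq, Real.sqrt_le_left (by positivity)]
    have : ∑ i, ‖(v - f) i‖ ^ 2 ≤ ∑ _i : Fin d, (1 : ℝ) := by
      refine Finset.sum_le_sum fun i _ => ?_
      have h3 := abs_floorVert_sub_le v i
      have h4 : ‖(v - f) i‖ ≤ 1 := by simpa [hf] using h3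
      exact pow_le_one₀ (norm_nonneg _) h4
    refine this.trans ?_
    simp only [Finset.sum_const, Finset.card_univ, Fintype.card_fin, nsmul_eq_mul, mul_one]
    rcases Nat.eq_zero_or_pos d with rfl | hd
    · simp
    · have : (1 : ℝ) ≤ d := by exact_mod_cast hd
      nlinarith
  have h3 := norm_le_norm_add_norm_sub' v f
  rw [hvn] at h3
  rw [h1]
  linarith

/-- Admissible exponents for the lower bound exist for every growth rate `c > 1 / (γ - 1)`. In the
limiting case `θ = D / α`, `b = β`, the ratio `(2θ - b) / (b - θ)` is `(2 - γ) / (γ - 1)`, which is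
`1 / (γ - 1) - 1`. -/
lemma exists_exponents {D α β γ c : ℝ} (hD : 0 < D) (hα : D < α) (hγ : γ = α * β / D)
    (hγ1 : 1 < γ) (hγ2 : γ < 2) (hc : 1 / (γ - 1) < c) :
    ∃ θ b, D < α * θ ∧ 0 < θ ∧ θ ≤ 1 ∧ b < β ∧ θ < b ∧ b ≤ 2 * θ ∧
      (2 * θ - b) / (c - 1) < b - θ := by
  have hα0 : 0 < α := hD.trans hα
  have hβ : β = D / α * γ := by rw [hγ]; field_simp
  have hDα : 0 < D / α := by positivity
  have hβ0 : 0 < β := by rw [hβ]; positivity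
  have hg1 : 0 < γ - 1 := by linarith
  have hc1 : 1 < c := by
    refine lt_of_le_of_lt ?_ hc
    rw [le_div_iff₀ hg1]; linarith
  have hck : (2 - γ) < (c - 1) * (γ - 1) := by
    rw [div_lt_iff₀ hg1] at hc
    linarith
  have ev : ∀ {f g : ℝ → ℝ}, Continuous f → Continuous g → f 0 < g 0 →
      ∀ᶠ ε in 𝓝[>] (0 : ℝ), f ε < g ε := fun hf hg h =>
    (hf.continuousAt.eventually_lt hg.continuousAt h).filter_mono nhdsWithin_le_nhds
  have e1 := ev (f := fun ε => D / α * (1 + ε)) (g := fun _ => 1) (by fun_prop) (by fun_prop)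
    (by simpa using (div_lt_one hα0).2 hα)
  have e2 := ev (f := fun ε => D / α * (1 + ε)) (g := fun ε => β * (1 - ε)) (by fun_prop)
    (by fun_prop) (by simp only [add_zero, sub_zero, mul_one, hβ]; nlinarith)
  have e3 := ev (f := fun ε => β * (1 - ε)) (g := fun ε => 2 * (D / α * (1 + ε))) (by fun_prop)
    (by fun_prop) (by simp only [add_zero, sub_zero, mul_one, hβ]; nlinarith)
  have e4 := ev (f := fun ε => 2 * (D / α * (1 + ε)) - β * (1 - ε))
    (g := fun ε => (c - 1) * (β * (1 - ε) - D / α * (1 + ε))) (by fun_prop)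
    (by fun_prop) (by simp only [add_zero, sub_zero, mul_one, hβ]; nlinarith)
  obtain ⟨ε, h1, h2, h3, h4, hε⟩ :=
    (e1.and (e2.and (e3.and (e4.and self_mem_nhdsWithin)))).exists
  have hε0 : 0 < ε := hε
  refine ⟨D / α * (1 + ε), β * (1 - ε), ?_, by positivity, h1.le, ?_, h2, h3.le, ?_⟩
  · have : α * (D / α * (1 + ε)) = D * (1 + ε) := by field_simp
    rw [this]; nlinarith
  · nlinarith
  · rw [div_lt_iff₀ (by linarith)]; linarith

/-- The sum of the length thresholds `exp (B c ^ (i + 1))` is at most the square of the last one. -/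
lemma sum_exp_le {B c : ℝ} (hB : 0 ≤ B) (hc : 1 < c) (hBc : 1 ≤ B * (c - 1)) (K : ℕ) :
    ∑ i ∈ Finset.range K, Real.exp (B * c ^ (i + 1)) ≤ Real.exp (2 * B * c ^ K) := by
  have h1 : ∑ i ∈ Finset.range K, Real.exp (B * c ^ (i + 1)) ≤ K * Real.exp (B * c ^ K) := by
    have := Finset.sum_le_card_nsmul (Finset.range K) (fun i => Real.exp (B * c ^ (i + 1)))
      (Real.exp (B * c ^ K)) fun i hi => Real.exp_le_exp.2
        (mul_le_mul_of_nonneg_left (pow_le_pow_right₀ hc.le (Finset.mem_range.1 hi)) hB)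
    simpa using this
  have hck : 1 + (K : ℝ) * (c - 1) ≤ c ^ K := by
    have := one_add_mul_le_pow (by linarith : (-2 : ℝ) ≤ c - 1) K
    rwa [add_sub_cancel] at this
  have h2 : (K : ℝ) ≤ Real.exp (B * c ^ K) := by
    have := Real.add_one_le_exp (B * c ^ K)
    have h3 := mul_le_mul_of_nonneg_left hck hB
    have h4 := mul_le_mul_of_nonneg_right hBc (Nat.cast_nonneg (α := ℝ) K)
    linarith
  refine h1.trans ((mul_le_mul_of_nonneg_right h2 (Real.exp_pos _).le).trans (le_of_eq ?_))
  rw [← Real.exp_add]; congr 1; ring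

lemma eventually_two_mul_exp_half_log_lt (D : ℝ) :
    ∀ᶠ m : ℝ in atTop, 2 * Real.exp (Real.log m / 2) < m - D := by
  have h1 : Tendsto (fun m : ℝ => Real.exp (Real.log m / 2)) atTop atTop :=
    Real.tendsto_exp_atTop.comp (Real.tendsto_log_atTop.atTop_div_const two_pos)
  filter_upwards [h1.eventually_ge_atTop (3 + |D|), eventually_gt_atTop 0] with m hm h0
  have hsq : Real.exp (Real.log m / 2) * Real.exp (Real.log m / 2) = m := by
    rw [← Real.exp_add, add_halves, Real.exp_log h0]
  have := abs_nonneg D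
  have := le_abs_self D
  nlinarith

/-- With probability arbitrarily close to one, the `L`-distance is at least the integral of the
profile, divided by any rate `a` larger than `|log (γ - 1)|`, up to an additive constant. -/
theorem distL_lower_bound {d : ℕ} (hd : 1 ≤ d) {α lam τ γ : ℝ} (hα : (d : ℝ) < α)
    (hγdef : γ = α * (τ - 1) / d) (hγ1 : 1 < γ) (hγ2 : γ < 2)
    (μ : Measure ℝ) [IsProbabilityMeasure μ] (hμ1 : μ (Iio 1) = 0) (hμ : PowerLawTail μ τ)
    (ν : Measure ℝ) [IsProbabilityMeasure ν] (hν0 : ν (Iio 0) = 0)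
    {e : EuclideanSpace ℝ (Fin d)} (he : ‖e‖ = 1) {a : ℝ} (ha : |Real.log (γ - 1)| < a)
    {η : ℝ≥0∞} (hη : η ≠ 0) :
    ∃ C : ℝ, ∀ᶠ m : ℝ in atTop,
      law d μ ν {ω | distL lam α ω 0 (floorVert (m • e)) <
        ENNReal.ofReal
          (2 / a * (∫ x in (0 : ℝ)..Real.log (Real.log m), profile ν x) - C)} ≤ η := by
  have hd' : (0 : ℝ) < d := by exact_mod_cast hd
  have hg1 : 0 < γ - 1 := by linarith
  have ha0 : 0 < a := (abs_nonneg _).trans_lt ha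
  -- the growth rate of the logarithms of the thresholds
  set c := Real.exp a with hc
  have hcγ : 1 / (γ - 1) < c := by
    rw [hc, ← Real.exp_log (one_div_pos.2 hg1), Real.exp_lt_exp, one_div, Real.log_inv]
    exact (neg_le_abs _).trans_lt ha
  have hc1 : 1 < c := Real.one_lt_exp_iff.2 ha0
  obtain ⟨θ, b, h1, hθ0, hθ1, hbβ, hθb, hb2, hg⟩ :=
    exists_exponents hd' hα hγdef hγ1 hγ2 hcγ
  set s := (α * θ - d) / 2 with hs
  have hs0 : 0 < s := by rw [hs]; linarith
  set g := (2 * θ - b) / (c - 1) with hgdef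
  have hg0 : 0 ≤ g := div_nonneg (by linarith) (by linarith)
  set κ := b - θ - g with hκ
  have hκ0 : 0 < κ := by rw [hκ]; linarith
  -- the smallest `B` for which long steps and cheap edges are as unlikely as large weights
  set B := max ((κ + g) / s) (κ + g) with hB
  have hB0 : 0 < B := lt_of_lt_of_le (by linarith) (le_max_right _ _)
  -- a common finite bound for the two constants of the first moment estimate
  obtain ⟨q, hq0, hQ1, hQ2⟩ : ∃ q : ℝ, 0 ≤ q ∧
      ENNReal.ofReal ((max 1 lam) ^ θ) * latticeSum d (α * θ - s) ≤ ENNReal.ofReal q ∧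
      moment μ b (Ici 1) ≤ ENNReal.ofReal q := by
    have t1 : ENNReal.ofReal ((max 1 lam) ^ θ) * latticeSum d (α * θ - s) ≠ ⊤ :=
      ENNReal.mul_ne_top ENNReal.ofReal_ne_top (latticeSum_ne_top (by rw [hs]; linarith))
    have t2 : moment μ b (Ici 1) ≠ ⊤ := hμ.moment_ne_top (by linarith) hbβ
    refine ⟨max (ENNReal.toReal _) (ENNReal.toReal _),
      le_max_of_le_left ENNReal.toReal_nonneg,
      (ENNReal.ofReal_toReal t1).symm.le.trans (ENNReal.ofReal_le_ofReal (le_max_left _ _)),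
      (ENNReal.ofReal_toReal t2).symm.le.trans (ENNReal.ofReal_le_ofReal (le_max_right _ _))⟩
  have hη2 : η / 2 ≠ 0 := (ENNReal.half_pos hη).ne'
  obtain ⟨A, hAη, hA1, hA2, hA3⟩ := ((eventually_tsum_le hq0 hκ0 hc1 hη2).and
    ((eventually_ge_atTop 1).and ((eventually_ge_atTop (1 / B)).and
    (eventually_ge_atTop (1 / (B * (c - 1))))))).exists
  have hA0 : 0 < A := by linarith
  have hAB : 1 ≤ A * B := (div_le_iff₀ hB0).1 hA2
  have hABc : 1 ≤ A * B * (c - 1) := by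
    rw [mul_assoc]
    exact (div_le_iff₀ (mul_pos hB0 (by linarith))).1 hA3
  have hbad : ∀ o : Vert d, law d μ ν (badGrowth lam α (fun k => Real.exp (A * c ^ k))
      (fun k => Real.exp (A * B * c ^ (k + 1)))
      (fun k => genInv (cdf ν) (Real.exp (-(A * B * c ^ (k + 1))))) o) ≤ η / 2 := fun o =>
    (law_badGrowth_le hθ0.le hθ1 hs0.le hθb.le hb2 hc1 hA0.le (by rw [hκ]; linarith)
      (by
        have := le_max_left ((κ + g) / s) (κ + g)
        rwa [div_le_iff₀ hs0] at this)
      (le_max_right _ _) μ ν hν0 hQ1 hQ2 o).trans hAη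
  have hanti := profile_antitone hν0
  have hnn := profile_nonneg hν0
  set b₀ := Real.log (A * B) with hb₀
  have hb₀0 : 0 ≤ b₀ := Real.log_nonneg hAB
  have hprof : ∀ k : ℕ, genInv (cdf ν) (Real.exp (-(A * B * c ^ (k + 1)))) =
      profile ν (b₀ + (k + 1) * a) := by
    intro k
    rw [profile, Real.exp_add, hb₀, Real.exp_log (by linarith), hc, ← Real.exp_nat_mul]
    push_cast
    rfl
  refine ⟨2 / a * ((Real.log 4 + b₀ + a) * profile ν 0), ?_⟩
  filter_upwards [eventually_two_mul_exp_half_log_lt d, eventually_gt_atTop 1,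
    (Real.tendsto_log_atTop.comp Real.tendsto_log_atTop).eventually_ge_atTop
      (Real.log (4 * (A * B)))] with m hm hm1 hmT
  simp only [Function.comp] at hmT
  set T := Real.log (Real.log m)
  have hlogm : 0 < Real.log m := Real.log_pos hm1
  -- the number of generations for which the two graph balls certainly stay disjoint
  set K := ⌊(T - Real.log (4 * (A * B))) / a⌋₊ with hK
  have hK1 : (K : ℝ) * a ≤ T - Real.log (4 * (A * B)) := by
    have := Nat.floor_le (div_nonneg (by linarith : 0 ≤ T - Real.log (4 * (A * B))) ha0.le)
    rwa [le_div_iff₀ ha0] at this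
  have hK2 : T - Real.log (4 * (A * B)) ≤ (K + 1) * a := by
    have := (Nat.lt_floor_add_one ((T - Real.log (4 * (A * B))) / a)).le
    rwa [div_le_iff₀ ha0] at this
  have hlog4 : Real.log (4 * (A * B)) = Real.log 4 + b₀ :=
    Real.log_mul (by norm_num) (by linarith)
  have hlog40 : 0 ≤ Real.log 4 := Real.log_nonneg (by norm_num)
  have hcK : 4 * (A * B) * c ^ K ≤ Real.log m := by
    have : c ^ K = Real.exp (K * a) := by rw [hc, ← Real.exp_nat_mul]
    rw [this, ← Real.exp_log (by positivity : 0 < 4 * (A * B)), ← Real.exp_add,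
      ← Real.exp_log hlogm, Real.exp_le_exp]
    linarith
  -- the two graph balls of radius `K` have Euclidean radius at most `√m`
  have hfar : 2 * ∑ i ∈ Finset.range K, Real.exp (A * B * c ^ (i + 1)) <
      eucDist 0 (floorVert (m • e)) := by
    have h2 := sum_exp_le (by linarith) hc1 hABc K
    have h3 : Real.exp (2 * (A * B) * c ^ K) ≤ Real.exp (Real.log m / 2) :=
      Real.exp_le_exp.2 (by linarith)
    have h4 := le_eucDist_floorVert he (m := m) (by linarith)
    linarith
  have hsum : 2 / a * (∫ x in (0 : ℝ)..T, profile ν x) -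
      2 / a * ((Real.log 4 + b₀ + a) * profile ν 0) ≤
      2 * ∑ k ∈ Finset.range K, genInv (cdf ν) (Real.exp (-(A * B * c ^ (k + 1)))) := by
    simp_rw [hprof]
    have i1 := integral_le_sum_of_antitone hanti ha0 b₀ K
    have hU : 0 ≤ b₀ + (K + 1) * a := by positivity
    have i2 := integral_shift_le hanti hnn (b := 0) (T := T) (U := b₀ + (K + 1) * a)
      (s := Real.log 4) le_rfl hU hlog40 (by linarith)
    have i3 := intervalIntegral.integral_add_adjacent_intervals
      (hanti.intervalIntegrable (μ := volume) (a := 0) (b := b₀ + a))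
      (hanti.intervalIntegrable (μ := volume) (a := b₀ + a) (b := b₀ + (K + 1) * a))
    have i4 := integral_le_of_antitone hanti (b := 0) (c := b₀ + a) (by linarith)
    have i5 : (∫ x in (0 : ℝ)..T, profile ν x) - (Real.log 4 + b₀ + a) * profile ν 0 ≤
        ∫ x in (b₀ + a)..(b₀ + (K + 1) * a), profile ν x := by linarith
    have i6 := mul_le_mul_of_nonneg_left i5 (by positivity : 0 ≤ 2 / a)
    have i7 : 2 / a * (∫ x in (b₀ + a)..(b₀ + (K + 1) * a), profile ν x) =
        2 * (1 / a * ∫ x in (b₀ + a)..(b₀ + (K + 1) * a), profile ν x) := by ring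
    linarith
  have hsub : {ω | distL lam α ω 0 (floorVert (m • e)) < ENNReal.ofReal
      (2 / a * (∫ x in (0 : ℝ)..T, profile ν x) -
        2 / a * ((Real.log 4 + b₀ + a) * profile ν 0))} ⊆
      {ω | ¬ ∀ v, 1 ≤ vertexWeight ω v} ∪
      (badGrowth lam α (fun k => Real.exp (A * c ^ k))
        (fun k => Real.exp (A * B * c ^ (k + 1)))
        (fun k => genInv (cdf ν) (Real.exp (-(A * B * c ^ (k + 1))))) 0 ∪
      badGrowth lam α (fun k => Real.exp (A * c ^ k))
        (fun k => Real.exp (A * B * c ^ (k + 1)))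
        (fun k => genInv (cdf ν) (Real.exp (-(A * B * c ^ (k + 1))))) (floorVert (m • e))) := by
    intro ω hω
    by_contra hcon
    simp only [mem_union, not_or] at hcon
    obtain ⟨n1, n2, n3⟩ := hcon
    have hW : ∀ v, 1 ≤ vertexWeight ω v := not_not.1 n1
    have := two_sided_distL_le (fun k => genInv_nonneg hν0 (Real.exp_pos _))
      (fun k => (Real.exp_pos _).le) n2 n3 hW hfar
    exact absurd (lt_of_le_of_lt ((ENNReal.ofReal_le_ofReal hsum).trans this) hω) (lt_irrefl _)
  calc _ ≤ _ := measure_mono hsub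
    _ ≤ 0 + (η / 2 + η / 2) := (measure_union_le _ _).trans
        (add_le_add (ae_one_le_vertexWeight μ ν hμ1).le
          ((measure_union_le _ _).trans (add_le_add (hbad _) (hbad _))))
    _ = η := by rw [zero_add, ENNReal.add_halves]

/-! ### Common neighbours -/

section Independence

variable {ι : Type*}

lemma infinitePi_block {E X ζ : Type*} [Fintype ζ] [MeasurableSpace X] (P : Measure X)
    [IsProbabilityMeasure P] {f : ι → ζ → E}
    (hf : Function.Injective fun k : ι × ζ => f k.1 k.2) {T : Set X} (hT : MeasurableSet T)
    (i : ι) : Measure.infinitePi (fun _ : E => P) {u | ∀ z, u (f i z) ∈ T} =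
      P T ^ Fintype.card ζ := by
  have hinj : Function.Injective (f i) := fun z z' h =>
    congrArg Prod.snd (@hf (i, z) (i, z') h)
  rw [infinitePi_forall_mem P hinj fun _ => hT, Finset.prod_const, Finset.card_univ]

/-- Events depending on disjoint blocks of coordinates are independent. -/
lemma iIndepSet_infinitePi_block {E X ζ : Type*} [Fintype ζ] [MeasurableSpace X] (P : Measure X)
    [IsProbabilityMeasure P] {f : ι → ζ → E}
    (hf : Function.Injective fun k : ι × ζ => f k.1 k.2) {T : Set X} (hT : MeasurableSet T) :
    iIndepSet (fun i => {u : E → X | ∀ z, u (f i z) ∈ T}) (Measure.infinitePi fun _ => P) := by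
  have hmeas : ∀ i, MeasurableSet {u : E → X | ∀ z, u (f i z) ∈ T} := fun i => by
    have : {u : E → X | ∀ z, u (f i z) ∈ T} = ⋂ z, (fun u : E → X => u (f i z)) ⁻¹' T := by
      ext u; simp
    rw [this]
    exact MeasurableSet.iInter fun z => measurable_pi_apply (f i z) hT
  rw [iIndepSet_iff_meas_biInter hmeas]
  intro s
  simp_rw [infinitePi_block P hf hT]
  have hset : (⋂ i ∈ s, {u : E → X | ∀ z, u (f i z) ∈ T}) =
      {u | ∀ k : s × ζ, u (f k.1 k.2) ∈ T} := by
    ext u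
    simp [Prod.forall]
  have hinj : Function.Injective fun k : s × ζ => f k.1 k.2 := by
    rintro ⟨⟨i, hi⟩, z⟩ ⟨⟨j, hj⟩, z'⟩ h
    have := @hf (i, z) (j, z') h
    simp only [Prod.mk.injEq] at this
    simp [this.1, this.2]
  rw [hset, infinitePi_forall_mem P hinj fun _ => hT]
  simp [← pow_mul, mul_comm]

lemma iIndepSet_prod_prod {Ω₁ Ω₂ : Type*} [MeasurableSpace Ω₁] [MeasurableSpace Ω₂]
    {P₁ : Measure Ω₁} {P₂ : Measure Ω₂} [SFinite P₂] {s₁ : ι → Set Ω₁}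
    {s₂ : ι → Set Ω₂} (h₁ : iIndepSet s₁ P₁) (h₂ : iIndepSet s₂ P₂)
    (m₁ : ∀ i, MeasurableSet (s₁ i)) (m₂ : ∀ i, MeasurableSet (s₂ i)) :
    iIndepSet (fun i => s₁ i ×ˢ s₂ i) (P₁.prod P₂) := by
  have := h₁.isProbabilityMeasure
  have := h₂.isProbabilityMeasure
  rw [iIndepSet_iff_meas_biInter fun i => (m₁ i).prod (m₂ i)]
  intro s
  have e : (⋂ i ∈ s, s₁ i ×ˢ s₂ i) = (⋂ i ∈ s, s₁ i) ×ˢ ⋂ i ∈ s, s₂ i := by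
    ext p
    simp only [mem_iInter, mem_prod]
    exact ⟨fun h => ⟨fun i hi => (h i hi).1, fun i hi => (h i hi).2⟩,
      fun h i hi => ⟨h.1 i hi, h.2 i hi⟩⟩
  rw [e, Measure.prod_prod, (iIndepSet_iff_meas_biInter m₁).1 h₁ s,
    (iIndepSet_iff_meas_biInter m₂).1 h₂ s, ← Finset.prod_mul_distrib]
  exact Finset.prod_congr rfl fun i _ => (Measure.prod_prod _ _).symm

lemma measure_iInter_compl_of_iIndepSet [Fintype ι] {Ω : Type*} [MeasurableSpace Ω]
    {P : Measure Ω} {s : ι → Set Ω} (h : iIndepSet s P) (hs : ∀ i, MeasurableSet (s i)) :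
    P (⋂ i, (s i)ᶜ) = ∏ i, (1 - P (s i)) := by
  have := h.isProbabilityMeasure
  have h1 := (iIndepSet_iff s P).1 h Finset.univ (f := fun i => (s i)ᶜ) fun i _ =>
    (MeasurableSpace.measurableSet_generateFrom (mem_singleton (s i))).compl
  simp only [Finset.mem_univ, iInter_true] at h1
  rw [h1]
  exact Finset.prod_congr rfl fun i _ => prob_compl_eq_one_sub (hs i)

end Independence

/-- Among the vertices `u ∈ S`, the events that `u` has weight larger than `w` and that all pairs
`{v, u}`, `v ∈ Z`, have small uniform variable and cheap edge are independent; hence it is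
exponentially unlikely that none of them occurs. -/
lemma law_no_common_neighbour_le {d : ℕ} (μ ν : Measure ℝ) [IsProbabilityMeasure μ]
    [IsProbabilityMeasure ν] {Z S : Finset (Vert d)} (hZS : Disjoint Z S) (w t : ℝ) :
    law d μ ν {ω | ∀ u ∈ S, ¬ (w < vertexWeight ω u ∧
      ∀ v ∈ Z, edgeUniform ω s(v, u) < 1 / 2 ∧ edgeWeight ω s(v, u) ≤ t)} ≤
    ENNReal.ofReal (Real.exp (-(S.card * (μ.real (Ioi w) * (cdf ν t / 2) ^ Z.card)))) := by
  set half : unitInterval := ⟨1 / 2, by norm_num, by norm_num⟩ with hhalf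
  set f : S → Z → Sym2 (Vert d) := fun u v => s((v : Vert d), (u : Vert d)) with hf
  have hfinj : Function.Injective fun k : S × Z => f k.1 k.2 := by
    rintro ⟨⟨u, hu⟩, ⟨v, hv⟩⟩ ⟨⟨u', hu'⟩, ⟨v', hv'⟩⟩ h
    rcases Sym2.eq_iff.1 h with ⟨h1, h2⟩ | ⟨h1, _⟩
    · simp only at h1 h2
      subst h1 h2
      rfl
    · simp only at h1
      subst h1
      exact absurd hu' (Finset.disjoint_left.1 hZS hv)
  have hginj : Function.Injective fun k : S × Unit => (k.1 : Vert d) := by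
    rintro ⟨u, _⟩ ⟨u', _⟩ h
    simp only [Prod.mk.injEq, and_true]
    exact Subtype.ext h
  set A : S → Set (Vert d → ℝ) := fun u => {W | ∀ _z : Unit, W u ∈ Ioi w} with hA
  set B : S → Set (Sym2 (Vert d) → unitInterval) := fun u => {U | ∀ v : Z, U (f u v) ∈ Iio half}
    with hB
  set C : S → Set (Sym2 (Vert d) → ℝ) := fun u => {L | ∀ v : Z, L (f u v) ∈ Iic t} with hC
  have hmB : ∀ u, MeasurableSet (B u) := fun u => by
    have : B u = ⋂ v : Z, (fun U : Sym2 (Vert d) → unitInterval => U (f u v)) ⁻¹' Iio half := by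
      ext U; simp [hB]
    rw [this]
    exact MeasurableSet.iInter fun z => measurable_pi_apply (f u z) measurableSet_Iio
  have hmC : ∀ u, MeasurableSet (C u) := fun u => by
    have : C u = ⋂ v : Z, (fun L : Sym2 (Vert d) → ℝ => L (f u v)) ⁻¹' Iic t := by
      ext U; simp [hC]
    rw [this]
    exact MeasurableSet.iInter fun z => measurable_pi_apply (f u z) measurableSet_Iic
  have hmA : ∀ u, MeasurableSet (A u) := fun u => by
    have : A u = (fun W : Vert d → ℝ => W u) ⁻¹' Ioi w := by
      ext W; simp [hA]
    rw [this]
    exact measurable_pi_apply (u : Vert d) measurableSet_Ioi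
  have hiA : iIndepSet A (Measure.infinitePi fun _ => μ) :=
    iIndepSet_infinitePi_block μ (f := fun (u : S) (_ : Unit) => (u : Vert d)) hginj
      measurableSet_Ioi
  have hiB : iIndepSet B (Measure.infinitePi fun _ => volume) :=
    iIndepSet_infinitePi_block volume hfinj measurableSet_Iio
  have hiC : iIndepSet C (Measure.infinitePi fun _ => ν) :=
    iIndepSet_infinitePi_block ν hfinj measurableSet_Iic
  have hind : iIndepSet (fun u => A u ×ˢ (B u ×ˢ C u)) (law d μ ν) :=
    iIndepSet_prod_prod hiA (iIndepSet_prod_prod hiB hiC hmB hmC) hmA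
      fun u => (hmB u).prod (hmC u)
  set y := μ.real (Ioi w) * (cdf ν t / 2) ^ Z.card with hy
  have hF0 := cdf_nonneg ν t
  have hy0 : 0 ≤ y := mul_nonneg measureReal_nonneg (by positivity)
  have hprob : ∀ u, law d μ ν (A u ×ˢ (B u ×ˢ C u)) = ENNReal.ofReal y := by
    intro u
    have eA : Measure.infinitePi (fun _ : Vert d => μ) (A u) = μ (Ioi w) := by
      have := infinitePi_block μ (f := fun (u : S) (_ : Unit) => (u : Vert d)) hginj
        (T := Ioi w) measurableSet_Ioi u
      simpa [hA] using this
    have eB := infinitePi_block (volume : Measure unitInterval) hfinj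
      (T := Iio half) measurableSet_Iio u
    have eC := infinitePi_block ν hfinj (T := Iic t) measurableSet_Iic u
    rw [law, Measure.prod_prod, Measure.prod_prod, eA, eB, eC, unitInterval.volume_Iio,
      Fintype.card_coe, ← mul_pow, ← ofReal_cdf, ← ENNReal.ofReal_mul (by rw [hhalf]; norm_num),
      ← ENNReal.ofReal_pow (mul_nonneg (by rw [hhalf]; norm_num) hF0),
      ← ofReal_measureReal (μ := μ), ← ENNReal.ofReal_mul measureReal_nonneg, hy]
    congr 3
    rw [hhalf]
    ring
  have hsub : {ω : Sample d | ∀ u ∈ S, ¬ (w < vertexWeight ω u ∧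
      ∀ v ∈ Z, edgeUniform ω s(v, u) < 1 / 2 ∧ edgeWeight ω s(v, u) ≤ t)} ⊆
      ⋂ u : S, (A u ×ˢ (B u ×ˢ C u))ᶜ := by
    intro ω hω
    refine mem_iInter.2 fun u hu => hω u u.2 ⟨hu.1 (), fun v hv => ⟨?_, ?_⟩⟩
    · exact hu.2.1 ⟨v, hv⟩
    · exact hu.2.2 ⟨v, hv⟩
  refine (measure_mono hsub).trans ?_
  rw [measure_iInter_compl_of_iIndepSet hind fun u => (hmA u).prod ((hmB u).prod (hmC u))]
  simp_rw [hprob]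
  rw [Finset.prod_const, Finset.card_univ, Fintype.card_coe]
  have h1 : 1 - ENNReal.ofReal y ≤ ENNReal.ofReal (Real.exp (-y)) := by
    rw [← ENNReal.ofReal_one, ← ENNReal.ofReal_sub _ hy0]
    exact ENNReal.ofReal_le_ofReal (by linarith [Real.add_one_le_exp (-y)])
  refine (pow_le_pow_left' h1 _).trans (le_of_eq ?_)
  rw [← ENNReal.ofReal_pow (Real.exp_pos _).le, ← Real.exp_nat_mul, mul_neg]

/-- The event that some `v ∈ B` and `v' ∈ B'` have no common neighbour in `S` of weight larger than
`w`, joined to both by edges of small uniform variable and of edge-weight at most `t`. The pair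
`v = v'` is allowed; it stands for the search for a single neighbour. -/
def noMeet {d : ℕ} (B B' S : Finset (Vert d)) (w t : ℝ) : Set (Sample d) :=
  {ω | ∃ v ∈ B, ∃ v' ∈ B', ∀ u ∈ S, u ≠ v → u ≠ v' → ¬ (w < vertexWeight ω u ∧
    (edgeUniform ω s(v, u) < 1 / 2 ∧ edgeWeight ω s(v, u) ≤ t) ∧
    (edgeUniform ω s(v', u) < 1 / 2 ∧ edgeWeight ω s(v', u) ≤ t))}

/-- Union bound over the pairs; the vertices of the pair itself are removed from `S`, whence
the `2`. -/
lemma law_noMeet_le {d : ℕ} (μ ν : Measure ℝ) [IsProbabilityMeasure μ]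
    [IsProbabilityMeasure ν] (B B' S : Finset (Vert d)) (w t : ℝ) :
    law d μ ν (noMeet B B' S w t) ≤ ENNReal.ofReal (B.card * B'.card *
      Real.exp (-(((S.card : ℝ) - 2) * (μ.real (Ioi w) * (cdf ν t / 2) ^ 2)))) := by
  classical
  set x := Real.exp (-(((S.card : ℝ) - 2) * (μ.real (Ioi w) * (cdf ν t / 2) ^ 2))) with hx
  have hF0 := cdf_nonneg ν t
  have hF1 := cdf_le_one ν t
  have hpair : ∀ v v' : Vert d, law d μ ν {ω | ∀ u ∈ S, u ≠ v → u ≠ v' →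
      ¬ (w < vertexWeight ω u ∧
      (edgeUniform ω s(v, u) < 1 / 2 ∧ edgeWeight ω s(v, u) ≤ t) ∧
      (edgeUniform ω s(v', u) < 1 / 2 ∧ edgeWeight ω s(v', u) ≤ t))} ≤ ENNReal.ofReal x := by
    intro v v'
    set Z : Finset (Vert d) := {v, v'}
    have hZ : Z.card ≤ 2 := Finset.card_le_two
    refine (measure_mono ?_).trans ((law_no_common_neighbour_le μ ν
      (Finset.disjoint_sdiff (s := Z) (t := S)) w t).trans ?_)
    · intro ω hω u hu hstar
      rw [Finset.mem_sdiff] at hu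
      have hne : u ≠ v ∧ u ≠ v' := by simpa [Z] using hu.2
      exact hω u hu.1 hne.1 hne.2 ⟨hstar.1, hstar.2 v (by simp [Z]), hstar.2 v' (by simp [Z])⟩
    · refine ENNReal.ofReal_le_ofReal (Real.exp_le_exp.2 (neg_le_neg ?_))
      have h1 : (S.card : ℝ) - 2 ≤ (S \ Z).card := by
        have := Finset.le_card_sdiff Z S
        have h2 : S.card ≤ (S \ Z).card + 2 := by omega
        have : (S.card : ℝ) ≤ (S \ Z).card + 2 := by exact_mod_cast h2
        linarith
      have h2 : (cdf ν t / 2) ^ 2 ≤ (cdf ν t / 2) ^ Z.card :=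
        pow_le_pow_of_le_one (by positivity) (by linarith) hZ
      have hG : 0 ≤ μ.real (Ioi w) := measureReal_nonneg
      have h3 := mul_le_mul_of_nonneg_left h2 hG
      have h4 : 0 ≤ μ.real (Ioi w) * (cdf ν t / 2) ^ 2 := by positivity
      calc _ ≤ ((S \ Z).card : ℝ) * (μ.real (Ioi w) * (cdf ν t / 2) ^ 2) :=
            mul_le_mul_of_nonneg_right h1 h4
        _ ≤ _ := mul_le_mul_of_nonneg_left h3 (Nat.cast_nonneg _)
  have hsub : noMeet B B' S w t ⊆ ⋃ v ∈ B, ⋃ v' ∈ B', {ω | ∀ u ∈ S, u ≠ v → u ≠ v' →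
      ¬ (w < vertexWeight ω u ∧
      (edgeUniform ω s(v, u) < 1 / 2 ∧ edgeWeight ω s(v, u) ≤ t) ∧
      (edgeUniform ω s(v', u) < 1 / 2 ∧ edgeWeight ω s(v', u) ≤ t))} := by
    rintro ω ⟨v, hv, v', hv', h⟩
    exact mem_biUnion hv (mem_biUnion hv' h)
  calc _ ≤ ∑ v ∈ B, ∑ v' ∈ B', ENNReal.ofReal x :=
        (measure_mono hsub).trans ((measure_biUnion_finset_le _ _).trans
          (Finset.sum_le_sum fun v _ => (measure_biUnion_finset_le _ _).trans
            (Finset.sum_le_sum fun v' _ => hpair v v')))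
    _ = _ := by
      simp only [Finset.sum_const, nsmul_eq_mul]
      rw [ENNReal.ofReal_mul (by positivity), ENNReal.ofReal_mul (by positivity),
        ENNReal.ofReal_natCast, ENNReal.ofReal_natCast, mul_assoc]

/-! ### Boxes -/

/-- The box of the vertices at sup-distance at most `r` from `o`. -/
noncomputable def box {d : ℕ} (o : Vert d) (r : ℝ) : Finset (Vert d) :=
  Fintype.piFinset fun i => Finset.Icc (o i - ⌊r⌋) (o i + ⌊r⌋)

lemma mem_box {d : ℕ} {o v : Vert d} {r : ℝ} : v ∈ box o r ↔ ∀ i, |(v i : ℝ) - o i| ≤ r := by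
  simp only [box, Fintype.mem_piFinset, Finset.mem_Icc]
  refine forall_congr' fun i => ?_
  have : (|(v i : ℝ) - o i| ≤ r) ↔ |v i - o i| ≤ ⌊r⌋ := by
    rw [Int.le_floor]; push_cast; rfl
  rw [this, abs_le]
  constructor <;> rintro ⟨h1, h2⟩ <;> constructor <;> linarith

lemma card_box {d : ℕ} (o : Vert d) {r : ℝ} (hr : 0 ≤ r) :
    ((box o r).card : ℝ) = (2 * (⌊r⌋ : ℝ) + 1) ^ d := by
  have h0 : 0 ≤ ⌊r⌋ := Int.floor_nonneg.2 hr
  have h1 : ∀ i, (Finset.Icc (o i - ⌊r⌋) (o i + ⌊r⌋)).card = (2 * ⌊r⌋ + 1).toNat := fun i => by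
    rw [Int.card_Icc]; congr 1; ring
  rw [box, Fintype.card_piFinset, Finset.prod_congr rfl fun i _ => h1 i]
  simp only [Finset.prod_const, Finset.card_univ, Fintype.card_fin, Nat.cast_pow]
  congr 1
  have : ((2 * ⌊r⌋ + 1).toNat : ℤ) = 2 * ⌊r⌋ + 1 := Int.toNat_of_nonneg (by omega)
  have h2 := congrArg (Int.cast : ℤ → ℝ) this
  push_cast at h2
  exact h2

lemma card_box_le {d : ℕ} (o : Vert d) {r : ℝ} (hr : 1 ≤ r) :
    ((box o r).card : ℝ) ≤ (3 * r) ^ d := by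
  rw [card_box o (by linarith)]
  have := Int.floor_le r
  have h0 : (0 : ℝ) ≤ ⌊r⌋ := by exact_mod_cast Int.floor_nonneg.2 (by linarith)
  exact pow_le_pow_left₀ (by linarith) (by linarith) d

lemma le_card_box {d : ℕ} (o : Vert d) {r : ℝ} (hr : 0 ≤ r) : r ^ d ≤ ((box o r).card : ℝ) := by
  rw [card_box o hr]
  have := Int.lt_floor_add_one r
  have h0 : (0 : ℝ) ≤ ⌊r⌋ := by exact_mod_cast Int.floor_nonneg.2 hr
  exact pow_le_pow_left₀ hr (by linarith) d

/-! ### Climbing along hubs -/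

section Climb

variable {d : ℕ} {lam α : ℝ} {ω : Sample d}

lemma distL_triangle (x y z : Vert d) :
    distL lam α ω x z ≤ distL lam α ω x y + distL lam α ω y z := by
  conv_rhs => rw [distL, distL]
  rw [ENNReal.iInf_add]
  refine le_iInf fun p => ?_
  rw [ENNReal.add_iInf]
  refine le_iInf fun q => ?_
  refine (distL_le_walk ((p : (graph lam α ω).Walk x y).append q)).trans ?_
  rw [SimpleGraph.Walk.edges_append, List.map_append, List.sum_append]

lemma distL_comm_le (x y : Vert d) : distL lam α ω y x ≤ distL lam α ω x y := by
  refine le_iInf fun p => ?_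
  refine (distL_le_walk (p : (graph lam α ω).Walk x y).reverse).trans (le_of_eq ?_)
  rw [SimpleGraph.Walk.edges_reverse, List.map_reverse, List.sum_reverse]

lemma distL_le_of_adj {x y : Vert d} (h : (graph lam α ω).Adj x y) :
    distL lam α ω x y ≤ ENNReal.ofReal (edgeWeight ω s(x, y)) := by
  refine (distL_le_walk (SimpleGraph.Walk.cons h SimpleGraph.Walk.nil)).trans (le_of_eq ?_)
  simp

lemma distL_self (x : Vert d) : distL lam α ω x x = 0 := by
  have := distL_le_walk (SimpleGraph.Walk.nil : (graph lam α ω).Walk x x)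
  simpa using this

/-- If `λ W_v W_u ≥ ‖v - u‖ ^ α`, the connection probability is at least `1 - e⁻¹ > 1 / 2`. -/
lemma adj_of_large_weights {u v : Vert d} (hne : v ≠ u)
    (hU : edgeUniform ω s(v, u) < 1 / 2)
    (hW : eucDist v u ^ α ≤ lam * (vertexWeight ω v * vertexWeight ω u)) :
    (graph lam α ω).Adj v u := by
  have h1 := one_le_eucDist hne
  rcases h1.eq_or_lt with h | h
  · exact Or.inl h.symm
  · refine Or.inr ⟨h, hU.trans_le ?_⟩
    have hpos : 0 < eucDist v u ^ α := Real.rpow_pos_of_pos (by linarith) _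
    have h2 : 1 ≤ lam * (vertexWeight ω v * vertexWeight ω u / eucDist v u ^ α) := by
      rwa [← mul_div_assoc, one_le_div hpos]
    have h3 : Real.exp (-(lam * (vertexWeight ω v * vertexWeight ω u / eucDist v u ^ α))) ≤
        1 / 2 := by
      rw [Real.exp_neg, ← one_div]
      refine one_div_le_one_div_of_le two_pos ?_
      have := Real.add_one_le_exp (lam * (vertexWeight ω v * vertexWeight ω u / eucDist v u ^ α))
      linarith
    rw [connProb]
    linarith

/-- Inside a box in which all edge-weights are at most `C`, nearest-neighbour paths are cheap. -/
lemma distL_le_of_mem_box {o : Vert d} {r C : ℝ} (hC : 0 ≤ C)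
    (hL : ∀ u ∈ box o r, ∀ v ∈ box o r, edgeWeight ω s(u, v) ≤ C) {v : Vert d}
    (hv : v ∈ box o r) : distL lam α ω o v ≤ ENNReal.ofReal (d * r * C) := by
  have key : ∀ (n : ℕ) (v : Vert d), v ∈ box o r → ∑ i, (v i - o i).natAbs = n →
      distL lam α ω o v ≤ ENNReal.ofReal (n * C) := by
    intro n
    induction n with
    | zero =>
      intro v _ hn
      have : v = o := by
        ext i
        have := (Finset.sum_eq_zero_iff.1 hn) i (Finset.mem_univ i)
        omega
      rw [this, distL_self]
      exact zero_le
    | succ n ih =>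
      intro v hv hn
      obtain ⟨i, hi⟩ : ∃ i, v i ≠ o i := by
        by_contra! h
        simp [h] at hn
      obtain ⟨ε, hε1, hε2⟩ : ∃ ε : ℤ, |ε| = 1 ∧
          (v i + ε - o i).natAbs + 1 = (v i - o i).natAbs := by
        rcases lt_or_gt_of_ne hi with h | h
        · exact ⟨1, by simp, by omega⟩
        · exact ⟨-1, by simp, by omega⟩
      set u : Vert d := Function.update v i (v i + ε) with hu
      have hui : u i = v i + ε := by simp [hu]
      have huj : ∀ j, j ≠ i → u j = v j := fun j hj => by simp [hu, hj]
      have hubox : u ∈ box o r := by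
        rw [mem_box] at hv ⊢
        intro j
        by_cases hj : j = i
        · subst hj
          refine le_trans ?_ (hv j)
          have : |u j - o j| ≤ |v j - o j| := by
            rw [hui, Int.abs_eq_natAbs, Int.abs_eq_natAbs]; omega
          exact_mod_cast this
        · rw [huj j hj]; exact hv j
      have hsum : ∑ j, (u j - o j).natAbs = n := by
        rw [← Finset.add_sum_erase _ _ (Finset.mem_univ i)] at hn ⊢
        rw [Finset.sum_congr rfl fun j hj => by rw [huj j (Finset.ne_of_mem_erase hj)], hui]
        omega
      have hadj : (graph lam α ω).Adj u v := by
        left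
        rw [eucDist, Finset.sum_eq_single i]
        · rw [hui]
          push_cast
          rw [add_sub_cancel_left, Real.sqrt_sq_eq_abs]
          exact_mod_cast hε1
        · intro j _ hj
          rw [huj j hj]; simp
        · simp
      calc distL lam α ω o v ≤ distL lam α ω o u + distL lam α ω u v := distL_triangle _ _ _
        _ ≤ ENNReal.ofReal (n * C) + ENNReal.ofReal C :=
          add_le_add (ih u hubox hsum) ((distL_le_of_adj hadj).trans
            (ENNReal.ofReal_le_ofReal (hL u hubox v hv)))
        _ = _ := by
          rw [← ENNReal.ofReal_add (by positivity) hC]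
          congr 1; push_cast; ring
  refine (key _ v hv rfl).trans (ENNReal.ofReal_le_ofReal ?_)
  refine mul_le_mul_of_nonneg_right ?_ hC
  push_cast
  have h1 : ∑ i, |((v i - o i : ℤ) : ℝ)| ≤ ∑ _i : Fin d, r := Finset.sum_le_sum fun i _ => by
    push_cast; exact mem_box.1 hv i
  simpa [Nat.cast_natAbs] using h1

lemma eucDist_rpow_le {u v : Vert d} {r X : ℝ} (hα : 0 ≤ α) (hr : 0 ≤ r)
    (h : ∀ i, |(v i : ℝ) - u i| ≤ 3 * r) (hX : (d * (3 * r)) ^ α ≤ X) :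
    eucDist v u ^ α ≤ X :=
  (Real.rpow_le_rpow (eucDist_nonneg _ _) (eucDist_le_mul v u (by linarith) h) hα).trans hX

/-- Off the bad events, hubs of the successive levels are reached one after the other. -/
lemma exists_hub_of_notMem_noMeet {κ X : ℝ} (hα : 0 ≤ α) (hlam : 0 < lam) {ρ t : ℕ → ℝ}
    (hρ0 : ∀ i, 0 < ρ i) (hρ : Monotone ρ) {o : Vert d} {J : ℕ}
    (hconn : ∀ i < J, (d * (3 * ρ (i + 1))) ^ α ≤ lam * (ρ i ^ κ * ρ (i + 1) ^ κ))
    (hω : ∀ i < J, ω ∉ noMeet (box o (ρ i)) (box o (ρ i)) (box o (ρ (i + 1)))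
      (ρ (i + 1) ^ κ) (t i))
    (ht : ∀ i, 0 ≤ t i)
    (hX : 0 ≤ X)
    (h0 : ∃ v ∈ box o (ρ 0), ρ 0 ^ κ < vertexWeight ω v ∧
      distL lam α ω o v ≤ ENNReal.ofReal X) :
    ∃ v ∈ box o (ρ J), ρ J ^ κ < vertexWeight ω v ∧
      distL lam α ω o v ≤ ENNReal.ofReal (X + ∑ i ∈ Finset.range J, t i) := by
  induction J with
  | zero => simpa using h0
  | succ J ih =>
    obtain ⟨v, hv, hvW, hvd⟩ := ih (fun i hi => hconn i (by omega)) (fun i hi => hω i (by omega))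
    have hnm := hω J (by omega)
    simp only [noMeet, mem_ofPred_eq, not_exists, not_and, not_forall, not_not] at hnm
    obtain ⟨u, hu, huv, _, huW, ⟨hU, hL⟩, _⟩ := hnm v hv v hv
    have hadj : (graph lam α ω).Adj v u := by
      refine adj_of_large_weights huv.symm hU ?_
      refine (eucDist_rpow_le hα (hρ0 _).le (fun i => ?_) (hconn J (by omega))).trans ?_
      · have e1 := abs_le.1 (mem_box.1 hv i)
        have e2 := abs_le.1 (mem_box.1 hu i)
        have e3 := hρ (Nat.le_succ J)
        have := hρ0 (J + 1)
        simp only [Nat.succ_eq_add_one] at e3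
        rw [abs_le]
        constructor <;> linarith [e1.1, e1.2, e2.1, e2.2]
      · have := hρ0 J
        have := hρ0 (J + 1)
        have hv0 : 0 ≤ vertexWeight ω v := (Real.rpow_pos_of_pos (hρ0 J) κ).le.trans hvW.le
        gcongr
    refine ⟨u, hu, huW, (distL_triangle o v u).trans ?_⟩
    rw [Finset.sum_range_succ, ← add_assoc,
      ENNReal.ofReal_add (add_nonneg hX (Finset.sum_nonneg fun i _ => ht i)) (ht J)]
    exact add_le_add hvd ((distL_le_of_adj hadj).trans (ENNReal.ofReal_le_ofReal hL))

/-- Off the bad events, the hubs climbing from two centres meet. -/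
lemma distL_le_of_notMem_noMeet {κ X : ℝ} (hα : 0 ≤ α) (hlam : 0 < lam) {ρ t : ℕ → ℝ}
    (hρ0 : ∀ i, 0 < ρ i) (hρ : Monotone ρ) {o o' : Vert d} {J : ℕ}
    (hconn : ∀ i < J + 1, (d * (3 * ρ (i + 1))) ^ α ≤ lam * (ρ i ^ κ * ρ (i + 1) ^ κ))
    (hω : ∀ i < J, ω ∉ noMeet (box o (ρ i)) (box o (ρ i)) (box o (ρ (i + 1)))
      (ρ (i + 1) ^ κ) (t i))
    (hω' : ∀ i < J, ω ∉ noMeet (box o' (ρ i)) (box o' (ρ i)) (box o' (ρ (i + 1)))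
      (ρ (i + 1) ^ κ) (t i))
    (hmeet : ω ∉ noMeet (box o (ρ J)) (box o' (ρ J)) (box o (ρ (J + 1))) (ρ (J + 1) ^ κ) (t J))
    (ht : ∀ i, 0 ≤ t i) (hX : 0 ≤ X)
    (hoo' : ∀ i, |(o' i : ℝ) - o i| ≤ ρ (J + 1))
    (h0 : ∃ v ∈ box o (ρ 0), ρ 0 ^ κ < vertexWeight ω v ∧
      distL lam α ω o v ≤ ENNReal.ofReal X)
    (h0' : ∃ v ∈ box o' (ρ 0), ρ 0 ^ κ < vertexWeight ω v ∧
      distL lam α ω o' v ≤ ENNReal.ofReal X) :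
    distL lam α ω o o' ≤ ENNReal.ofReal (2 * X + 2 * ∑ i ∈ Finset.range (J + 1), t i) := by
  obtain ⟨v, hv, hvW, hvd⟩ := exists_hub_of_notMem_noMeet hα hlam hρ0 hρ
    (fun i hi => hconn i (by omega)) hω ht hX h0
  obtain ⟨v', hv', hvW', hvd'⟩ := exists_hub_of_notMem_noMeet hα hlam hρ0 hρ
    (fun i hi => hconn i (by omega)) hω' ht hX h0'
  simp only [noMeet, mem_ofPred_eq, not_exists, not_and, not_forall, not_not] at hmeet
  obtain ⟨u, hu, huv, huv', huW, ⟨hU, hL⟩, hU', hL'⟩ := hmeet v hv v' hv'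
  have hJ := hρ0 J
  have hJ1 := hρ0 (J + 1)
  have e3 : ρ J ≤ ρ (J + 1) := hρ (Nat.le_succ J)
  have hv0 : 0 ≤ vertexWeight ω v := (Real.rpow_pos_of_pos hJ κ).le.trans hvW.le
  have hv0' : 0 ≤ vertexWeight ω v' := (Real.rpow_pos_of_pos hJ κ).le.trans hvW'.le
  have hadj : (graph lam α ω).Adj v u := by
    refine adj_of_large_weights huv.symm hU ?_
    refine (eucDist_rpow_le hα hJ1.le (fun i => ?_) (hconn J (by omega))).trans ?_
    · have e1 := abs_le.1 (mem_box.1 hv i)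
      have e2 := abs_le.1 (mem_box.1 hu i)
      rw [abs_le]
      constructor <;> linarith [e1.1, e1.2, e2.1, e2.2]
    · gcongr
  have hadj' : (graph lam α ω).Adj v' u := by
    refine adj_of_large_weights huv'.symm hU' ?_
    refine (eucDist_rpow_le hα hJ1.le (fun i => ?_) (hconn J (by omega))).trans ?_
    · have e1 := abs_le.1 (mem_box.1 hv' i)
      have e2 := abs_le.1 (mem_box.1 hu i)
      have e4 := abs_le.1 (hoo' i)
      rw [abs_le]
      constructor <;> linarith [e1.1, e1.2, e2.1, e2.2, e4.1, e4.2]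
    · gcongr
  have hS : 0 ≤ ∑ i ∈ Finset.range J, t i := Finset.sum_nonneg fun i _ => ht i
  have d1 : distL lam α ω o u ≤ ENNReal.ofReal (X + ∑ i ∈ Finset.range (J + 1), t i) := by
    refine (distL_triangle o v u).trans ?_
    rw [Finset.sum_range_succ, ← add_assoc, ENNReal.ofReal_add (add_nonneg hX hS) (ht J)]
    exact add_le_add hvd ((distL_le_of_adj hadj).trans (ENNReal.ofReal_le_ofReal hL))
  have d2 : distL lam α ω o' u ≤ ENNReal.ofReal (X + ∑ i ∈ Finset.range (J + 1), t i) := by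
    refine (distL_triangle o' v' u).trans ?_
    rw [Finset.sum_range_succ, ← add_assoc, ENNReal.ofReal_add (add_nonneg hX hS) (ht J)]
    exact add_le_add hvd' ((distL_le_of_adj hadj').trans (ENNReal.ofReal_le_ofReal hL'))
  refine (distL_triangle o u o').trans
    ((add_le_add d1 ((distL_comm_le o' u).trans d2)).trans (le_of_eq ?_))
  have hS' : 0 ≤ ∑ i ∈ Finset.range (J + 1), t i := Finset.sum_nonneg fun i _ => ht i
  rw [← ENNReal.ofReal_add (add_nonneg hX hS') (add_nonneg hX hS')]
  congr 1; ring

end Climb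

/-! ### The upper bound on the `L`-distance -/

/-- The conditions on a radius `ρ` under which the boxes of radius `ρ` contain, up to an event of
probability at most `1 / ρ`, hubs of weight larger than `ρ ^ κ` with cheap edges to all the vertices
of a given box of comparable size. The tail condition replaces the slowly varying function by a
power slightly larger than `τ - 1`; the last condition pays for a union bound over all pairs. -/
structure LargeRadius (d : ℕ) (μ : Measure ℝ) (κ q ξ ρ : ℝ) : Prop where
  four_le : 4 ≤ ρ
  tail : (ρ ^ κ) ^ (-q) ≤ μ.real (Ioi (ρ ^ κ))
  small : (3 * ρ) ^ d * (3 * ρ) ^ d * Real.exp (-(ρ ^ ξ / 8)) ≤ 1 / ρ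

lemma eventually_largeRadius {d : ℕ} {μ : Measure ℝ} [IsProbabilityMeasure μ] {τ κ q ξ : ℝ}
    (hμ : PowerLawTail μ τ) (hτ : 1 < τ) (hq : τ - 1 < q) (hκ : 0 < κ) (hξ : 0 < ξ) :
    ∀ᶠ ρ in atTop, LargeRadius d μ κ q ξ ρ := by
  have h1 := (tendsto_rpow_atTop hκ).eventually (hμ.eventually_rpow_le hτ hq)
  have h2 : Tendsto (fun ρ : ℝ => (3 : ℝ) ^ d * 3 ^ d *
      ((ρ ^ ξ) ^ ((2 * d + 1 : ℝ) / ξ) * Real.exp (-(1 / 8) * ρ ^ ξ))) atTop (𝓝 0) := by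
    have := ((tendsto_rpow_mul_exp_neg_mul_atTop_nhds_zero ((2 * d + 1 : ℝ) / ξ) (1 / 8)
      (by norm_num)).comp (tendsto_rpow_atTop hξ)).const_mul ((3 : ℝ) ^ d * 3 ^ d)
    rwa [mul_zero] at this
  filter_upwards [h1, h2.eventually (gt_mem_nhds one_pos), eventually_ge_atTop 4]
    with ρ e1 e2 e3
  refine ⟨e3, e1, ?_⟩
  have h0 : 0 < ρ := by linarith
  rw [le_div_iff₀ h0]
  refine le_trans (le_of_eq ?_) e2.le
  have : (ρ ^ ξ) ^ ((2 * d + 1 : ℝ) / ξ) = ρ ^ d * ρ ^ d * ρ := by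
    rw [← Real.rpow_mul h0.le, mul_div_cancel₀ _ hξ.ne', Real.rpow_add h0, Real.rpow_one, two_mul,
      Real.rpow_add h0, Real.rpow_natCast]
  rw [this, mul_pow]
  have e4 : -(ρ ^ ξ / 8) = -(1 / 8) * ρ ^ ξ := by ring
  rw [e4]
  ring

/-- For `d - κ q = 3 ξ` a box of radius `ρ` contains at least about `ρ ^ (3 ξ)` hubs, of which a
proportion `ρ ^ (-2 ξ)` is joined to a given pair by edges cheaper than
`F⁻¹(ρ ^ (-ξ))`. This leaves `ρ ^ ξ` candidates on average, up to constants. -/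
lemma LargeRadius.law_noMeet_le {d : ℕ} (hd : 1 ≤ d) {μ ν : Measure ℝ} [IsProbabilityMeasure μ]
    [IsProbabilityMeasure ν] {κ q ξ ρ : ℝ} (h : LargeRadius d μ κ q ξ ρ)
    (hξ : 0 < ξ) (hexp : d - κ * q = 3 * ξ) {B B' : Finset (Vert d)}
    (hB : (B.card : ℝ) ≤ (3 * ρ) ^ d) (hB' : (B'.card : ℝ) ≤ (3 * ρ) ^ d) (o : Vert d) :
    law d μ ν (noMeet B B' (box o ρ) (ρ ^ κ) (genInv (cdf ν) (ρ ^ (-ξ)))) ≤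
      ENNReal.ofReal (1 / ρ) := by
  have h4 := h.four_le
  have h0 : 0 < ρ := by linarith
  refine (ScaleFreePercolation.law_noMeet_le μ ν B B' _ _ _).trans
    (ENNReal.ofReal_le_ofReal (le_trans ?_ h.small))
  have hF : ρ ^ (-ξ) ≤ cdf ν (genInv (cdf ν) (ρ ^ (-ξ))) :=
    le_cdf_genInv (Real.rpow_lt_one_of_one_lt_of_neg (by linarith) (by linarith))
  have hS : ρ ^ d / 2 ≤ ((box o ρ).card : ℝ) - 2 := by
    have h1 := le_card_box o h0.le
    have h2 : ρ ^ 1 ≤ ρ ^ d := pow_le_pow_right₀ (by linarith) hd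
    rw [pow_one] at h2
    linarith
  have hmain : ρ ^ ξ / 8 ≤ (((box o ρ).card : ℝ) - 2) *
      (μ.real (Ioi (ρ ^ κ)) * (cdf ν (genInv (cdf ν) (ρ ^ (-ξ))) / 2) ^ 2) := by
    calc ρ ^ ξ / 8 = ρ ^ d / 2 * ((ρ ^ κ) ^ (-q) * (ρ ^ (-ξ) / 2) ^ 2) := by
          have e1 : (ρ ^ (-ξ) / 2) ^ 2 = ρ ^ (-ξ * 2) / 4 := by
            rw [Real.rpow_mul h0.le, Real.rpow_two]; ring
          have e2 : ρ ^ ξ = ρ ^ d * (ρ ^ κ) ^ (-q) * ρ ^ (-ξ * 2) := by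
            rw [← Real.rpow_mul h0.le, ← Real.rpow_natCast ρ d, ← Real.rpow_add h0,
              ← Real.rpow_add h0]
            congr 1
            linarith
          rw [e1, e2]; ring
      _ ≤ _ := by
          have := h.tail
          have hS0 : 0 ≤ ((box o ρ).card : ℝ) - 2 := le_trans (by positivity) hS
          gcongr
  have hnn : (0 : ℝ) ≤ (3 * ρ) ^ d := by positivity
  gcongr

lemma LargeRadius.law_no_hub_le {d : ℕ} (hd : 1 ≤ d) {μ ν : Measure ℝ} [IsProbabilityMeasure μ]
    [IsProbabilityMeasure ν] {κ q ξ ρ : ℝ} (h : LargeRadius d μ κ q ξ ρ)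
    (hξ : 0 < ξ) (hexp : d - κ * q = 3 * ξ) (o : Vert d) :
    law d μ ν {ω | ∀ u ∈ box o ρ, ¬ ρ ^ κ < vertexWeight ω u} ≤ ENNReal.ofReal (1 / ρ) := by
  refine le_trans (measure_mono ?_) (h.law_noMeet_le (ν := ν) hd hξ hexp (B := {o}) (B' := {o})
    ?_ ?_ o)
  · intro ω hω
    exact ⟨o, by simp, o, by simp, fun u hu _ _ hcon => hω u hu hcon.1⟩
  all_goals
    have := h.four_le
    simp only [Finset.card_singleton, Nat.cast_one]
    exact one_le_pow₀ (by linarith)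

/-- The edge-weights in boxes of a fixed radius are tight, uniformly in the centre. -/
lemma exists_edgeWeight_bound {d : ℕ} (μ ν : Measure ℝ) [IsProbabilityMeasure μ]
    [IsProbabilityMeasure ν] {r : ℝ} (hr : 0 ≤ r) {η : ℝ≥0∞} (hη : η ≠ 0) :
    ∃ C : ℝ, 0 ≤ C ∧ ∀ o : Vert d, law d μ ν {ω | ¬ ∀ u ∈ box o r, ∀ v ∈ box o r,
      edgeWeight ω s(u, v) ≤ C} ≤ η := by
  set n := (box (0 : Vert d) r).card with hn
  have hcard : ∀ o : Vert d, (box o r).card = n := fun o => by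
    have h1 := card_box o hr
    rw [← card_box 0 hr] at h1
    exact_mod_cast h1
  have hlim : Tendsto (fun C : ℝ => (n : ℝ≥0∞) * (n * ENNReal.ofReal (1 - cdf ν C))) atTop
      (𝓝 0) := by
    have h1 : Tendsto (fun C : ℝ => ENNReal.ofReal (1 - cdf ν C)) atTop (𝓝 0) := by
      have := (ENNReal.continuous_ofReal.tendsto _).comp
        ((tendsto_const_nhds (x := (1 : ℝ))).sub (tendsto_cdf_atTop ν))
      simpa [Function.comp_def] using this
    have h2 := ENNReal.Tendsto.const_mul (a := (n : ℝ≥0∞)) (ENNReal.Tendsto.const_mul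
      (a := (n : ℝ≥0∞)) h1 (Or.inr (ENNReal.natCast_ne_top n))) (Or.inr (ENNReal.natCast_ne_top n))
    simpa using h2
  obtain ⟨C, hC, hC0⟩ := ((hlim.eventually (gt_mem_nhds (pos_iff_ne_zero.2 hη))).and
    (eventually_ge_atTop 0)).exists
  refine ⟨C, hC0, fun o => le_trans ?_ hC.le⟩
  have hedge : ∀ e : Sym2 (Vert d), law d μ ν {ω | ¬ edgeWeight ω e ≤ C} ≤
      ENNReal.ofReal (1 - cdf ν C) := by
    intro e
    have hmp : MeasurePreserving (fun ω : Sample d => ω.2.2 e) (law d μ ν) ν :=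
      (measurePreserving_eval_infinitePi (fun _ : Sym2 (Vert d) => ν) e).comp
        (measurePreserving_snd.comp (by unfold law; exact measurePreserving_snd))
    have e1 : {ω : Sample d | ¬ edgeWeight ω e ≤ C} = (fun ω : Sample d => ω.2.2 e) ⁻¹' (Iic C)ᶜ :=
      rfl
    rw [e1, hmp.measure_preimage measurableSet_Iic.compl.nullMeasurableSet,
      prob_compl_eq_one_sub measurableSet_Iic, ← ofReal_cdf,
      ENNReal.ofReal_sub _ (cdf_nonneg ν C), ENNReal.ofReal_one]
  have hsub : {ω : Sample d | ¬ ∀ u ∈ box o r, ∀ v ∈ box o r, edgeWeight ω s(u, v) ≤ C} ⊆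
      ⋃ u ∈ box o r, ⋃ v ∈ box o r, {ω | ¬ edgeWeight ω s(u, v) ≤ C} := by
    intro ω hω
    rw [mem_ofPred_eq] at hω
    push Not at hω
    obtain ⟨u, hu, v, hv, h⟩ := hω
    exact mem_biUnion hu (mem_biUnion hv (not_le.2 h))
  calc _ ≤ ∑ u ∈ box o r, ∑ v ∈ box o r, ENNReal.ofReal (1 - cdf ν C) :=
        (measure_mono hsub).trans ((measure_biUnion_finset_le _ _).trans
          (Finset.sum_le_sum fun v _ => (measure_biUnion_finset_le _ _).trans
            (Finset.sum_le_sum fun v' _ => hedge _)))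
    _ = _ := by simp only [Finset.sum_const, nsmul_eq_mul, hcard]

/-- Admissible exponents for the upper bound exist for every growth rate `c < 1 / (γ - 1)`. In the
limiting case `κ = D / β`, `q = β`, the last condition reads `γ < 1 + 1 / c`. -/
lemma exists_hub_exponents {D α β γ c : ℝ} (hD : 0 < D) (hα : D < α) (hγ : γ = α * β / D)
    (hγ1 : 1 < γ) (hc0 : 0 < c) (hc : c < 1 / (γ - 1)) :
    ∃ κ q, 0 < κ ∧ β < q ∧ κ * q < D ∧ α < κ * (1 + 1 / c) := by
  have hα0 : 0 < α := hD.trans hα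
  have hβ : β = D * γ / α := by rw [hγ]; field_simp
  have hβ0 : 0 < β := by rw [hβ]; positivity
  have hg1 : 0 < γ - 1 := by linarith
  have hck : γ < 1 + 1 / c := by
    have : γ - 1 < 1 / c := (lt_one_div hc0 hg1).1 hc
    linarith
  have hα2 : D / β * γ = α := by rw [hβ]; field_simp
  have h1 : ∀ᶠ ε in 𝓝[>] (0 : ℝ), α < D / β * (1 - ε) * (1 + 1 / c) := by
    have hcont : Continuous fun ε : ℝ => D / β * (1 - ε) * (1 + 1 / c) := by fun_prop
    refine (hcont.continuousAt.eventually (lt_mem_nhds ?_)).filter_mono nhdsWithin_le_nhds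
    simp only [sub_zero, mul_one]
    calc α = D / β * γ := hα2.symm
      _ < _ := mul_lt_mul_of_pos_left hck (by positivity)
  have h2 : ∀ᶠ ε in 𝓝[>] (0 : ℝ), ε < 1 :=
    (eventually_lt_nhds one_pos).filter_mono nhdsWithin_le_nhds
  obtain ⟨ε, e1, e2, e3⟩ := (h1.and (h2.and self_mem_nhdsWithin)).exists
  have hε0 : 0 < ε := e3
  refine ⟨D / β * (1 - ε), β * (1 + ε), ?_, by nlinarith, ?_, e1⟩
  · exact mul_pos (by positivity) (by linarith)
  · have : D / β * (1 - ε) * (β * (1 + ε)) = D * (1 - ε ^ 2) := by field_simp; ring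
    rw [this]
    nlinarith [pow_pos hε0 2]

lemma abs_floorVert_le {d : ℕ} {e : EuclideanSpace ℝ (Fin d)} (he : ‖e‖ = 1) {m : ℝ}
    (hm : 1 ≤ m) (i : Fin d) : |(floorVert (m • e) i : ℝ)| ≤ 2 * m := by
  have h1 := abs_floorVert_sub_le (m • e) i
  have h2 : |(m • e) i| ≤ m := by
    have := PiLp.norm_apply_le (m • e) i
    rwa [norm_smul, he, mul_one, Real.norm_eq_abs, Real.norm_of_nonneg (by linarith)] at this
  rw [abs_le] at *
  constructor <;> linarith [h1.1, h1.2, h2.1, h2.2]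

lemma log_log_two_mul_le {m : ℝ} (hm : Real.exp 1 ≤ m) :
    Real.log (Real.log (2 * m)) ≤ Real.log (Real.log m) + 1 := by
  have h0 : 0 < m := (Real.exp_pos 1).trans_le hm
  have h1 : 1 ≤ Real.log m := by rwa [Real.le_log_iff_exp_le h0]
  have h2 : Real.log (2 * m) ≤ Real.exp 1 * Real.log m := by
    rw [Real.log_mul two_ne_zero h0.ne']
    have e1 := Real.add_one_le_exp 1
    have e2 := Real.log_two_lt_d9
    nlinarith
  have h3 : 0 < Real.log (2 * m) := by
    rw [Real.log_mul two_ne_zero h0.ne']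
    have := Real.log_nonneg (one_le_two (α := ℝ))
    linarith
  calc _ ≤ Real.log (Real.exp 1 * Real.log m) := Real.log_le_log h3 h2
    _ = _ := by
      rw [Real.log_mul (Real.exp_pos 1).ne' (by linarith), Real.log_exp, add_comm]

/-- This allows the last radius of the hub construction to be prescribed, while the parameter `s` of
the first one stays in a bounded range. -/
lemma exists_eq_mul_pow {c A₀ L : ℝ} (hc : 1 < c) (hA₀ : 0 < A₀) (hL : c * A₀ ≤ L) :
    ∃ (J : ℕ) (s : ℝ), A₀ ≤ s ∧ s ≤ c * A₀ ∧ s * c ^ (J + 1) = L := by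
  obtain ⟨N, hN1, hN2⟩ := exists_nat_pow_near ((one_le_div hA₀).2
    (le_trans (le_mul_of_one_le_left hA₀.le hc.le) hL)) hc
  have hN : N ≠ 0 := by
    rintro rfl
    rw [zero_add, pow_one, div_lt_iff₀ hA₀] at hN2
    linarith
  obtain ⟨J, rfl⟩ := Nat.exists_eq_succ_of_ne_zero hN
  have hpos : 0 < c ^ (J + 1) := by positivity
  refine ⟨J, L / c ^ (J + 1), ?_, ?_, div_mul_cancel₀ _ hpos.ne'⟩
  · rw [le_div_iff₀ hpos]
    rw [le_div_iff₀ hA₀] at hN1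
    rwa [mul_comm]
  · rw [div_le_iff₀ hpos]
    rw [div_lt_iff₀ hA₀, pow_succ] at hN2
    nlinarith

/-- Union bound over all the bad events of the hub construction, for radii growing doubly
exponentially. -/
lemma law_bad_hubs_le {d : ℕ} (hd : 1 ≤ d) {μ ν : Measure ℝ} [IsProbabilityMeasure μ]
    [IsProbabilityMeasure ν] {κ q ξ c s : ℝ} (hc : 1 < c) (hs : 0 < s)
    (hlarge : ∀ ρ, Real.exp s ≤ ρ → LargeRadius d μ κ q ξ ρ)
    (hξ : 0 < ξ) (hexp : d - κ * q = 3 * ξ) (o o' : Vert d) (J : ℕ) {ρ t : ℕ → ℝ}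
    (hρ : ∀ i, ρ i = Real.exp (s * c ^ i)) (ht : ∀ i, t i = genInv (cdf ν) (ρ (i + 1) ^ (-ξ))) :
    law d μ ν (({ω | ∀ u ∈ box o (ρ 0), ¬ ρ 0 ^ κ < vertexWeight ω u} ∪
      {ω | ∀ u ∈ box o' (ρ 0), ¬ ρ 0 ^ κ < vertexWeight ω u}) ∪
      (((⋃ i, noMeet (box o (ρ i)) (box o (ρ i)) (box o (ρ (i + 1))) (ρ (i + 1) ^ κ) (t i)) ∪
      ⋃ i, noMeet (box o' (ρ i)) (box o' (ρ i)) (box o' (ρ (i + 1))) (ρ (i + 1) ^ κ) (t i)) ∪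
      noMeet (box o (ρ J)) (box o' (ρ J)) (box o (ρ (J + 1))) (ρ (J + 1) ^ κ) (t J))) ≤
    5 * ∑' k : ℕ, ENNReal.ofReal (Real.exp (-(s * c ^ k))) := by
  set E : ℕ → ℝ≥0∞ := fun k => ENNReal.ofReal (Real.exp (-(s * c ^ k))) with hE
  have hEρ : ∀ i, ENNReal.ofReal (1 / ρ i) = E i := fun i => by
    simp only [hE]; rw [hρ, Real.exp_neg, one_div]
  have hmono : ∀ i, ρ i ≤ ρ (i + 1) := fun i => by
    rw [hρ, hρ]
    exact Real.exp_le_exp.2 (mul_le_mul_of_nonneg_left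
      (pow_le_pow_right₀ hc.le (Nat.le_succ i)) hs.le)
  have hL : ∀ i, LargeRadius d μ κ q ξ (ρ i) := fun i => hlarge _ (by
    rw [hρ]
    exact Real.exp_le_exp.2 (le_mul_of_one_le_right hs.le (one_le_pow₀ hc.le)))
  have hcard : ∀ (a : Vert d) i, ((box a (ρ i)).card : ℝ) ≤ (3 * ρ (i + 1)) ^ d := fun a i => by
    have h4 := (hL i).four_le
    have := hmono i
    exact (card_box_le a (by linarith)).trans (pow_le_pow_left₀ (by linarith) (by linarith) d)
  have hmeet : ∀ (a b : Vert d) i, law d μ ν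
      (noMeet (box a (ρ i)) (box b (ρ i)) (box a (ρ (i + 1))) (ρ (i + 1) ^ κ) (t i)) ≤
      E (i + 1) := fun a b i => by
    rw [ht, ← hEρ]
    exact (hL (i + 1)).law_noMeet_le hd hξ hexp (hcard a i) (hcard b i) a
  have hhub : ∀ a : Vert d, law d μ ν {ω | ∀ u ∈ box a (ρ 0), ¬ ρ 0 ^ κ < vertexWeight ω u} ≤
      ∑' k, E k := fun a => by
    refine ((hL 0).law_no_hub_le hd hξ hexp a).trans ?_
    rw [hEρ]
    exact ENNReal.le_tsum 0
  have hshift : ∑' n, E (n + 1) ≤ ∑' k, E k :=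
    ENNReal.tsum_comp_le_tsum_of_injective (add_left_injective 1) E
  have hclimb : ∀ a : Vert d, law d μ ν (⋃ i, noMeet (box a (ρ i)) (box a (ρ i))
      (box a (ρ (i + 1))) (ρ (i + 1) ^ κ) (t i)) ≤ ∑' k, E k := fun a =>
    (measure_iUnion_le _).trans ((ENNReal.tsum_le_tsum fun i => hmeet a a i).trans hshift)
  calc _ ≤ ((∑' k, E k) + ∑' k, E k) + (((∑' k, E k) + ∑' k, E k) + ∑' k, E k) :=
        (measure_union_le _ _).trans (add_le_add
          ((measure_union_le _ _).trans (add_le_add (hhub o) (hhub o')))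
          ((measure_union_le _ _).trans (add_le_add
            ((measure_union_le _ _).trans (add_le_add (hclimb o) (hclimb o')))
            ((hmeet o o' J).trans (ENNReal.le_tsum _)))))
    _ = _ := by ring

/-- With probability arbitrarily close to one, the `L`-distance is at most the integral of the
profile, divided by any rate `a` smaller than `|log (γ - 1)|`, up to an additive constant. -/
theorem distL_upper_bound {d : ℕ} (hd : 1 ≤ d) {α lam τ γ : ℝ} (hα : (d : ℝ) < α)
    (hlam : 0 < lam) (hτ : 1 < τ)
    (hγdef : γ = α * (τ - 1) / d) (hγ1 : 1 < γ) (hγ2 : γ < 2)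
    (μ : Measure ℝ) [IsProbabilityMeasure μ] (hμ : PowerLawTail μ τ)
    (ν : Measure ℝ) [IsProbabilityMeasure ν] (hν0 : ν (Iio 0) = 0)
    {e : EuclideanSpace ℝ (Fin d)} (he : ‖e‖ = 1) {a : ℝ} (ha0 : 0 < a)
    (ha : a < |Real.log (γ - 1)|) {η : ℝ≥0∞} (hη : η ≠ 0) :
    ∃ C : ℝ, ∀ᶠ m : ℝ in atTop,
      law d μ ν {ω | ENNReal.ofReal
          (2 / a * (∫ x in (0 : ℝ)..Real.log (Real.log m), profile ν x) + C) <
        distL lam α ω 0 (floorVert (m • e))} ≤ η := by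
  have hd' : (0 : ℝ) < d := by exact_mod_cast hd
  have hα0 : 0 < α := hd'.trans hα
  have hg1 : 0 < γ - 1 := by linarith
  -- the growth rate of the logarithms of the radii
  set c := Real.exp a with hc
  have hc0 : 0 < c := Real.exp_pos a
  have hcγ : c < 1 / (γ - 1) := by
    have hlog : Real.log (γ - 1) < 0 := Real.log_neg hg1 (by linarith)
    rw [abs_of_neg hlog] at ha
    rw [hc, ← Real.exp_log (one_div_pos.2 hg1), Real.exp_lt_exp, one_div, Real.log_inv]
    exact ha
  have hc1 : 1 < c := Real.one_lt_exp_iff.2 ha0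
  obtain ⟨κ, q, hκ, hq, hκq, hκα⟩ := exists_hub_exponents hd' hα hγdef hγ1 hc0 hcγ
  obtain ⟨ξ, hexp⟩ : ∃ ξ, (d : ℝ) - κ * q = 3 * ξ := ⟨(d - κ * q) / 3, by ring⟩
  have hξ : 0 < ξ := by linarith
  -- the product of the weights of consecutive hubs beats the distance between them
  have hconn : ∀ᶠ ρ : ℝ in atTop,
      (d * (3 * ρ)) ^ α ≤ lam * ((ρ ^ (1 / c)) ^ κ * ρ ^ κ) := by
    filter_upwards [(tendsto_rpow_atTop (sub_pos.2 hκα)).eventually_ge_atTop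
      ((d * 3) ^ α / lam), eventually_gt_atTop 0] with ρ h1 h0
    rw [div_le_iff₀ hlam] at h1
    have e1 : (ρ ^ (1 / c)) ^ κ * ρ ^ κ = ρ ^ (κ * (1 + 1 / c) - α) * ρ ^ α := by
      rw [← Real.rpow_mul h0.le, ← Real.rpow_add h0, ← Real.rpow_add h0]
      congr 1; ring
    rw [e1, ← mul_assoc (d : ℝ), Real.mul_rpow (by positivity) h0.le, ← mul_assoc, mul_comm lam]
    exact mul_le_mul_of_nonneg_right h1 (by positivity)
  obtain ⟨ρs, hρs⟩ := eventually_atTop.1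
    ((eventually_largeRadius (d := d) hμ hτ hq hκ hξ).and hconn)
  have hη4 : η / 2 / 2 ≠ 0 := (ENNReal.half_pos (ENNReal.half_pos hη).ne').ne'
  obtain ⟨A₁, hA₁⟩ := eventually_atTop.1
    (eventually_tsum_le (q := 1) (κ := 1) zero_le_one one_pos hc1 hη4)
  obtain ⟨A₀, hA₀1, hA₀2, hA₀3, hA₀ξ⟩ := ((eventually_ge_atTop A₁).and
    ((eventually_gt_atTop 0).and ((Real.tendsto_exp_atTop.eventually_ge_atTop ρs).and
    (eventually_ge_atTop (1 / ξ))))).exists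
  -- an upper bound, independent of `m`, for the radius of the first box
  set r := Real.exp (c * A₀) with hr
  obtain ⟨C₁, hC₁0, hC₁⟩ := exists_edgeWeight_bound (d := d) μ ν (Real.exp_pos (c * A₀)).le hη4
  set X := (d : ℝ) * r * C₁ with hX
  have hX0 : 0 ≤ X := mul_nonneg (mul_nonneg hd'.le (Real.exp_pos _).le) hC₁0
  have hanti := profile_antitone hν0
  have hnn := profile_nonneg hν0
  refine ⟨2 * X + 2 / a * ((|Real.log ξ| + 1) * profile ν 0), ?_⟩
  have hlog2 : Tendsto (fun m : ℝ => Real.log (2 * m)) atTop atTop :=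
    Real.tendsto_log_atTop.comp (tendsto_id.const_mul_atTop two_pos)
  filter_upwards [hlog2.eventually_ge_atTop (c * A₀), eventually_ge_atTop (Real.exp 1),
    eventually_ge_atTop 1,
    (Real.tendsto_log_atTop.comp Real.tendsto_log_atTop).eventually_ge_atTop 0]
    with m hmL hme hm1 hmT
  simp only [Function.comp] at hmT
  set T := Real.log (Real.log m)
  obtain ⟨J, s, hs1, hs2, hsJ⟩ := exists_eq_mul_pow hc1 hA₀2 hmL
  have hs0 : 0 < s := by linarith
  set ρ : ℕ → ℝ := fun i => Real.exp (s * c ^ i) with hρdef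
  set t : ℕ → ℝ := fun i => genInv (cdf ν) (ρ (i + 1) ^ (-ξ)) with htdef
  have hρ0 : ∀ i, 0 < ρ i := fun i => Real.exp_pos _
  have hρmono : Monotone ρ := fun i j hij => Real.exp_le_exp.2
    (mul_le_mul_of_nonneg_left (pow_le_pow_right₀ hc1.le hij) hs0.le)
  have hρge : ∀ i, Real.exp s ≤ ρ i := fun i =>
    Real.exp_le_exp.2 (le_mul_of_one_le_right hs0.le (one_le_pow₀ hc1.le))
  have hexps : ρs ≤ Real.exp s := hA₀3.trans (Real.exp_le_exp.2 hs1)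
  have ht0 : ∀ i, 0 ≤ t i := fun i => genInv_nonneg hν0 (Real.rpow_pos_of_pos (hρ0 _) _)
  have hρJ : ρ (J + 1) = 2 * m := by
    simp only [hρdef]
    rw [hsJ, Real.exp_log (by linarith)]
  have hρr : ρ 0 ≤ r := by
    simp only [hρdef, pow_zero, mul_one]
    exact Real.exp_le_exp.2 hs2
  have hρconn : ∀ i, (d * (3 * ρ (i + 1))) ^ α ≤ lam * (ρ i ^ κ * ρ (i + 1) ^ κ) := by
    intro i
    have h1 := (hρs (ρ (i + 1)) (hexps.trans (hρge _))).2
    have h2 : ρ (i + 1) ^ (1 / c) = ρ i := by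
      simp only [hρdef]
      rw [← Real.exp_mul, pow_succ]
      congr 1
      field_simp
    rwa [h2] at h1
  -- the cost of the climb in terms of the integral of the profile
  have hcost : 2 * X + 2 * ∑ i ∈ Finset.range (J + 1), t i ≤
      2 / a * (∫ x in (0 : ℝ)..T, profile ν x) +
        (2 * X + 2 / a * ((|Real.log ξ| + 1) * profile ν 0)) := by
    have hξs : 1 ≤ ξ * s := by
      have := (div_le_iff₀ hξ).1 (hA₀ξ.trans hs1)
      linarith
    set b := Real.log (ξ * s) with hb
    have hprof : ∀ i, t i = profile ν (b + (i + 1) * a) := by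
      intro i
      simp only [htdef, hρdef]
      rw [profile, Real.exp_add, hb, Real.exp_log (by linarith), ← Real.exp_mul]
      have : Real.exp ((i + 1) * a) = c ^ (i + 1) := by
        rw [hc, ← Real.exp_nat_mul]; push_cast; rfl
      rw [this]
      congr 2
      ring
    have hend : b + ((J + 1 : ℕ) : ℝ) * a ≤ T + (|Real.log ξ| + 1) := by
      have h1 : ((J + 1 : ℕ) : ℝ) * a = Real.log (c ^ (J + 1)) := by
        rw [Real.log_pow, hc, Real.log_exp]
      have h2 : 0 < c ^ (J + 1) := by positivity
      rw [h1, hb, ← Real.log_mul (by positivity) h2.ne', mul_assoc, hsJ,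
        Real.log_mul hξ.ne' (lt_of_lt_of_le (by positivity) hmL).ne']
      have h3 := log_log_two_mul_le hme
      have h4 := le_abs_self (Real.log ξ)
      linarith
    have i1 := sum_le_integral_of_antitone hanti ha0 b (J + 1)
    have i2 := integral_shift_le hanti hnn (b := b) (T := b + ((J + 1 : ℕ) : ℝ) * a) (U := T)
      (s := |Real.log ξ| + 1) (Real.log_nonneg hξs) hmT (by positivity) hend
    have i3 := mul_le_mul_of_nonneg_left i2 (by positivity : 0 ≤ 1 / a)
    rw [Finset.sum_congr rfl fun i _ => hprof i]
    have i4 : 2 / a * (∫ x in (0 : ℝ)..T, profile ν x) +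
        2 / a * ((|Real.log ξ| + 1) * profile ν 0) =
        2 * (1 / a * ((∫ x in (0 : ℝ)..T, profile ν x) + (|Real.log ξ| + 1) * profile ν 0)) := by
      ring
    linarith
  set x := floorVert (m • e) with hx
  set bad := (({ω : Sample d | ∀ u ∈ box 0 (ρ 0), ¬ ρ 0 ^ κ < vertexWeight ω u} ∪
      {ω | ∀ u ∈ box x (ρ 0), ¬ ρ 0 ^ κ < vertexWeight ω u}) ∪
      (((⋃ i, noMeet (box 0 (ρ i)) (box 0 (ρ i)) (box 0 (ρ (i + 1))) (ρ (i + 1) ^ κ) (t i)) ∪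
      ⋃ i, noMeet (box x (ρ i)) (box x (ρ i)) (box x (ρ (i + 1))) (ρ (i + 1) ^ κ) (t i)) ∪
      noMeet (box 0 (ρ J)) (box x (ρ J)) (box 0 (ρ (J + 1))) (ρ (J + 1) ^ κ) (t J))) with hbad
  have hsub : {ω | ENNReal.ofReal (2 / a * (∫ x in (0 : ℝ)..T, profile ν x) +
        (2 * X + 2 / a * ((|Real.log ξ| + 1) * profile ν 0))) < distL lam α ω 0 x} ⊆
      bad ∪ ({ω | ¬ ∀ u ∈ box 0 r, ∀ v ∈ box 0 r, edgeWeight ω s(u, v) ≤ C₁} ∪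
        {ω | ¬ ∀ u ∈ box x r, ∀ v ∈ box x r, edgeWeight ω s(u, v) ≤ C₁}) := by
    intro ω hω
    by_contra hcon
    simp only [hbad, mem_union, not_or, mem_iUnion, not_exists] at hcon
    obtain ⟨⟨⟨h1, h2⟩, ⟨h3, h4⟩, h5⟩, h6, h7⟩ := hcon
    have hstart : ∀ o : Vert d, ¬ (ω ∈ {ω | ∀ u ∈ box o (ρ 0), ¬ ρ 0 ^ κ < vertexWeight ω u}) →
        ¬ (ω ∈ {ω | ¬ ∀ u ∈ box o r, ∀ v ∈ box o r, edgeWeight ω s(u, v) ≤ C₁}) →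
        ∃ v ∈ box o (ρ 0), ρ 0 ^ κ < vertexWeight ω v ∧
          distL lam α ω o v ≤ ENNReal.ofReal X := by
      intro o g1 g2
      simp only [mem_ofPred_eq, not_forall, not_not] at g1
      obtain ⟨v, hv, hvW⟩ := g1
      refine ⟨v, hv, hvW, distL_le_of_mem_box hC₁0 (not_not.1 g2) ?_⟩
      rw [mem_box] at hv ⊢
      exact fun i => (hv i).trans hρr
    have hfin := distL_le_of_notMem_noMeet hα0.le hlam hρ0 hρmono (fun i _ => hρconn i)
      (fun i _ => h3 i) (fun i _ => h4 i) h5 ht0 hX0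
      (fun i => by
        rw [hρJ, Pi.zero_apply, Int.cast_zero, sub_zero]
        exact abs_floorVert_le he hm1 i) (hstart 0 h1 h6) (hstart x h2 h7)
    exact absurd (lt_of_lt_of_le hω (hfin.trans (ENNReal.ofReal_le_ofReal hcost))) (lt_irrefl _)
  have hE : 3 * ∑' k : ℕ, ENNReal.ofReal (Real.exp (-(s * c ^ k))) ≤ η / 2 / 2 := by
    have := hA₁ s (hA₀1.trans hs1)
    simpa using this
  calc _ ≤ _ := measure_mono hsub
    _ ≤ 5 * ∑' k : ℕ, ENNReal.ofReal (Real.exp (-(s * c ^ k))) + (η / 2 / 2 + η / 2 / 2) :=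
      (measure_union_le _ _).trans (add_le_add
        (law_bad_hubs_le hd hc1 hs0 (fun ρ hρ => (hρs ρ (hexps.trans hρ)).1) hξ hexp 0 x J
          (fun _ => rfl) fun _ => rfl)
        ((measure_union_le _ _).trans (add_le_add (hC₁ 0) (hC₁ x))))
    _ ≤ (3 * ∑' k : ℕ, ENNReal.ofReal (Real.exp (-(s * c ^ k))) +
        3 * ∑' k : ℕ, ENNReal.ofReal (Real.exp (-(s * c ^ k)))) + (η / 2 / 2 + η / 2 / 2) := by
      gcongr
      rw [← add_mul]
      gcongr
      norm_num
    _ ≤ (η / 2 / 2 + η / 2 / 2) + (η / 2 / 2 + η / 2 / 2) := by gcongr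
    _ = η := by rw [ENNReal.add_halves, ENNReal.add_halves]

end ScaleFreePercolation

theorem mainTheorem2 (d : ℕ) (hd : 1 ≤ d) (α lam τ γ : ℝ)
    (hα : (d : ℝ) < α) (hlam : 0 < lam) (hτ : 1 < τ)
    (hγdef : γ = α * (τ - 1) / d) (hγ1 : 1 < γ) (hγ2 : γ < 2)
    (μ : Measure ℝ) [IsProbabilityMeasure μ]
    (hμ1 : μ (Iio 1) = 0) (hμ : ScaleFreePercolation.PowerLawTail μ τ)
    (ν : Measure ℝ) [IsProbabilityMeasure ν]
    (hν0 : ν (Iio 0) = 0) (hν : ScaleFreePercolation.explosionIntegral ν = ⊤)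
    (e : EuclideanSpace ℝ (Fin d)) (he : ‖e‖ = 1) :
    TendstoInMeasure (ScaleFreePercolation.law d μ ν)
      (fun (m : ℝ) (ω : ScaleFreePercolation.Sample d) =>
        (ScaleFreePercolation.distL lam α ω 0 (ScaleFreePercolation.floorVert (m • e))).toReal /
          ScaleFreePercolation.normalisation ν γ m)
      atTop (fun _ => (1 : ℝ)) := by
  refine tendstoInMeasure_of_ne_top fun ε hε hεtop => ?_
  rw [ENNReal.tendsto_nhds_zero]
  intro η hη
  set δ := ε.toReal with hδdef
  have hδ : 0 < δ := ENNReal.toReal_pos hε.ne' hεtop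
  set a₀ := |Real.log (γ - 1)| with ha₀def
  have ha₀ : 0 < a₀ :=
    abs_pos.2 (Real.log_neg (by linarith) (by linarith)).ne
  have hδ1 : 1 < 1 + δ / 4 := by linarith
  have hη2 : η / 2 ≠ 0 := (ENNReal.half_pos hη.ne').ne'
  obtain ⟨C₀, hC₀⟩ := ScaleFreePercolation.normalisation_bounds hν0 hγ1 hγ2
  obtain ⟨C₁, hC₁⟩ := ScaleFreePercolation.distL_lower_bound (lam := lam) hd hα hγdef hγ1 hγ2
    μ hμ1 hμ ν hν0 he (lt_mul_of_one_lt_right ha₀ hδ1) hη2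
  obtain ⟨C₂, hC₂⟩ := ScaleFreePercolation.distL_upper_bound hd hα hlam hτ hγdef hγ1 hγ2
    μ hμ ν hν0 he (div_pos ha₀ (by linarith)) (div_lt_self ha₀ hδ1) hη2
  have hH := (ScaleFreePercolation.tendsto_integral_of_lintegral_eq_top
    (ScaleFreePercolation.profile_antitone hν0) (ScaleFreePercolation.profile_nonneg hν0)
    hν).comp (Real.tendsto_log_atTop.comp Real.tendsto_log_atTop)
  have hG : Tendsto (fun m : ℝ => 2 / a₀ *
      ∫ x in (0 : ℝ)..Real.log (Real.log m), ScaleFreePercolation.profile ν x) atTop atTop :=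
    hH.const_mul_atTop (by positivity)
  filter_upwards [hC₀, hC₁, hC₂, hG.eventually_gt_atTop C₀, hG.eventually_gt_atTop 0,
    hG.eventually_gt_atTop ((|C₂| + (1 + δ) * C₀) / (3 * δ / 4)),
    hG.eventually_gt_atTop ((C₁ + |1 - δ| * C₀) / (3 * δ / 4))] with m h0 h1 h2 g1 g2 g3 g4
  set G := 2 / a₀ * ∫ x in (0 : ℝ)..Real.log (Real.log m), ScaleFreePercolation.profile ν x
    with hGdef
  set N := ScaleFreePercolation.normalisation ν γ m with hN
  have e1 : 2 / (a₀ * (1 + δ / 4)) *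
      (∫ x in (0 : ℝ)..Real.log (Real.log m), ScaleFreePercolation.profile ν x) =
      G / (1 + δ / 4) := by
    rw [hGdef]; field_simp
  have e2 : 2 / (a₀ / (1 + δ / 4)) *
      (∫ x in (0 : ℝ)..Real.log (Real.log m), ScaleFreePercolation.profile ν x) =
      (1 + δ / 4) * G := by
    rw [hGdef]; field_simp
  rw [e1] at h1
  rw [e2] at h2
  have hN1 := (abs_le.1 h0).1
  have hN2 := (abs_le.1 h0).2
  have hNpos : 0 < N := by linarith
  have e3 : (1 - δ / 4) * G ≤ G / (1 + δ / 4) := by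
    rw [le_div_iff₀ (by linarith)]
    nlinarith [mul_pos hδ hδ, mul_nonneg (mul_pos hδ hδ).le g2.le]
  rw [div_lt_iff₀ (by positivity)] at g3 g4
  have hC₂' := le_abs_self C₂
  -- both estimates are closer to the normalisation than a factor `1 ± δ`
  have hup : (1 + δ / 4) * G + |C₂| < (1 + δ) * N := by
    have : (1 + δ) * (G - C₀) ≤ (1 + δ) * N :=
      mul_le_mul_of_nonneg_left (by linarith) (by linarith)
    nlinarith
  have hlo : (1 - δ) * N < G / (1 + δ / 4) - C₁ := by
    have h3 : (1 - δ) * (N - G) ≤ |1 - δ| * C₀ :=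
      (le_abs_self _).trans ((abs_mul _ _).le.trans
        (mul_le_mul_of_nonneg_left h0 (abs_nonneg _)))
    nlinarith
  refine (measure_mono (t := _ ∪ _) ?_).trans
    ((measure_union_le _ _).trans ((add_le_add h1 h2).trans (ENNReal.add_halves η).le))
  intro ω hω
  by_contra hcon
  simp only [mem_union, mem_ofPred_eq, not_or, not_lt] at hcon
  obtain ⟨k1, k2⟩ := hcon
  set D := ScaleFreePercolation.distL lam α ω 0 (ScaleFreePercolation.floorVert (m • e))
  have hDtop : D ≠ ⊤ := ne_top_of_le_ne_top ENNReal.ofReal_ne_top k2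
  have k3 : G / (1 + δ / 4) - C₁ ≤ D.toReal := (ENNReal.ofReal_le_iff_le_toReal hDtop).1 k1
  have k4 : D.toReal ≤ (1 + δ / 4) * G + |C₂| :=
    ENNReal.toReal_le_of_le_ofReal (by positivity)
      (k2.trans (ENNReal.ofReal_le_ofReal (by linarith)))
  have hlt : |D.toReal / N - 1| < δ := by
    rw [abs_lt, lt_sub_iff_add_lt, sub_lt_iff_lt_add, lt_div_iff₀ hNpos, div_lt_iff₀ hNpos]
    constructor <;> linarith
  rw [mem_ofPred_eq, edist_dist, Real.dist_eq, ← ENNReal.ofReal_toReal hεtop] at hω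
  exact absurd ((ENNReal.ofReal_le_ofReal_iff (abs_nonneg _)).1 hω) (not_le.2 hlt)
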